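/- Let $d\ge 2$ and let $\mathbb B^d$ be the set of nonoriented nearest-neighbour bonds of $\mathbb Z^d$. Let $p\in(1,\infty)$ and $q\in(\frac d2,\infty)$ satisfy $\frac1p+\frac1q<\frac2{d-1}$, and set $$\delta_1:=\frac2{d-1}-\frac1p-\frac1q,\qquad \delta_2:=\frac2d-\frac1q,\qquad \theta:=\begin{cases}p&\text{if }d=2,\\1+p\,\delta_1&\text{if }d\ge3,\end{cases}\qquad \nu:=1-\delta_2\Bigl(1-\frac1\theta\Bigr).$$ For $x_0\in\mathbb Z^d$ and $r\ge0$ let $B(x_0,r):=x_0+([-r,r]\cap\mathbb Z)^d$, and for $t_0\in\mathbb R$, $\tau>0$, $n\ge 0$, $\sigma\in(0,1]$ let $$Q_\sigma(t_0,x_0,\tau,n):=[t_0-\sigma\tau n^2,t_0]\times B(x_0,\sigma n).$$ Given conductances $\omega:\mathbb B^d\to(0,\infty)$, let $(\mathcal L^\omega v)(x):=\sum_{y:\{x,y\}\in\mathbb B^d}\omega(\{x,y\})(v(y)-v(x))$. A function $u:\mathbb R\times\mathbb Z^d\to\mathbb R$ is called subcaloric in $Q=I\times V$ if at all $(t,x)\in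 Q$ it is differentiable in time (one-sided at the end-points of $I$) with $\partial_tu-\mathcal L^\omega u\le0$. For a finite $S\subset\mathbb Z^d$ let $S_{\mathbb B^d}$ be the set of bonds with both end-points in $S$, and for $F:\mathbb B^d\to\mathbb R$ and $r\in(0,\infty)$ let $$\|F\|_{\underline L^r(S)}:=\Bigl(\frac1{|S_{\mathbb B^d}|}\sum_{e\in S_{\mathbb B^d}}|F(e)|^r\Bigr)^{1/r}.$$ For a compact interval $I$ let $\|u\|_{L^\infty(I\times S)}:=\sup_{I\times S}|u|$ and $\|u\|_{\underline L^2(I\times S)}:=\bigl(\frac1{|I||S|}\int_I\sum_{x\in S}|u(t,x)|^2\,dt\bigr)^{1/2}$. Finally let $$\mathcal C(\omega,S,\tau):=\max\Bigl\{1,\ \tau^{\frac12}\Bigl(\|\omega^{-1}\|_{\underline L^q(S)}\bigl(\|\omega\|_{\underline L^p(S)}+\tau^{-1}\bigr)^{2-\nu}\Bigr)^{\frac1{2(1-\nu)}}\Bigr\}.$$ Then $\nu\in(0,1)$, and there exists a constant $c\in[1,\infty)$ depending only on $d$, $p$, $q$ such that the following is true: for all conductances $\omega:\mathbb B^d\to(0,\infty)$,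 all $t_0\in\mathbb R$, $x_0\in\mathbb Z^d$, $\tau>0$, all real $n\ge2^{20}$, and every $u$ that is subcaloric and positive in $Q_1(t_0,x_0,\tau,n)$, the function $u$ is bounded on $Q_{\frac12}(t_0,x_0,\tau,n)$ and $$\|u\|_{L^\infty(Q_{\frac12}(t_0,x_0,\tau,n))}\le c\,\mathcal C(\omega,B(x_0,n),\tau)^{\frac p{p-1}}\,\|u\|_{\underline L^2(Q_1(t_0,x_0,\tau,n))}.$$ -/

import Mathlib

namespace RCM

noncomputable section

/-- The nearest-neighbour graph of the lattice `ℤ^d`: the sites `x` and `y` are joined by a bond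
if and only if their Euclidean distance is one. -/
def lattice (d : ℕ) : SimpleGraph (Fin d → ℤ) where
  Adj x y := ∑ i, (x i - y i) ^ 2 = 1
  symm := ⟨fun x y h => by
    rw [← h]
    exact Finset.sum_congr rfl fun i _ => by ring⟩
  loopless := ⟨fun x h => by simp at h⟩

/-- `ω` is an environment of conductances: it is positive on every (nonoriented) bond.
The values of `ω` on unordered pairs that are not bonds are never used below. -/
def IsConductance {d : ℕ} (ω : Sym2 (Fin d → ℤ) → ℝ) : Prop :=
  ∀ e ∈ (lattice d).edgeSet, 0 < ω e

/-- The generator `(L^ω v)(x) = ∑_{y ∼ x} ω(x,y) (v(y) - v(x))`; the sum is over the finitely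
many neighbours `y` of `x`. -/
def generator {d : ℕ} (ω : Sym2 (Fin d → ℤ) → ℝ) (v : (Fin d → ℤ) → ℝ) (x : Fin d → ℤ) : ℝ :=
  ∑ᶠ y ∈ (lattice d).neighborSet x, ω s(x, y) * (v y - v x)

/-- The box `B(x₀, r) = x₀ + ([-r, r] ∩ ℤ)^d` for a real radius `r`. -/
def box {d : ℕ} (x₀ : Fin d → ℤ) (r : ℝ) : Finset (Fin d → ℤ) :=
  Fintype.piFinset fun i => Finset.Icc (x₀ i - ⌊r⌋) (x₀ i + ⌊r⌋)

open scoped Classical in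
/-- The bonds both of whose end-points lie in the finite set `S` of sites. -/
def bonds {d : ℕ} (S : Finset (Fin d → ℤ)) : Finset (Sym2 (Fin d → ℤ)) :=
  S.sym2.filter fun e => e ∈ (lattice d).edgeSet

/-- The averaged norm `(|S_𝔹|⁻¹ ∑_{e ∈ S_𝔹} |F(e)|^r)^{1/r}` over the bonds `S_𝔹` of `S`. -/
def bondNorm {d : ℕ} (r : ℝ) (S : Finset (Fin d → ℤ)) (F : Sym2 (Fin d → ℤ) → ℝ) : ℝ :=
  (((bonds S).card : ℝ)⁻¹ * ∑ e ∈ bonds S, |F e| ^ r) ^ (1 / r)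

/-- `u` is subcaloric in `I × S`: at every time of `I` and every site of `S` it is differentiable
in time (one-sided at an end-point of `I`) and satisfies `∂_t u - L^ω u ≤ 0`. -/
def IsSubcaloric {d : ℕ} (ω : Sym2 (Fin d → ℤ) → ℝ) (u : ℝ → (Fin d → ℤ) → ℝ)
    (I : Set ℝ) (S : Finset (Fin d → ℤ)) : Prop :=
  ∀ t ∈ I, ∀ x ∈ S, DifferentiableWithinAt ℝ (fun s => u s x) I t ∧
    derivWithin (fun s => u s x) I t - generator ω (u t) x ≤ 0

/-- The time interval `[t₀ - σ τ n², t₀]` of the parabolic cylinder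
`Q_σ(t₀, x₀, τ, n) = [t₀ - σ τ n², t₀] × B(x₀, σ n)`. -/
def timeInterval (σ t₀ τ n : ℝ) : Set ℝ := Set.Icc (t₀ - σ * τ * n ^ 2) t₀

/-- The set of the values `|u(t,x)|` with `(t,x) ∈ I × S`. -/
def absValues {d : ℕ} (u : ℝ → (Fin d → ℤ) → ℝ) (I : Set ℝ) (S : Finset (Fin d → ℤ)) : Set ℝ :=
  {a | ∃ t ∈ I, ∃ x ∈ S, a = |u t x|}

/-- The norm `‖u‖_{L^∞(I × S)} = sup_{I × S} |u|` (meaningful if `absValues u I S` is bounded). -/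
def supNorm {d : ℕ} (u : ℝ → (Fin d → ℤ) → ℝ) (I : Set ℝ) (S : Finset (Fin d → ℤ)) : ℝ :=
  sSup (absValues u I S)

/-- The averaged norm `((|I| |S|)⁻¹ ∫_I ∑_{x ∈ S} |u(t,x)|² dt)^{1/2}` over `I × S`. -/
def avgL2Norm {d : ℕ} (u : ℝ → (Fin d → ℤ) → ℝ) (I : Set ℝ) (S : Finset (Fin d → ℤ)) : ℝ :=
  Real.sqrt ((MeasureTheory.volume.real I * (S.card : ℝ))⁻¹ *
    ∫ t in I, ∑ x ∈ S, |u t x| ^ 2)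

/-- `δ₁ = 2/(d-1) - 1/p - 1/q`. -/
def delta₁ (d : ℕ) (p q : ℝ) : ℝ := 2 / ((d : ℝ) - 1) - 1 / p - 1 / q

/-- `δ₂ = 2/d - 1/q`. -/
def delta₂ (d : ℕ) (q : ℝ) : ℝ := 2 / (d : ℝ) - 1 / q

/-- `θ = p` if `d = 2`, and `θ = 1 + p δ₁` if `d ≥ 3`. -/
def theta (d : ℕ) (p q : ℝ) : ℝ := if d = 2 then p else 1 + p * delta₁ d p q

/-- `ν = 1 - δ₂ (1 - 1/θ)`. -/
def nu (d : ℕ) (p q : ℝ) : ℝ := 1 - delta₂ d q * (1 - 1 / theta d p q)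

/-- The constant
`C(ω,S,τ) = max {1, τ^{1/2} (‖ω⁻¹‖_{L^q(S)} (‖ω‖_{L^p(S)} + τ⁻¹)^{2-ν})^{1/(2(1-ν))}}`
with averaged norms over the bonds of `S`. -/
def boundConst {d : ℕ} (p q : ℝ) (ω : Sym2 (Fin d → ℤ) → ℝ) (S : Finset (Fin d → ℤ))
    (τ : ℝ) : ℝ :=
  max 1 (τ ^ (1 / 2 : ℝ) *
    (bondNorm q S (fun e => (ω e)⁻¹) *
      (bondNorm p S ω + τ⁻¹) ^ (2 - nu d p q)) ^ (1 / (2 * (1 - nu d p q))))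

end

end RCM

/-! The proof is a Moser iteration in which the cut-off function is adapted to the solution. By
convexity, powers `v` of a nonnegative subsolution are again subsolutions (`IsSubsol.rpow`), and
testing with `η² v` gives a Caccioppoli inequality with error term `∑ a (∇η)² v²`
(`IsSubsol.caccioppoli`). Estimating this term for a fixed `η` would call for the Sobolev inequality
in dimension `d` and so for stronger integrability of the conductances.

Instead `η` depends on `v` and on the conductances. It is a product of one-dimensional profiles that
drop only at good levels: those where the sums over the hyperplane slices of `a^p`, `a^(-q)`, `v²`
and the energy density are bounded by a multiple of their mean over the levels. By Markov's
inequality a fixed share of the levels is good for all four quantities (`exists_good_levels`). The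
error term then lives on slices of dimension `D = d - 1`, where it is interpolated with a weighted
Sobolev inequality (`sobolev_weighted`, and `sobolev_weighted_one` if `D = 1`). This is where
`2/(d-1)` comes from. The outcome is a bound by `mass^(1-1/θ) (mass + energy)^(1/θ)` up to constants
(`exists_caccioppoli`). Since `θ > 1`, the energy enters with a power below one and is absorbed by
Young's inequality and an induction on the width of the annulus (`exists_absorbed_caccioppoli`).

The resulting bounds on the energy and on the mass uniformly in time, together with the weighted
Sobolev inequality in the full dimension (here `q > d/2` enters), control `v^(1+δ₂)` in `L²` by `v`
in `L²` (`exists_gain`). The iteration stops after finitely many steps, when the gap between radii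
reaches the lattice spacing. There a single site is bounded by the sum over a cube, and the
polynomial loss in `N` disappears on taking the root of order `(1+δ₂)^J`
(`exists_maximal_inequality`).

Measuring time in units of `τ` turns the conductances into `τ ω`. The constant `C(ω, S, τ)` is the
factor of the rescaled inequality written in the original variables (`gain_factor_le`,
`scaled_const_eq`). -/

namespace RCM
open Finset

/-! ### Hölder inequalities and convexity of powers -/

theorem le_rpow_mul_rpow_of_forall {I F G a b : ℝ} (ha : 0 ≤ a) (hb : 0 ≤ b)
    (h : ∀ ε > 0, I ≤ (F + ε) ^ a * (G + ε) ^ b) : I ≤ F ^ a * G ^ b := by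
  have h1 : Filter.Tendsto (fun ε : ℝ => (F + ε) ^ a * (G + ε) ^ b)
      (nhdsWithin 0 (Set.Ioi 0)) (nhds (F ^ a * G ^ b)) := by
    have : ContinuousAt (fun ε : ℝ => (F + ε) ^ a * (G + ε) ^ b) 0 := by
      apply ContinuousAt.mul
      · exact ContinuousAt.rpow_const (by fun_prop) (Or.inr ha)
      · exact ContinuousAt.rpow_const (by fun_prop) (Or.inr hb)
    have h2 := this.tendsto
    simp only [add_zero] at h2
    exact h2.mono_left nhdsWithin_le_nhds
  exact ge_of_tendsto h1 (eventually_nhdsWithin_of_forall h)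

theorem rpow_mul_rpow_le_young {f g F G a b : ℝ} (hf : 0 ≤ f) (hg : 0 ≤ g) (hF : 0 < F)
    (hG : 0 < G) (ha : 0 ≤ a) (hb : 0 ≤ b) (hab : a + b = 1) :
    f ^ a * g ^ b ≤ F ^ a * G ^ b * (a * (f / F) + b * (g / G)) := by
  have := Real.geom_mean_le_arith_mean2_weighted ha hb (div_nonneg hf hF.le)
    (div_nonneg hg hG.le) hab
  calc f ^ a * g ^ b = F ^ a * G ^ b * ((f / F) ^ a * (g / G) ^ b) := by
        rw [Real.div_rpow hf hF.le, Real.div_rpow hg hG.le]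
        have := Real.rpow_pos_of_pos hF a
        have := Real.rpow_pos_of_pos hG b
        field_simp
    _ ≤ _ := by gcongr

theorem young_const_le_one {F G ε a b : ℝ} (hF : 0 ≤ F) (hG : 0 ≤ G) (hε : 0 < ε)
    (ha : 0 ≤ a) (hb : 0 ≤ b) (hab : a + b = 1) :
    a * (F / (F + ε)) + b * (G / (G + ε)) ≤ 1 := by
  have h1 : F / (F + ε) ≤ 1 := by rw [div_le_one (by linarith)]; linarith
  have h2 : G / (G + ε) ≤ 1 := by rw [div_le_one (by linarith)]; linarith
  nlinarith

/-- Hölder's inequality with exponents `1/a` and `1/b`: Young's inequality is applied termwise after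
normalising by the two sums. The shift by `ε` avoids division by a vanishing sum, and the form with
`a + b = 1` keeps the end-point cases `a = 0` and `b = 0`. -/
theorem sum_rpow_mul_rpow_le {κ : Type*} (s : Finset κ) {f g : κ → ℝ} {a b : ℝ}
    (hf : ∀ i ∈ s, 0 ≤ f i) (hg : ∀ i ∈ s, 0 ≤ g i) (ha : 0 ≤ a) (hb : 0 ≤ b) (hab : a + b = 1) :
    ∑ i ∈ s, f i ^ a * g i ^ b ≤ (∑ i ∈ s, f i) ^ a * (∑ i ∈ s, g i) ^ b := by
  have hF := sum_nonneg hf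
  have hG := sum_nonneg hg
  refine le_rpow_mul_rpow_of_forall ha hb fun ε hε => ?_
  set F := ∑ i ∈ s, f i
  set G := ∑ i ∈ s, g i
  calc ∑ i ∈ s, f i ^ a * g i ^ b
      ≤ ∑ i ∈ s, (F + ε) ^ a * (G + ε) ^ b * (a * (f i / (F + ε)) + b * (g i / (G + ε))) :=
        sum_le_sum fun i hi => rpow_mul_rpow_le_young (hf i hi) (hg i hi) (by linarith)
          (by linarith) ha hb hab
    _ = (F + ε) ^ a * (G + ε) ^ b * (a * (F / (F + ε)) + b * (G / (G + ε))) := by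
        rw [← mul_sum, sum_add_distrib, ← mul_sum, ← mul_sum, ← sum_div, ← sum_div]
    _ ≤ _ := mul_le_of_le_one_right (by positivity) (young_const_le_one hF hG hε ha hb hab)

theorem integral_rpow_mul_rpow_le {x y : ℝ} (hxy : x ≤ y) {f g : ℝ → ℝ} {a b : ℝ}
    (hfc : Continuous f) (hgc : Continuous g)
    (hf : ∀ t, 0 ≤ f t) (hg : ∀ t, 0 ≤ g t) (ha : 0 ≤ a) (hb : 0 ≤ b) (hab : a + b = 1) :
    ∫ t in x..y, f t ^ a * g t ^ b ≤ (∫ t in x..y, f t) ^ a * (∫ t in x..y, g t) ^ b := by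
  have hF : 0 ≤ ∫ t in x..y, f t := intervalIntegral.integral_nonneg hxy fun t _ => hf t
  have hG : 0 ≤ ∫ t in x..y, g t := intervalIntegral.integral_nonneg hxy fun t _ => hg t
  refine le_rpow_mul_rpow_of_forall ha hb fun ε hε => ?_
  set F := ∫ t in x..y, f t with hFd
  set G := ∫ t in x..y, g t with hGd
  have c1 : Continuous fun t => f t ^ a * g t ^ b :=
    (hfc.rpow_const fun _ => Or.inr ha).mul (hgc.rpow_const fun _ => Or.inr hb)
  calc ∫ t in x..y, f t ^ a * g t ^ b
      ≤ ∫ t in x..y, (F + ε) ^ a * (G + ε) ^ b * (a * (f t / (F + ε)) + b * (g t / (G + ε))) := by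
        apply intervalIntegral.integral_mono_on hxy (c1.intervalIntegrable _ _)
          (Continuous.intervalIntegrable (by fun_prop) _ _)
        intro t _
        exact rpow_mul_rpow_le_young (hf t) (hg t) (by linarith) (by linarith) ha hb hab
    _ = (F + ε) ^ a * (G + ε) ^ b * (a * (F / (F + ε)) + b * (G / (G + ε))) := by
        rw [intervalIntegral.integral_const_mul, intervalIntegral.integral_add,
          intervalIntegral.integral_const_mul, intervalIntegral.integral_const_mul,
          intervalIntegral.integral_div, intervalIntegral.integral_div]
        · exact Continuous.intervalIntegrable (by fun_prop) _ _
        · exact Continuous.intervalIntegrable (by fun_prop) _ _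
    _ ≤ _ := mul_le_of_le_one_right (by positivity) (young_const_le_one hF hG hε ha hb hab)

/-- The tangent line inequality for the convex function `x ↦ x ^ α`. -/
theorem rpow_tangent_le {α a b : ℝ} (hα : 1 ≤ α) (ha : 0 ≤ a) (hb : 0 ≤ b) :
    α * a ^ (α - 1) * (b - a) ≤ b ^ α - a ^ α := by
  rcases hα.eq_or_lt with rfl | hα
  · simp
  have h := Real.geom_mean_le_arith_mean2_weighted (w₁ := 1 - 1 / α) (w₂ := 1 / α)
    (p₁ := a ^ α) (p₂ := b ^ α) (by rw [sub_nonneg, div_le_one (by linarith)]; linarith)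
    (by positivity) (by positivity) (by positivity) (by ring)
  rw [← Real.rpow_mul ha, ← Real.rpow_mul hb] at h
  have e1 : α * (1 - 1 / α) = α - 1 := by field_simp
  have e2 : α * (1 / α) = 1 := by field_simp
  rw [e1, e2, Real.rpow_one] at h
  have e3 : a ^ (α - 1) * a = a ^ α := by
    rw [← Real.rpow_add_one' ha (by linarith)]; ring_nf
  have h2 := mul_le_mul_of_nonneg_left h (by linarith : 0 ≤ α)
  have e4 : α * ((1 - 1 / α) * a ^ α + 1 / α * b ^ α) = (α - 1) * a ^ α + b ^ α := by
    field_simp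
  rw [e4] at h2
  nlinarith

/-- The tangent lines at `a` and at `b` bound the difference from the two sides. -/
theorem abs_rpow_sub_rpow_le {γ a b : ℝ} (hγ : 1 ≤ γ) (ha : 0 ≤ a) (hb : 0 ≤ b) :
    |b ^ γ - a ^ γ| ≤ γ * ((a ^ (γ - 1) + b ^ (γ - 1)) * |b - a|) := by
  have h1 := rpow_tangent_le hγ ha hb
  have h2 := rpow_tangent_le hγ hb ha
  have ha' : 0 ≤ γ * a ^ (γ - 1) := by positivity
  have hb' : 0 ≤ γ * b ^ (γ - 1) := by positivity
  have h3 := mul_le_mul_of_nonneg_left (le_abs_self (b - a)) ha'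
  have h4 := mul_le_mul_of_nonneg_left (neg_abs_le (b - a)) ha'
  have h5 := mul_le_mul_of_nonneg_left (le_abs_self (b - a)) hb'
  have h6 := mul_nonneg hb' (abs_nonneg (b - a))
  have h7 := mul_nonneg ha' (abs_nonneg (b - a))
  rw [abs_le]
  constructor <;> nlinarith

/-- The unit step in direction `i`. -/
def step {ι : Type*} [DecidableEq ι] (i : ι) : ι → ℤ := Pi.single i 1

@[simp] theorem step_same {ι : Type*} [DecidableEq ι] (i : ι) : step i i = 1 := by simp [step]

theorem step_ne {ι : Type*} [DecidableEq ι] {i j : ι} (h : j ≠ i) : step i j = 0 := by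
  simp [step, h]

/-! ### Lattice cubes and sums over their bonds -/

section cube
variable {ι : Type*} [Fintype ι] [DecidableEq ι]

/-- The lattice cube `[-r, r]^ι`. -/
noncomputable def cube (ι : Type*) [Fintype ι] [DecidableEq ι] (r : ℕ) : Finset (ι → ℤ) :=
  Fintype.piFinset fun _ => Finset.Icc (-(r : ℤ)) r

/-- The sum of `F` over the bonds `(x, x + eᵢ)` with both end-points in the cube of radius `r`. -/
noncomputable def esum (r : ℕ) (F : (ι → ℤ) → ι → ℝ) : ℝ :=
  ∑ x ∈ cube ι r, ∑ i, if x i < r then F x i else 0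

theorem mem_cube {r : ℕ} {x : ι → ℤ} : x ∈ cube ι r ↔ ∀ i, -(r : ℤ) ≤ x i ∧ x i ≤ r := by
  simp [cube]

theorem cube_mono {s r : ℕ} (h : s ≤ r) : cube ι s ⊆ cube ι r := by
  intro x hx
  rw [mem_cube] at hx ⊢
  intro i
  have := hx i
  omega

theorem card_cube (r : ℕ) : (cube ι r).card = (2 * r + 1) ^ Fintype.card ι := by
  simp only [cube, Fintype.card_piFinset, Int.card_Icc, prod_const, card_univ]
  congr 1
  omega

theorem add_step_mem {r : ℕ} {x : ι → ℤ} (hx : x ∈ cube ι r) {i : ι} (h : x i < r) :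
    x + step i ∈ cube ι r := by
  rw [mem_cube] at hx ⊢
  intro j
  by_cases hj : j = i
  · subst hj
    have := hx j
    simp
    omega
  · simpa [step_ne hj] using hx j

theorem lt_of_add_step_mem {r : ℕ} {x : ι → ℤ} {i : ι} (h : x + step i ∈ cube ι r) :
    x i < r := by
  have := (mem_cube.1 h i).2
  simp at this
  omega

theorem esum_nonneg {r : ℕ} {F : (ι → ℤ) → ι → ℝ} (h : ∀ x i, 0 ≤ F x i) : 0 ≤ esum r F :=
  sum_nonneg fun x _ => sum_nonneg fun i _ => by split_ifs <;> simp [h]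

theorem esum_le_esum {r : ℕ} {F G : (ι → ℤ) → ι → ℝ}
    (h : ∀ x ∈ cube ι r, ∀ i, x + step i ∈ cube ι r → F x i ≤ G x i) : esum r F ≤ esum r G :=
  sum_le_sum fun x hx => sum_le_sum fun i _ => by
    split_ifs with h'
    · exact h x hx i (add_step_mem hx h')
    · rfl

theorem esum_mono {s r : ℕ} (hsr : s ≤ r) {F : (ι → ℤ) → ι → ℝ} (h : ∀ x i, 0 ≤ F x i) :
    esum s F ≤ esum r F := by
  unfold esum
  calc _ ≤ ∑ x ∈ cube ι s, ∑ i, if x i < r then F x i else 0 := by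
        refine sum_le_sum fun x _ => sum_le_sum fun i _ => ?_
        split_ifs with h1 h2
        · rfl
        · omega
        · exact h x i
        · rfl
    _ ≤ _ := sum_le_sum_of_subset_of_nonneg (cube_mono hsr) fun x _ _ =>
        sum_nonneg fun i _ => by split_ifs <;> simp [h]

theorem esum_mul_left (r : ℕ) (c : ℝ) (F : (ι → ℤ) → ι → ℝ) :
    esum r (fun x i => c * F x i) = c * esum r F := by
  simp only [esum, mul_sum, mul_ite, mul_zero]

theorem esum_add (r : ℕ) (F G : (ι → ℤ) → ι → ℝ) :
    esum r (fun x i => F x i + G x i) = esum r F + esum r G := by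
  simp only [esum, ← sum_add_distrib]
  refine sum_congr rfl fun x _ => sum_congr rfl fun i _ => ?_
  split_ifs <;> simp

/-- The finite set of bonds of the cube, each represented by its lower end-point and direction. -/
noncomputable def edges (ι : Type*) [Fintype ι] [DecidableEq ι] (r : ℕ) : Finset ((ι → ℤ) × ι) :=
  ((cube ι r) ×ˢ univ).filter fun e => e.1 e.2 < r

theorem esum_eq (r : ℕ) (F : (ι → ℤ) → ι → ℝ) : esum r F = ∑ e ∈ edges ι r, F e.1 e.2 := by
  rw [edges, sum_filter, sum_product]
  rfl

theorem esum_rpow_mul_rpow_le (r : ℕ) {F G : (ι → ℤ) → ι → ℝ} {a b : ℝ}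
    (hf : ∀ x i, 0 ≤ F x i) (hg : ∀ x i, 0 ≤ G x i) (ha : 0 ≤ a) (hb : 0 ≤ b) (hab : a + b = 1) :
    esum r (fun x i => F x i ^ a * G x i ^ b) ≤ esum r F ^ a * esum r G ^ b := by
  simp only [esum_eq]
  exact sum_rpow_mul_rpow_le _ (fun _ _ => hf _ _) (fun _ _ => hg _ _) ha hb hab

theorem esum_left_le (r : ℕ) {f : (ι → ℤ) → ℝ} (hf : ∀ x, 0 ≤ f x) :
    esum r (fun x _ => f x) ≤ Fintype.card ι * ∑ x ∈ cube ι r, f x := by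
  unfold esum
  rw [mul_sum]
  refine sum_le_sum fun x _ => ?_
  calc _ ≤ ∑ i : ι, f x := sum_le_sum fun i _ => by split_ifs <;> simp [hf]
    _ = _ := by simp

theorem esum_right_le (r : ℕ) {f : (ι → ℤ) → ℝ} (hf : ∀ x, 0 ≤ f x) :
    esum r (fun x i => f (x + step i)) ≤ Fintype.card ι * ∑ x ∈ cube ι r, f x := by
  unfold esum
  rw [sum_comm]
  calc _ ≤ ∑ i : ι, ∑ x ∈ cube ι r, f x := by
        refine sum_le_sum fun i _ => ?_
        rw [← sum_filter]
        refine (sum_map ((cube ι r).filter fun x => x i < (r : ℤ)) (addRightEmbedding (step i)) f).symm.trans_le ?_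
        refine sum_le_sum_of_subset_of_nonneg ?_ fun _ _ _ => hf _
        intro y hy
        simp only [mem_map, mem_filter, addRightEmbedding_apply] at hy
        obtain ⟨x, ⟨hx, h⟩, rfl⟩ := hy
        exact add_step_mem hx h
    _ = _ := by simp

end cube
end RCM

/-! ### The unweighted Sobolev inequality on a cube -/

namespace RCM

open Finset MeasureTheory

/-- A nonnegative function on `[-r, r]` is bounded by its average plus its total variation. -/
theorem le_average_add_variation (r : ℕ) (g : ℤ → ℝ) {k : ℤ} (hk : k ∈ Icc (-(r : ℤ)) r) :
    g k ≤ ∑ j ∈ Icc (-(r : ℤ)) r,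
      (g j / (2 * r + 1) + if j < r then |g (j + 1) - g j| else 0) := by
  set V := ∑ j ∈ Icc (-(r : ℤ)) r, if j < r then |g (j + 1) - g j| else 0
  have key : ∀ n : ℕ, ∀ l : ℤ, -(r : ℤ) ≤ l → l + n ≤ r →
      |g (l + n) - g l| ≤ ∑ j ∈ Ico l (l + n), |g (j + 1) - g j| := by
    intro n
    induction n with
    | zero => intro l _ _; simp
    | succ n ih =>
      intro l h1 h2
      push_cast at h2
      have := ih l h1 (by omega)
      have e : Ico l (l + (n + 1 : ℕ)) = insert (l + n) (Ico l (l + n)) := by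
        ext j; simp only [mem_Ico, mem_insert]; push_cast; omega
      rw [e, sum_insert (by simp)]
      push_cast
      rw [← add_assoc]
      have := abs_sub_le (g (l + n + 1)) (g (l + n)) (g l)
      linarith
  have key2 : ∀ l m : ℤ, l ∈ Icc (-(r : ℤ)) r → m ∈ Icc (-(r : ℤ)) r → l ≤ m →
      |g m - g l| ≤ V := by
    intro l m hl hm hlm
    obtain ⟨n, rfl⟩ := Int.le.dest hlm
    rw [mem_Icc] at hl hm
    refine (key n l hl.1 hm.2).trans ?_
    calc _ = ∑ j ∈ Ico l (l + n), if j < r then |g (j + 1) - g j| else 0 := by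
          refine sum_congr rfl fun j hj => ?_
          rw [mem_Ico] at hj
          rw [if_pos (by omega)]
      _ ≤ V := by
          refine sum_le_sum_of_subset_of_nonneg ?_ fun j _ _ => by split_ifs <;> positivity
          intro j hj
          rw [mem_Ico] at hj
          rw [mem_Icc]
          omega
  -- Averaging this over the `2r + 1` sites `j` gives the claim.
  have key3 : ∀ j ∈ Icc (-(r : ℤ)) r, g k ≤ g j + V := by
    intro j hj
    rcases le_total k j with h | h
    · have := key2 k j hk hj h
      rw [abs_le] at this
      linarith
    · have := key2 j k hj hk h
      rw [abs_le] at this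
      linarith
  have h1 := sum_le_sum key3
  rw [sum_add_distrib, sum_const, sum_const, Int.card_Icc] at h1
  have e : ((r : ℤ) + 1 - -(r : ℤ)).toNat = 2 * r + 1 := by omega
  rw [e, nsmul_eq_mul, nsmul_eq_mul] at h1
  push_cast at h1
  rw [sum_add_distrib, ← sum_div]
  have h2 : (0 : ℝ) < 2 * r + 1 := by positivity
  have h3 : g k ≤ (∑ j ∈ Icc (-(r : ℤ)) r, g j + (2 * r + 1) * V) / (2 * r + 1) := by
    rw [le_div_iff₀ h2]; linarith
  rw [add_div, mul_div_cancel_left₀ _ h2.ne'] at h3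
  exact h3

theorem update_add_step {ι : Type*} [DecidableEq ι] (x : ι → ℤ) (i : ι) (k : ℤ) :
    Function.update x i k + step i = Function.update x i (k + 1) := by
  ext j
  by_cases hj : j = i
  · subst hj; simp
  · simp [hj, step_ne hj]

variable {ι : Type*} [Fintype ι] [DecidableEq ι]

theorem update_mem_cube {r : ℕ} {x : ι → ℤ} (hx : x ∈ cube ι r) (i : ι) {k : ℤ}
    (hk : k ∈ Icc (-(r : ℤ)) r) : Function.update x i k ∈ cube ι r := by
  rw [mem_cube] at hx ⊢
  rw [mem_Icc] at hk
  intro j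
  by_cases hj : j = i
  · subst hj; simpa using hk
  · simpa [hj] using hx j

/-- The discrete Loomis-Whitney type inequality, from the grid-lines lemma. -/
theorem sum_le_of_le_lines {r : ℕ} {p : ℝ}
    (hp : (Fintype.card ι : ℝ).HolderConjugate p) {f w : (ι → ℤ) → ℝ} (hf : ∀ x, 0 ≤ f x)
    (hw : ∀ x ∈ cube ι r, 0 ≤ w x)
    (h : ∀ x ∈ cube ι r, ∀ i, w x ≤ ∑ k ∈ Icc (-(r : ℤ)) r, f (Function.update x i k)) :
    ∑ x ∈ cube ι r, w x ^ p ≤ (∑ x ∈ cube ι r, f x) ^ p := by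
  have hp1 : 0 < p := hp.symm.pos
  have hd : (1 : ℝ) < Fintype.card ι := hp.lt
  -- With counting measure on every axis the product measure is counting measure, so the grid-lines
  -- inequality for integrals becomes one for sums.
  let μ : ι → Measure ℤ := fun _ => Measure.count
  have hpi : Measure.pi μ = Measure.count := by
    have : ∀ x : ι → ℤ, Measure.pi μ {x} = 1 := by
      intro x; rw [Measure.pi_singleton]; simp [μ]
    refine Measure.ext_of_singleton fun x => ?_
    rw [this, Measure.count_singleton]
  classical
  let f' : (ι → ℤ) → ENNReal := fun x => if x ∈ cube ι r then ENNReal.ofReal (f x) else 0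
  have key := lintegral_prod_lintegral_pow_le μ hp (f := f') (measurable_of_countable _)
  rw [hpi, lintegral_count, lintegral_count] at key
  have e1 : ∑' x, f' x = ENNReal.ofReal (∑ x ∈ cube ι r, f x) := by
    rw [tsum_eq_sum (s := cube ι r) (fun x hx => by simp [f', hx]),
      ENNReal.ofReal_sum_of_nonneg fun x _ => hf x]
    exact sum_congr rfl fun x hx => by simp [f', hx]
  have hfs : 0 ≤ ∑ x ∈ cube ι r, f x := sum_nonneg fun x _ => hf x
  rw [e1, ENNReal.ofReal_rpow_of_nonneg hfs hp1.le] at key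
  have e2 : ENNReal.ofReal (∑ x ∈ cube ι r, w x ^ p) ≤
      ENNReal.ofReal ((∑ x ∈ cube ι r, f x) ^ p) := by
    refine le_trans ?_ key
    rw [ENNReal.ofReal_sum_of_nonneg fun x hx => Real.rpow_nonneg (hw x hx) p]
    refine le_trans (sum_le_sum fun x hx => ?_) (ENNReal.sum_le_tsum (cube ι r))
    have e3 : ∀ i, ENNReal.ofReal (w x) ≤ ∫⁻ k, f' (Function.update x i k) ∂(μ i) := by
      intro i
      simp only [μ]
      rw [lintegral_count]
      refine le_trans ?_ (ENNReal.sum_le_tsum (Icc (-(r : ℤ)) r))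
      refine (ENNReal.ofReal_le_ofReal (h x hx i)).trans ?_
      rw [ENNReal.ofReal_sum_of_nonneg fun x _ => hf _]
      exact sum_le_sum fun k hk => by simp [f', update_mem_cube hx i hk]
    -- As `p = card ι / (card ι - 1)`, the power `w^p` splits into `card ι` equal factors, one for
    -- each line through `x`.
    calc ENNReal.ofReal (w x ^ p) = ∏ i : ι, ENNReal.ofReal (w x) ^ ((1 : ℝ) / ((Fintype.card ι : ℝ) - 1)) := by
          rw [prod_const, card_univ, ← ENNReal.rpow_natCast, ← ENNReal.rpow_mul,
            ENNReal.ofReal_rpow_of_nonneg (hw x hx) (by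
              have : (0 : ℝ) < Fintype.card ι - 1 := by linarith
              positivity)]
          rw [hp.conjugate_eq]
          congr 2
          ring
      _ ≤ _ := by
          gcongr with i
          exact e3 i
  exact (ENNReal.ofReal_le_ofReal_iff (Real.rpow_nonneg hfs p)).1 e2

/-- The Gagliardo-Nirenberg-Sobolev inequality on a lattice cube. -/
theorem sobolev_one {r : ℕ} {p : ℝ} (hp : (Fintype.card ι : ℝ).HolderConjugate p)
    {w : (ι → ℤ) → ℝ} (hw : ∀ x, 0 ≤ w x) :
    ∑ x ∈ cube ι r, w x ^ p ≤
      ((∑ x ∈ cube ι r, w x) / (2 * r + 1) + esum r fun x i => |w (x + step i) - w x|) ^ p := by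
  -- The density `f` contains the average and the variation in every direction, so its sum along any
  -- line dominates `w` at each point of that line.
  have h := sum_le_of_le_lines (r := r) hp (w := w)
    (f := fun x => w x / (2 * r + 1) + ∑ i, if x i < r then |w (x + step i) - w x| else 0)
    (fun x => add_nonneg (div_nonneg (hw x) (by positivity))
      (sum_nonneg fun i _ => by split_ifs <;> positivity)) (fun x _ => hw x) ?_
  · rwa [sum_add_distrib, ← sum_div] at h
  intro x hx i
  have h1 := le_average_add_variation r (fun k => w (Function.update x i k)) (k := x i)
    (by rw [mem_Icc]; exact mem_cube.1 hx i)
  simp only [Function.update_eq_self] at h1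
  refine h1.trans (sum_le_sum fun k _ => ?_)
  gcongr
  rw [← update_add_step]
  calc _ = if (Function.update x i k) i < r then
        |w (Function.update x i k + step i) - w (Function.update x i k)| else 0 := by simp
    _ ≤ _ := single_le_sum (f := fun j => if (Function.update x i k) j < r then
        |w (Function.update x i k + step j) - w (Function.update x i k)| else 0)
        (fun j _ => by split_ifs <;> positivity) (mem_univ i)

end RCM

/-! ### The weighted Sobolev inequality -/

namespace RCM

open Finset MeasureTheory

variable {ι : Type*} [Fintype ι] [DecidableEq ι]

set_option maxHeartbeats 2000000 in
/-- The weighted Sobolev inequality on a lattice cube of dimension at least two, with a weight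
whose inverse is controlled in `L^q`. -/
theorem sobolev_weighted {q κ : ℝ} (hD : 2 ≤ Fintype.card ι) (hq : 1 < q) (hκ : 1 ≤ κ)
    (hκe : 1 / κ = 1 + 1 / q - 2 / (Fintype.card ι : ℝ)) (r : ℕ)
    {w : (ι → ℤ) → ℝ} (hw : ∀ x, 0 ≤ w x) {b : (ι → ℤ) → ι → ℝ} (hb : ∀ x i, 0 < b x i) :
    (∑ x ∈ cube ι r, w x ^ (2 * κ)) ^ (1 / κ) ≤
      32 * Fintype.card ι * κ ^ 2 *
        ((esum r fun x i => (b x i)⁻¹ ^ q) ^ (1 / q) *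
            (esum r fun x i => b x i * (w (x + step i) - w x) ^ 2) +
          (((2 * r + 1 : ℝ)) ^ (Fintype.card ι)) ^ (1 / q) / (2 * r + 1) ^ 2 *
            ∑ x ∈ cube ι r, w x ^ 2) := by
  set D : ℝ := ((Fintype.card ι : ℕ) : ℝ) with hDdef
  have hD2 : (2 : ℝ) ≤ D := by rw [hDdef]; exact_mod_cast hD
  set Z := ∑ x ∈ cube ι r, w x ^ (2 * κ) with hZ
  set V := ∑ x ∈ cube ι r, w x ^ 2 with hV
  set Y := esum r fun x i => b x i * (w (x + step i) - w x) ^ 2 with hY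
  set Q := esum r fun x i => (b x i)⁻¹ ^ q with hQ
  set m : ℝ := 2 * r + 1 with hm
  have hm0 : 0 < m := by positivity
  have hZ0 : 0 ≤ Z := sum_nonneg fun x _ => Real.rpow_nonneg (hw x) _
  have hV0 : 0 ≤ V := sum_nonneg fun x _ => by positivity
  have hY0 : 0 ≤ Y := esum_nonneg fun x i => mul_nonneg (hb x i).le (sq_nonneg _)
  have hQ0 : 0 ≤ Q := esum_nonneg fun x i => Real.rpow_nonneg (inv_nonneg.2 (hb x i).le) _
  have hRHS : 0 ≤ 32 * D * κ ^ 2 * (Q ^ (1 / q) * Y + (m ^ Fintype.card ι) ^ (1 / q) / m ^ 2 * V) := by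
    positivity
  -- The argument ends with a division by `Z^(1-1/q)`, hence the case `Z = 0` is set aside.
  rcases hZ0.eq_or_lt with h0 | hZp
  · rw [← h0, Real.zero_rpow (by positivity)]
    exact hRHS
  -- The unweighted inequality is applied to `w^γ`. The choice of `γ` gives `γ p' = 2κ` on the left,
  -- and the relation for `κ` gives `2(γ-1) = 2κ(1-1/q)`, so the powers of `w` produced by the
  -- gradient are again controlled by `Z`.
  set γ := 2 * κ * (1 - 1 / D) with hγ
  have hDi : 1 / D ≤ 1 / 2 := one_div_le_one_div_of_le (by norm_num) hD2
  have hDi0 : 0 < 1 / D := by positivity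
  have hqi : 1 / q < 1 := by rw [div_lt_one (by linarith)]; exact hq
  have hqi0 : 0 < 1 / q := by positivity
  have hγ1 : 1 ≤ γ := by
    calc (1 : ℝ) ≤ 2 * κ * (1 / 2) := by linarith
      _ ≤ γ := by rw [hγ]; gcongr; linarith
  have hγ2 : γ ≤ 2 * κ := mul_le_of_le_one_right (by linarith) (by linarith)
  have hγe : 2 * (γ - 1) = 2 * κ * (1 - 1 / q) := by
    have : κ * (1 / κ) = 1 := by field_simp
    rw [hκe] at this
    rw [hγ]
    have h2 : 2 / D = 2 * (1 / D) := by ring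
    rw [h2] at this
    linarith
  have hpq : (Fintype.card ι : ℝ).HolderConjugate (D / (D - 1)) :=
    Real.HolderConjugate.conjExponent (by linarith)
  set p' := D / (D - 1) with hp'
  have hp'i : 1 / p' = 1 - 1 / D := by
    rw [hp']; field_simp
  have hp'0 : 0 < p' := hpq.symm.pos
  have hγp : γ * p' = 2 * κ := by
    rw [hγ, ← hp'i]; field_simp
  have hγ3 : γ ^ 2 ≤ 4 * κ ^ 2 := by
    calc γ ^ 2 ≤ (2 * κ) ^ 2 := by gcongr
      _ = _ := by ring
  clear_value γ p'
  -- powers of `w`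
  have hpow : ∀ x, w x ^ (2 * (γ - 1)) = (w x ^ (2 * κ)) ^ (1 - 1 / q) := by
    intro x; rw [← Real.rpow_mul (hw x), hγe]
  have hpow2 : ∀ x, (w x ^ (γ - 1)) ^ 2 = (w x ^ (2 * κ)) ^ (1 - 1 / q) := by
    intro x
    rw [← hpow, ← Real.rpow_natCast, ← Real.rpow_mul (hw x)]
    congr 1; push_cast; ring
  have hzk : ∀ x, 0 ≤ w x ^ (2 * κ) := fun x => Real.rpow_nonneg (hw x) _
  -- the zero order term
  have S1 : ∑ x ∈ cube ι r, w x ^ γ ≤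
      V ^ (1 / 2 : ℝ) * (Z ^ (1 - 1 / q) * (m ^ Fintype.card ι) ^ (1 / q)) ^ (1 / 2 : ℝ) := by
    have h1 : ∀ x, w x ^ γ = (w x ^ 2) ^ (1 / 2 : ℝ) * ((w x ^ (2 * κ)) ^ (1 - 1 / q)) ^ (1 / 2 : ℝ) := by
      intro x
      rw [← hpow, ← Real.rpow_mul (hw x), ← Real.rpow_natCast, ← Real.rpow_mul (hw x),
        ← Real.rpow_add_of_nonneg (hw x) (by norm_num) (by linarith)]
      congr 1; push_cast; ring
    simp_rw [h1]
    have h3 := sum_rpow_mul_rpow_le (cube ι r) (f := fun x => w x ^ 2)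
      (g := fun x => (w x ^ (2 * κ)) ^ (1 - 1 / q)) (a := 1 / 2) (b := 1 / 2)
      (fun x _ => sq_nonneg _)
      (fun x _ => Real.rpow_nonneg (hzk x) _) (by norm_num) (by norm_num) (by norm_num)
    refine h3.trans ?_
    have h2 := sum_rpow_mul_rpow_le (cube ι r) (f := fun x => w x ^ (2 * κ)) (g := fun _ => (1 : ℝ))
      (fun x _ => hzk x) (fun _ _ => zero_le_one) (by linarith : 0 ≤ 1 - 1 / q) hqi0.le (by ring)
    simp only [Real.one_rpow, mul_one, sum_const, nsmul_eq_mul, card_cube] at h2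
    push_cast at h2
    gcongr
    exact sum_nonneg fun x _ => Real.rpow_nonneg (hzk x) _
  -- the gradient term
  have S3 : (esum r fun x i => (b x i)⁻¹ * (w x ^ (γ - 1) + w (x + step i) ^ (γ - 1)) ^ 2) ≤
      4 * (D * (Q ^ (1 / q) * Z ^ (1 - 1 / q))) := by
    have hbi : ∀ x i, (b x i)⁻¹ = ((b x i)⁻¹ ^ q) ^ (1 / q) := by
      intro x i
      rw [← Real.rpow_mul (inv_nonneg.2 (hb x i).le), mul_one_div_cancel (by linarith), Real.rpow_one]
    have hDp : D ^ (1 - 1 / q) ≤ D := by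
      calc D ^ (1 - 1 / q) ≤ D ^ (1 : ℝ) := Real.rpow_le_rpow_of_exponent_le (by linarith) (by linarith)
        _ = D := Real.rpow_one D
    have hgen : ∀ f : (ι → ℤ) → ι → ℝ, (∀ x i, 0 ≤ f x i) → esum r f ≤ D * Z →
        (esum r fun x i => (b x i)⁻¹ * f x i ^ (1 - 1 / q)) ≤ D * (Q ^ (1 / q) * Z ^ (1 - 1 / q)) := by
      intro f hf hfZ
      have := esum_rpow_mul_rpow_le r (F := fun x i => (b x i)⁻¹ ^ q) (G := f)
        (fun x i => Real.rpow_nonneg (inv_nonneg.2 (hb x i).le) _) hf hqi0.le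
        (by linarith : 0 ≤ 1 - 1 / q) (by ring)
      simp_rw [← hbi] at this
      refine this.trans ?_
      have h4 : esum r f ^ (1 - 1 / q) ≤ D * Z ^ (1 - 1 / q) := by
        calc esum r f ^ (1 - 1 / q) ≤ (D * Z) ^ (1 - 1 / q) :=
              Real.rpow_le_rpow (esum_nonneg hf) hfZ (by linarith)
          _ = D ^ (1 - 1 / q) * Z ^ (1 - 1 / q) := Real.mul_rpow (by linarith) hZ0
          _ ≤ _ := by gcongr
      calc Q ^ (1 / q) * esum r f ^ (1 - 1 / q) ≤ Q ^ (1 / q) * (D * Z ^ (1 - 1 / q)) := by gcongr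
        _ = _ := by ring
    have h1 := hgen (fun x _ => w x ^ (2 * κ)) (fun x _ => hzk x) (by rw [hZ, hDdef]; exact esum_left_le r (f := fun x => w x ^ (2 * κ)) hzk)
    have h2 := hgen (fun x i => w (x + step i) ^ (2 * κ)) (fun x i => hzk _) (by rw [hZ, hDdef]; exact esum_right_le r (f := fun x => w x ^ (2 * κ)) hzk)
    calc _ ≤ esum r (fun x i => 2 * ((b x i)⁻¹ * (w x ^ (2 * κ)) ^ (1 - 1 / q) +
            (b x i)⁻¹ * (w (x + step i) ^ (2 * κ)) ^ (1 - 1 / q))) := by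
          refine esum_le_esum fun x _ i _ => ?_
          rw [← hpow2, ← hpow2, ← mul_add, mul_left_comm]
          gcongr
          · exact inv_nonneg.2 (hb x i).le
          · exact add_sq_le
      _ ≤ _ := by rw [esum_mul_left, esum_add]; linarith
  have S2 : (esum r fun x i => |w (x + step i) ^ γ - w x ^ γ|) ≤
      γ * (Y ^ (1 / 2 : ℝ) * (4 * (D * (Q ^ (1 / q) * Z ^ (1 - 1 / q)))) ^ (1 / 2 : ℝ)) := by
    calc _ ≤ esum r (fun x i => γ * ((b x i * (w (x + step i) - w x) ^ 2) ^ (1 / 2 : ℝ) *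
          ((b x i)⁻¹ * (w x ^ (γ - 1) + w (x + step i) ^ (γ - 1)) ^ 2) ^ (1 / 2 : ℝ))) := by
          refine esum_le_esum fun x _ i _ => ?_
          refine (abs_rpow_sub_rpow_le hγ1 (hw x) (hw _)).trans_eq ?_
          have h5 := (hb x i).le
          have h6 : 0 ≤ w x ^ (γ - 1) + w (x + step i) ^ (γ - 1) :=
            add_nonneg (Real.rpow_nonneg (hw _) _) (Real.rpow_nonneg (hw _) _)
          rw [← Real.mul_rpow (by positivity) (by positivity)]
          have : b x i * (w (x + step i) - w x) ^ 2 *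
              ((b x i)⁻¹ * (w x ^ (γ - 1) + w (x + step i) ^ (γ - 1)) ^ 2) =
              ((w x ^ (γ - 1) + w (x + step i) ^ (γ - 1)) * |w (x + step i) - w x|) ^ 2 := by
            rw [mul_pow, sq_abs]
            have := (hb x i).ne'
            field_simp
          rw [this, ← Real.sqrt_eq_rpow, Real.sqrt_sq (by positivity)]
      _ ≤ _ := by
          rw [esum_mul_left]
          refine mul_le_mul_of_nonneg_left ?_ (by linarith)
          refine (esum_rpow_mul_rpow_le r (fun x i => mul_nonneg (hb x i).le (sq_nonneg _))
            (fun x i => mul_nonneg (inv_nonneg.2 (hb x i).le) (sq_nonneg _)) (by norm_num)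
            (by norm_num) (by norm_num)).trans ?_
          gcongr
          exact esum_nonneg fun x i => mul_nonneg (inv_nonneg.2 (hb x i).le) (sq_nonneg _)
  have S := sobolev_one (r := r) hpq (w := fun x => w x ^ γ) fun x => Real.rpow_nonneg (hw x) _
  have hZ' : ∀ x, (w x ^ γ) ^ p' = w x ^ (2 * κ) := by
    intro x
    rw [← Real.rpow_mul (hw x)]
    rw [hγp]
  simp only [hZ'] at S
  rw [← hZ] at S
  clear_value Z V Y Q
  set c1 := (m ^ Fintype.card ι) ^ (1 / q)
  have hc1 : 0 ≤ c1 := by positivity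
  set z := Z ^ (1 - 1 / q) with hz
  have hz0 : 0 < z := Real.rpow_pos_of_pos hZp _
  set s1 := (∑ x ∈ cube ι r, w x ^ γ) / m with hs1d
  set s2 := esum r fun x i => |w (x + step i) ^ γ - w x ^ γ|
  have hs1 : 0 ≤ s1 := div_nonneg (sum_nonneg fun x _ => Real.rpow_nonneg (hw x) _) hm0.le
  have hs2 : 0 ≤ s2 := esum_nonneg fun x i => abs_nonneg _
  have q1 : s1 ^ 2 ≤ V * (z * c1) / m ^ 2 := by
    have : s1 ≤ V ^ (1 / 2 : ℝ) * (z * c1) ^ (1 / 2 : ℝ) / m := by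
      simp only [s1]; gcongr
    calc s1 ^ 2 ≤ (V ^ (1 / 2 : ℝ) * (z * c1) ^ (1 / 2 : ℝ) / m) ^ 2 := by gcongr
      _ = _ := by
        rw [div_pow, mul_pow, ← Real.sqrt_eq_rpow, ← Real.sqrt_eq_rpow, Real.sq_sqrt hV0,
          Real.sq_sqrt (by positivity)]
  clear_value s1 s2 z c1 D m
  have q2 : s2 ^ 2 ≤ γ ^ 2 * (Y * (4 * (D * (Q ^ (1 / q) * z)))) := by
    calc s2 ^ 2 ≤ (γ * (Y ^ (1 / 2 : ℝ) * (4 * (D * (Q ^ (1 / q) * z))) ^ (1 / 2 : ℝ))) ^ 2 := by gcongr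
      _ = _ := by
        rw [mul_pow, mul_pow, ← Real.sqrt_eq_rpow, ← Real.sqrt_eq_rpow, Real.sq_sqrt hY0,
          Real.sq_sqrt (by positivity)]
  have q3 : Z ^ (1 / p') ≤ s1 + s2 := by
    calc Z ^ (1 / p') ≤ ((s1 + s2) ^ p') ^ (1 / p') := by gcongr
      _ = s1 + s2 := by
        rw [← Real.rpow_mul (by positivity), mul_one_div_cancel hp'0.ne', Real.rpow_one]
  -- Both sides are `Z^(2-2/D)`, which is the relation defining `κ`.
  have q4 : Z ^ (1 / κ) * z = (Z ^ (1 / p')) ^ 2 := by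
    rw [hz, ← Real.rpow_add hZp, ← Real.rpow_natCast, ← Real.rpow_mul hZ0, hκe, hp'i]
    congr 1
    push_cast
    ring
  have q5 : (Z ^ (1 / p')) ^ 2 ≤ 2 * s1 ^ 2 + 2 * s2 ^ 2 := by
    calc (Z ^ (1 / p')) ^ 2 ≤ (s1 + s2) ^ 2 := by gcongr
      _ ≤ 2 * (s1 ^ 2 + s2 ^ 2) := add_sq_le
      _ = _ := mul_add _ _ _
  rw [← q4] at q5
  have hQq : 0 ≤ Q ^ (1 / q) := by positivity
  refine le_of_mul_le_mul_right (q5.trans ?_) hz0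
  have t1 : 2 * s1 ^ 2 ≤ 32 * D * κ ^ 2 * (c1 / m ^ 2 * V) * z := by
    have h7 : 0 ≤ V * (z * c1) / m ^ 2 := by positivity
    have h8 : 1 ≤ D * κ ^ 2 := one_le_mul_of_one_le_of_one_le (by linarith) (one_le_pow₀ hκ)
    calc 2 * s1 ^ 2 ≤ 2 * (V * (z * c1) / m ^ 2) := by linarith
      _ ≤ 32 * (D * κ ^ 2) * (V * (z * c1) / m ^ 2) :=
          mul_le_mul_of_nonneg_right (by linarith) h7
      _ = _ := by ring
  -- Here `32 = 2 · 4 · 4`: from the square of a sum, from `γ² ≤ 4κ²`, and from the bound on the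
  -- inverse-weighted sum of powers.
  have t2 : 2 * s2 ^ 2 ≤ 32 * D * κ ^ 2 * (Q ^ (1 / q) * Y) * z := by
    calc 2 * s2 ^ 2 ≤ 2 * (γ ^ 2 * (Y * (4 * (D * (Q ^ (1 / q) * z))))) := by linarith
      _ ≤ 2 * ((4 * κ ^ 2) * (Y * (4 * (D * (Q ^ (1 / q) * z))))) := by gcongr
      _ = _ := by ring
  linarith

end RCM

/-! ### One-dimensional Sobolev inequality and interpolation -/

namespace RCM

open Finset MeasureTheory

variable {ι : Type*} [Fintype ι] [DecidableEq ι]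

theorem sum_line_le (r : ℕ) {f : (ι → ℤ) → ℝ} (hf : ∀ x, 0 ≤ f x) {x : ι → ℤ}
    (hx : x ∈ cube ι r) (i : ι) :
    ∑ k ∈ Icc (-(r : ℤ)) r, f (Function.update x i k) ≤ ∑ y ∈ cube ι r, f y := by
  refine (sum_map (Icc (-(r : ℤ)) r)
    ⟨fun k => Function.update x i k, Function.update_injective x i⟩ f).symm.trans_le ?_
  refine sum_le_sum_of_subset_of_nonneg ?_ fun _ _ _ => hf _
  intro y hy
  simp only [mem_map, Function.Embedding.coeFn_mk] at hy
  obtain ⟨k, hk, rfl⟩ := hy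
  exact update_mem_cube hx i hk

/-- Sums along one line are enlarged to sums over the whole cube. Nothing is lost in dimension one,
where this is applied. -/
theorem le_sum_add_esum [Nonempty ι] (r : ℕ) {w : (ι → ℤ) → ℝ} (hw : ∀ x, 0 ≤ w x)
    {x : ι → ℤ} (hx : x ∈ cube ι r) :
    w x ≤ (∑ y ∈ cube ι r, w y) / (2 * r + 1) + esum r fun x i => |w (x + step i) - w x| := by
  obtain ⟨i⟩ := ‹Nonempty ι›
  have h1 := le_average_add_variation r (fun k => w (Function.update x i k)) (k := x i)
    (by rw [mem_Icc]; exact mem_cube.1 hx i)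
  simp only [Function.update_eq_self] at h1
  refine h1.trans ?_
  have h2 := sum_line_le r (f := fun x => w x / (2 * r + 1) +
    ∑ i, if x i < r then |w (x + step i) - w x| else 0)
    (fun x => add_nonneg (div_nonneg (hw x) (by positivity))
      (sum_nonneg fun i _ => by split_ifs <;> positivity)) hx i
  rw [sum_add_distrib (s := cube ι r), ← sum_div] at h2
  refine le_trans (sum_le_sum fun k _ => ?_) h2
  gcongr
  rw [← update_add_step]
  calc _ = if (Function.update x i k) i < r then
        |w (Function.update x i k + step i) - w (Function.update x i k)| else 0 := by simp
    _ ≤ _ := single_le_sum (f := fun j => if (Function.update x i k) j < r then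
        |w (Function.update x i k + step j) - w (Function.update x i k)| else 0)
        (fun j _ => by split_ifs <;> positivity) (mem_univ i)

/-- The one-dimensional weighted Sobolev inequality. -/
theorem sobolev_weighted_one {q : ℝ} (hD : Fintype.card ι = 1) (hq : 1 < q) (r : ℕ)
    {w : (ι → ℤ) → ℝ} (hw : ∀ x, 0 ≤ w x) {b : (ι → ℤ) → ι → ℝ} (hb : ∀ x i, 0 < b x i)
    {x : ι → ℤ} (hx : x ∈ cube ι r) :
    w x ^ 2 ≤ 2 * (2 * r + 1 : ℝ) ^ (1 - 1 / q) *
        ((esum r fun x i => (b x i)⁻¹ ^ q) ^ (1 / q) *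
            (esum r fun x i => b x i * (w (x + step i) - w x) ^ 2) +
          (((2 * r + 1 : ℝ)) ^ (Fintype.card ι)) ^ (1 / q) / (2 * r + 1) ^ 2 *
            ∑ x ∈ cube ι r, w x ^ 2) := by
  have : Nonempty ι := Fintype.card_pos_iff.1 (by omega)
  have h := le_sum_add_esum r hw hx
  set V := ∑ x ∈ cube ι r, w x ^ 2 with hV
  set Y := esum r fun x i => b x i * (w (x + step i) - w x) ^ 2 with hY
  set Q := esum r fun x i => (b x i)⁻¹ ^ q with hQ
  set m : ℝ := 2 * r + 1 with hm
  have hm0 : 0 < m := by positivity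
  have hY0 : 0 ≤ Y := esum_nonneg fun x i => mul_nonneg (hb x i).le (sq_nonneg _)
  have hqi : 1 / q < 1 := by rw [div_lt_one (by linarith)]; exact hq
  have hqi0 : 0 < 1 / q := by positivity
  have hcard : ((cube ι r).card : ℝ) = m := by rw [card_cube, hD, hm]; push_cast; ring
  have h1 : (∑ y ∈ cube ι r, w y) ^ 2 ≤ m * V := by
    have := sq_sum_le_card_mul_sum_sq (s := cube ι r) (f := w)
    rwa [hcard] at this
  have h2 : (esum r fun x i => |w (x + step i) - w x|) ^ 2 ≤
      Y * (Q ^ (1 / q) * m ^ (1 - 1 / q)) := by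
    have h3 : (esum r fun x i => |w (x + step i) - w x|) ^ 2 ≤
        Y * esum r fun x i => (b x i)⁻¹ := by
      rw [hY, esum_eq, esum_eq, esum_eq]
      refine sum_sq_le_sum_mul_sum_of_sq_le_mul _ (fun e _ => mul_nonneg (hb _ _).le (sq_nonneg _))
        (fun e _ => inv_nonneg.2 (hb _ _).le) fun e _ => ?_
      rw [sq_abs]
      have := (hb e.1 e.2).ne'
      field_simp
      rfl
    refine h3.trans (mul_le_mul_of_nonneg_left ?_ hY0)
    have h4 := esum_rpow_mul_rpow_le r (F := fun x i => (b x i)⁻¹ ^ q) (G := fun _ _ => 1)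
        (fun x i => Real.rpow_nonneg (inv_nonneg.2 (hb x i).le) _) (fun _ _ => zero_le_one) hqi0.le
        (by linarith : 0 ≤ 1 - 1 / q) (by ring)
    have hbi : ∀ x i, ((b x i)⁻¹ ^ q) ^ (1 / q) * (1 : ℝ) ^ (1 - 1 / q) = (b x i)⁻¹ := by
      intro x i
      rw [← Real.rpow_mul (inv_nonneg.2 (hb x i).le), mul_one_div_cancel (by linarith),
        Real.rpow_one, Real.one_rpow, mul_one]
    simp_rw [hbi] at h4
    refine h4.trans ?_
    have h5 := esum_left_le r (f := fun _ : ι → ℤ => (1 : ℝ)) (fun _ => zero_le_one)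
    rw [hD, sum_const, nsmul_eq_mul, hcard] at h5
    have h6 : (0 : ℝ) ≤ esum r fun (_ : ι → ℤ) (_ : ι) => (1 : ℝ) :=
      esum_nonneg fun _ _ => zero_le_one
    refine mul_le_mul_of_nonneg_left (Real.rpow_le_rpow h6 (by simpa using h5) (by linarith))
      (Real.rpow_nonneg ?_ _)
    exact esum_nonneg fun x i => Real.rpow_nonneg (inv_nonneg.2 (hb x i).le) _
  clear_value V Y Q m
  set S := ∑ y ∈ cube ι r, w y
  set s2 := esum r fun x i => |w (x + step i) - w x|
  have h7 : m ^ (1 - 1 / q) * ((m ^ Fintype.card ι) ^ (1 / q) / m ^ 2) = 1 / m := by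
    rw [hD, pow_one, ← mul_div_assoc, ← Real.rpow_add hm0]
    simp
    field_simp
  calc w x ^ 2 ≤ (S / m + s2) ^ 2 := by gcongr; exact hw x
    _ ≤ 2 * ((S / m) ^ 2 + s2 ^ 2) := add_sq_le
    _ ≤ 2 * (m * V / m ^ 2 + Y * (Q ^ (1 / q) * m ^ (1 - 1 / q))) := by
        rw [div_pow]; gcongr
    _ = 2 * (1 / m * V + Y * (Q ^ (1 / q) * m ^ (1 - 1 / q))) := by
        congr 2; field_simp
    _ = _ := by rw [← h7]; ring

/-- The exponent relation for the weighted interpolation inequality in dimension `D`: there is an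
exponent `κ` of the weighted Sobolev inequality with `1/p = (1/θ) (1 - 1/κ)` (`κ = ∞` if `D = 1`),
and `β` is the defect in scaling. -/
def InterpExponents (D : ℕ) (p q θ β : ℝ) : Prop :=
  1 < p ∧ 1 < q ∧ 1 < θ ∧ ((D = 1 ∧ θ = p ∧ β = 1 - 1 / q) ∨
    (2 ≤ D ∧ β = 0 ∧ ∃ κ : ℝ, 1 ≤ κ ∧ 1 / κ = 1 + 1 / q - 2 / (D : ℝ) ∧
      1 / p = 1 / θ * (1 - 1 / κ)))

/-- Hölder's inequality puts `g` into `L^p` and `w²` into the dual space. The latter lies between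
`L^1` and the space `L^κ` reached by the weighted Sobolev inequality (`L^∞` if the dimension is
one), and `1/θ` is the share of the Sobolev end-point. In the application `g` consists of the
conductances of the bonds that cross a slice, and `b` of those inside a slice. -/
theorem exists_weighted_interpolation (ι : Type*) [Fintype ι] [DecidableEq ι] {p q θ β : ℝ}
    (hE : InterpExponents (Fintype.card ι) p q θ β) :
    ∃ C : ℝ, 1 ≤ C ∧ ∀ (r : ℕ) (w : (ι → ℤ) → ℝ) (_ : ∀ x, 0 ≤ w x) (b : (ι → ℤ) → ι → ℝ)
      (_ : ∀ x i, 0 < b x i) (g : (ι → ℤ) → ℝ) (_ : ∀ x, 0 ≤ g x),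
      ∑ x ∈ cube ι r, g x * w x ^ 2 ≤ (∑ x ∈ cube ι r, g x ^ p) ^ (1 / p) *
        ((∑ x ∈ cube ι r, w x ^ 2) ^ (1 - 1 / θ) * (C * ((2 * r + 1 : ℝ) ^ β *
        ((esum r fun x i => (b x i)⁻¹ ^ q) ^ (1 / q) *
            (esum r fun x i => b x i * (w (x + step i) - w x) ^ 2) +
          (((2 * r + 1 : ℝ)) ^ (Fintype.card ι)) ^ (1 / q) / (2 * r + 1) ^ 2 *
            ∑ x ∈ cube ι r, w x ^ 2))) ^ (1 / θ)) := by
  obtain ⟨hp, hq, hθ, hE⟩ := hE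
  have hpi0 : 0 < 1 / p := by positivity
  have hθi0 : 0 < 1 / θ := by positivity
  have hpi : 1 / p < 1 := by rw [div_lt_one (by linarith)]; exact hp
  have hθi : 1 / θ < 1 := by rw [div_lt_one (by linarith)]; exact hθ
  rcases hE with ⟨hD, rfl, rfl⟩ | ⟨hD, rfl, κ, hκ, hκe, hpe⟩
  · refine ⟨2, by norm_num, fun r w hw b hb g hg => ?_⟩
    set T := (esum r fun x i => (b x i)⁻¹ ^ q) ^ (1 / q) *
            (esum r fun x i => b x i * (w (x + step i) - w x) ^ 2) +
          (((2 * r + 1 : ℝ)) ^ (Fintype.card ι)) ^ (1 / q) / (2 * r + 1) ^ 2 *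
            ∑ x ∈ cube ι r, w x ^ 2 with hT
    have h1 : ∀ x ∈ cube ι r, w x ^ 2 ≤ 2 * ((2 * r + 1 : ℝ) ^ (1 - 1 / q) * T) := by
      intro x hx
      rw [← mul_assoc]
      exact sobolev_weighted_one hD hq r hw hb hx
    set B := 2 * ((2 * r + 1 : ℝ) ^ (1 - 1 / q) * T)
    have hB : 0 ≤ B := (sq_nonneg _).trans (h1 0 (by rw [mem_cube]; intro i; simp))
    calc ∑ x ∈ cube ι r, g x * w x ^ 2
        ≤ ∑ x ∈ cube ι r, B ^ (1 / θ) * ((g x ^ θ) ^ (1 / θ) * (w x ^ 2) ^ (1 - 1 / θ)) := by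
          refine sum_le_sum fun x hx => ?_
          have e1 : w x ^ 2 = (w x ^ 2) ^ (1 / θ) * (w x ^ 2) ^ (1 - 1 / θ) := by
            rw [← Real.rpow_add_of_nonneg (sq_nonneg _) hθi0.le (by linarith)]
            simp
          have e2 : (g x ^ θ) ^ (1 / θ) = g x := by
            rw [← Real.rpow_mul (hg x), mul_one_div_cancel (by linarith), Real.rpow_one]
          rw [e2]
          have e3 : (w x ^ 2) ^ (1 / θ) ≤ B ^ (1 / θ) :=
            Real.rpow_le_rpow (sq_nonneg _) (h1 x hx) hθi0.le
          have e4 : 0 ≤ (w x ^ 2) ^ (1 - 1 / θ) := by positivity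
          calc g x * w x ^ 2 = (w x ^ 2) ^ (1 / θ) * (g x * (w x ^ 2) ^ (1 - 1 / θ)) := by
                rw [mul_left_comm, ← e1]
            _ ≤ _ := mul_le_mul_of_nonneg_right e3 (mul_nonneg (hg x) e4)
      _ ≤ B ^ (1 / θ) * ((∑ x ∈ cube ι r, g x ^ θ) ^ (1 / θ) *
            (∑ x ∈ cube ι r, w x ^ 2) ^ (1 - 1 / θ)) := by
          rw [← mul_sum]
          refine mul_le_mul_of_nonneg_left ?_ (Real.rpow_nonneg hB _)
          exact sum_rpow_mul_rpow_le _ (f := fun x => g x ^ θ) (g := fun x => w x ^ 2)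
            (fun x _ => Real.rpow_nonneg (hg x) _) (fun x _ => sq_nonneg _) hθi0.le
            (by linarith) (by ring)
      _ = _ := by ring
  · refine ⟨32 * Fintype.card ι * κ ^ 2, ?_, fun r w hw b hb g hg => ?_⟩
    · have : (2 : ℝ) ≤ Fintype.card ι := by exact_mod_cast hD
      exact one_le_mul_of_one_le_of_one_le (by linarith) (one_le_pow₀ hκ)
    have h1 := sobolev_weighted hD hq hκ hκe r hw hb
    rw [Real.rpow_zero, one_mul]
    set B := 32 * Fintype.card ι * κ ^ 2 * ((esum r fun x i => (b x i)⁻¹ ^ q) ^ (1 / q) *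
            (esum r fun x i => b x i * (w (x + step i) - w x) ^ 2) +
          (((2 * r + 1 : ℝ)) ^ (Fintype.card ι)) ^ (1 / q) / (2 * r + 1) ^ 2 *
            ∑ x ∈ cube ι r, w x ^ 2)
    clear_value B
    set Z := ∑ x ∈ cube ι r, w x ^ (2 * κ)
    have hzk : ∀ x, 0 ≤ w x ^ (2 * κ) := fun x => Real.rpow_nonneg (hw x) _
    have hZ0 : 0 ≤ Z := sum_nonneg fun x _ => hzk x
    set V := ∑ x ∈ cube ι r, w x ^ 2
    have hV0 : 0 ≤ V := sum_nonneg fun x _ => sq_nonneg _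
    have hG0 : 0 ≤ ∑ x ∈ cube ι r, g x ^ p := sum_nonneg fun x _ => Real.rpow_nonneg (hg x) _
    have hκi : 0 ≤ 1 / κ := by positivity
    set c := 1 / κ * (1 / θ) with hc
    have hc0 : 0 ≤ c := by positivity
    have hcp : 1 / p + c = 1 / θ := by rw [hpe, hc]; ring
    have hp' : 0 < 1 - 1 / p := by linarith
    -- the exponents of the interpolation
    set a := (1 - 1 / θ) / (1 - 1 / p) with ha
    set a' := c / (1 - 1 / p) with ha'
    have ha0 : 0 ≤ a := div_nonneg (by linarith) hp'.le
    have ha'0 : 0 ≤ a' := div_nonneg hc0 hp'.le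
    have haa : a + a' = 1 := by
      rw [ha, ha', ← add_div, div_eq_one_iff_eq hp'.ne']; linarith
    have hap : a * (1 - 1 / p) = 1 - 1 / θ := div_mul_cancel₀ _ hp'.ne'
    have hap' : a' * (1 - 1 / p) = c := div_mul_cancel₀ _ hp'.ne'
    have hκc : κ * c = 1 / θ := by rw [hc]; field_simp
    have e1 : ∀ x, w x ^ 2 = ((w x ^ 2) ^ a * (w x ^ (2 * κ)) ^ a') ^ (1 - 1 / p) := by
      intro x
      rw [Real.mul_rpow (by positivity) (Real.rpow_nonneg (hzk x) _),
        ← Real.rpow_mul (sq_nonneg _), ← Real.rpow_mul (hzk x), hap, hap',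
        ← Real.rpow_natCast, ← Real.rpow_mul (hw x), ← Real.rpow_mul (hw x),
        ← Real.rpow_add_of_nonneg (hw x) (by push_cast; nlinarith) (by positivity)]
      congr 1
      push_cast
      linarith
    have e2 : ∀ x, (g x ^ p) ^ (1 / p) = g x := fun x => by
      rw [← Real.rpow_mul (hg x), mul_one_div_cancel (by linarith), Real.rpow_one]
    have h2 := sum_rpow_mul_rpow_le (cube ι r) (f := fun x => g x ^ p)
      (g := fun x => (w x ^ 2) ^ a * (w x ^ (2 * κ)) ^ a')
      (fun x _ => Real.rpow_nonneg (hg x) _)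
      (fun x _ => mul_nonneg (by positivity) (Real.rpow_nonneg (hzk x) _)) hpi0.le hp'.le (by ring)
    simp only [← e1, e2] at h2
    refine h2.trans (mul_le_mul_of_nonneg_left ?_ (Real.rpow_nonneg hG0 _))
    have h3 := sum_rpow_mul_rpow_le (cube ι r) (f := fun x => w x ^ 2)
      (g := fun x => w x ^ (2 * κ)) (fun x _ => sq_nonneg _) (fun x _ => hzk x) ha0 ha'0 haa
    calc _ ≤ (V ^ a * Z ^ a') ^ (1 - 1 / p) :=
          Real.rpow_le_rpow (sum_nonneg fun x _ =>
            mul_nonneg (by positivity) (Real.rpow_nonneg (hzk x) _)) h3 hp'.le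
      _ = V ^ (1 - 1 / θ) * (Z ^ (1 / κ)) ^ (1 / θ) := by
          rw [Real.mul_rpow (by positivity) (by positivity), ← Real.rpow_mul hV0,
            ← Real.rpow_mul hZ0, ← Real.rpow_mul hZ0, hap, hap']
      _ ≤ _ := by gcongr

/-- The interpolation that yields the gain of integrability in the parabolic setting. -/
theorem exists_parabolic_interpolation (ι : Type*) [Fintype ι] [DecidableEq ι] {q δ : ℝ}
    (hD : 2 ≤ Fintype.card ι) (hq : 1 < q) (hδ0 : 0 ≤ δ) (hδ1 : δ < 1)
    (hδ : δ = 2 / (Fintype.card ι : ℝ) - 1 / q) :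
    ∃ C : ℝ, 1 ≤ C ∧ ∀ (r : ℕ) (w : (ι → ℤ) → ℝ) (_ : ∀ x, 0 ≤ w x) (b : (ι → ℤ) → ι → ℝ)
      (_ : ∀ x i, 0 < b x i),
      ∑ x ∈ cube ι r, (w x ^ (1 + δ)) ^ 2 ≤ (∑ x ∈ cube ι r, w x ^ 2) ^ δ * (C *
        ((esum r fun x i => (b x i)⁻¹ ^ q) ^ (1 / q) *
            (esum r fun x i => b x i * (w (x + step i) - w x) ^ 2) +
          (((2 * r + 1 : ℝ)) ^ (Fintype.card ι)) ^ (1 / q) / (2 * r + 1) ^ 2 *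
            ∑ x ∈ cube ι r, w x ^ 2)) := by
  -- With this `κ` one has `2(1+δ) = 2δ + 2κ(1-δ)`, so Hölder with weights `δ` and `1-δ` leaves the
  -- Sobolev norm with power exactly one, and it can be integrated in time.
  set κ := 1 / (1 - δ) with hκd
  have hκ : 1 ≤ κ := by rw [hκd, le_div_iff₀ (by linarith)]; linarith
  have hκi : 1 / κ = 1 - δ := by rw [hκd, one_div_one_div]
  have hκe : 1 / κ = 1 + 1 / q - 2 / (Fintype.card ι : ℝ) := by rw [hκi, hδ]; ring
  refine ⟨32 * Fintype.card ι * κ ^ 2, ?_, fun r w hw b hb => ?_⟩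
  · have : (2 : ℝ) ≤ Fintype.card ι := by exact_mod_cast hD
    exact one_le_mul_of_one_le_of_one_le (by linarith) (one_le_pow₀ hκ)
  have h1 := sobolev_weighted hD hq hκ hκe r hw hb
  have hzk : ∀ x, 0 ≤ w x ^ (2 * κ) := fun x => Real.rpow_nonneg (hw x) _
  have hV0 : 0 ≤ ∑ x ∈ cube ι r, w x ^ 2 := sum_nonneg fun x _ => sq_nonneg _
  refine le_trans ?_ (mul_le_mul_of_nonneg_left h1 (Real.rpow_nonneg hV0 _))
  have h3 := sum_rpow_mul_rpow_le (cube ι r) (f := fun x => w x ^ 2)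
      (g := fun x => w x ^ (2 * κ)) (fun x _ => sq_nonneg _) (fun x _ => hzk x) hδ0
      (by linarith : 0 ≤ 1 - δ) (by ring)
  rw [hκi]
  refine le_trans (sum_le_sum fun x _ => le_of_eq ?_) h3
  have : κ * (1 - δ) = 1 := by rw [hκd]; field_simp; exact div_self (by linarith)
  rw [← Real.rpow_natCast, ← Real.rpow_natCast, ← Real.rpow_mul (hw x), ← Real.rpow_mul (hw x),
    ← Real.rpow_mul (hw x), ← Real.rpow_add_of_nonneg (hw x) (by push_cast; linarith)
    (mul_nonneg (by linarith) (by linarith))]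
  congr 1
  push_cast
  linarith

end RCM

/-! ### Subsolutions and the Caccioppoli inequality -/

namespace RCM

open Finset MeasureTheory

variable {ι : Type*} [Fintype ι] [DecidableEq ι]

/-- The generator written as a sum over the coordinate directions. -/
noncomputable def lap (a : (ι → ℤ) → ι → ℝ) (w : (ι → ℤ) → ℝ) (x : ι → ℤ) : ℝ :=
  ∑ i, (a x i * (w (x + step i) - w x) + a (x - step i) i * (w (x - step i) - w x))

/-- Nonnegative subsolutions in the cylinder `[-N², 0] × [-N, N]^d`, continuous in time. -/
structure IsSubsol (a : (ι → ℤ) → ι → ℝ) (N : ℕ) (v : ℝ → (ι → ℤ) → ℝ) : Prop where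
  cont : ∀ x, Continuous fun t => v t x
  nonneg : ∀ t x, 0 ≤ v t x
  deriv : ∀ t ∈ Set.Ioo (-(N : ℝ) ^ 2) 0, ∀ x ∈ cube ι (N - 1),
    ∃ v', HasDerivAt (fun s => v s x) v' t ∧ v' ≤ lap a (v t) x

/-- Convexity of `x ↦ x^α`: by the chain rule the time derivative is `α v^(α-1) ∂ₜv`, while the
tangent inequality on each bond shows that `α v^(α-1)` times the generator of `v` is at most the
generator of `v^α`. -/
theorem IsSubsol.rpow {a : (ι → ℤ) → ι → ℝ} (ha : ∀ x i, 0 < a x i) {N : ℕ}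
    {v : ℝ → (ι → ℤ) → ℝ} (h : IsSubsol a N v) {α : ℝ} (hα : 1 ≤ α) :
    IsSubsol a N fun t x => v t x ^ α where
  cont x := (h.cont x).rpow_const fun _ => Or.inr (by linarith)
  nonneg t x := Real.rpow_nonneg (h.nonneg t x) _
  deriv t ht x hx := by
    obtain ⟨v', hv, hle⟩ := h.deriv t ht x hx
    refine ⟨_, hv.rpow_const (Or.inr hα), ?_⟩
    have h0 : 0 ≤ α * v t x ^ (α - 1) :=
      mul_nonneg (by linarith) (Real.rpow_nonneg (h.nonneg t x) _)
    calc v' * α * v t x ^ (α - 1) = α * v t x ^ (α - 1) * v' := by ring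
      _ ≤ α * v t x ^ (α - 1) * lap a (v t) x := mul_le_mul_of_nonneg_left hle h0
      _ ≤ _ := by
        unfold lap
        rw [mul_sum]
        refine sum_le_sum fun i _ => ?_
        have h1 := mul_le_mul_of_nonneg_left
          (rpow_tangent_le hα (h.nonneg t x) (h.nonneg t (x + step i))) (ha x i).le
        have h2 := mul_le_mul_of_nonneg_left
          (rpow_tangent_le hα (h.nonneg t x) (h.nonneg t (x - step i))) (ha (x - step i) i).le
        linarith

theorem sum_cube_shift {r : ℕ} (hr : 1 ≤ r) {G : (ι → ℤ) → ℝ}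
    (hG : ∀ x, x ∉ cube ι (r - 1) → G x = 0) (i : ι) :
    ∑ x ∈ cube ι r, G x = ∑ x ∈ cube ι r, G (x + step i) := by
  have h1 : ∑ x ∈ cube ι (r - 1), G x = ∑ x ∈ cube ι r, G x :=
    sum_subset (cube_mono (by omega)) fun x _ hx => hG x hx
  have h2 : ∑ x ∈ cube ι (r - 1), G x =
      ∑ x ∈ (cube ι r).map (addRightEmbedding (step i)), G x := by
    refine sum_subset (fun x hx => ?_) fun x _ hx => hG x hx
    rw [mem_map]
    refine ⟨x - step i, ?_, by simp⟩
    rw [mem_cube] at hx ⊢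
    intro j
    have := hx j
    by_cases hj : j = i
    · subst hj; simp; omega
    · simp [step_ne hj]; omega
  rw [← h1, h2, sum_map]
  rfl

/-- Summation by parts. Since `g` vanishes outside the cube of radius `r - 1`, a shift by one site
creates no boundary terms. -/
theorem sum_mul_lap {r : ℕ} (hr : 1 ≤ r) (a : (ι → ℤ) → ι → ℝ) (w : (ι → ℤ) → ℝ)
    {g : (ι → ℤ) → ℝ} (hg : ∀ x, x ∉ cube ι (r - 1) → g x = 0) :
    ∑ x ∈ cube ι r, g x * lap a w x =
      -esum r fun x i => a x i * ((g (x + step i) - g x) * (w (x + step i) - w x)) := by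
  have hlast : ∀ x : ι → ℤ, ∀ i, ¬ x i < r → g x = 0 ∧ g (x + step i) = 0 := by
    intro x i h
    constructor <;> refine hg _ fun hm => ?_ <;> have := mem_cube.1 hm i
    · omega
    · simp at this; omega
  unfold lap esum
  simp_rw [mul_sum]
  rw [sum_comm, sum_comm (s := cube ι r), ← sum_neg_distrib]
  refine sum_congr rfl fun i _ => ?_
  simp_rw [mul_add]
  rw [sum_add_distrib, sum_cube_shift hr (G := fun x =>
    g x * (a (x - step i) i * (w (x - step i) - w x))) (fun x hx => by simp [hg x hx]) i,
    ← sum_add_distrib, ← sum_neg_distrib]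
  refine sum_congr rfl fun x _ => ?_
  simp only [add_sub_cancel_right]
  split_ifs with h
  · ring
  · obtain ⟨h1, h2⟩ := hlast x i h
    simp [h1, h2]

/-- Write `β²y - α²x` as `(α²+β²)(y-x)/2 + (β²-α²)(x+y)/2`. Half of the square passed to `nlinarith`
controls the mixed term; then `(α+β)² ≤ 2(α²+β²)` and `(x+y)² ≤ 2(x²+y²)`. -/
theorem caccioppoli_pointwise (α β x y : ℝ) :
    (α ^ 2 + β ^ 2) / 4 * (y - x) ^ 2 - (β - α) ^ 2 * (x ^ 2 + y ^ 2) ≤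
      (β ^ 2 * y - α ^ 2 * x) * (y - x) := by
  nlinarith [sq_nonneg ((α + β) * (y - x) / 2 + (β - α) * (y + x)),
    mul_nonneg (sq_nonneg (α - β)) (sq_nonneg (y - x)),
    mul_nonneg (sq_nonneg (β - α)) (sq_nonneg (y - x))]

theorem energy_pointwise {s r : ℕ} (hsr : s < r) {a : (ι → ℤ) → ι → ℝ} (ha : ∀ x i, 0 < a x i)
    (w : (ι → ℤ) → ℝ) {η : (ι → ℤ) → ℝ} (h1 : ∀ x ∈ cube ι s, η x = 1)
    (h0 : ∀ x, x ∉ cube ι (r - 1) → η x = 0) :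
    ∑ x ∈ cube ι r, 2 * (η x ^ 2 * w x) * lap a w x ≤
      -(esum s fun x i => a x i * (w (x + step i) - w x) ^ 2) +
      2 * esum r fun x i => a x i * (η (x + step i) - η x) ^ 2 *
        (w x ^ 2 + w (x + step i) ^ 2) := by
  have e : ∑ x ∈ cube ι r, 2 * (η x ^ 2 * w x) * lap a w x =
      2 * ∑ x ∈ cube ι r, (η x ^ 2 * w x) * lap a w x := by
    rw [mul_sum]; exact sum_congr rfl fun x _ => by ring
  rw [e, sum_mul_lap (by omega) a w (g := fun x => η x ^ 2 * w x) fun x hx => by simp [h0 x hx]]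
  have k1 : (esum s fun x i => a x i * (w (x + step i) - w x) ^ 2) ≤
      esum r fun x i => a x i * ((η x ^ 2 + η (x + step i) ^ 2) / 2 * (w (x + step i) - w x) ^ 2) := by
    refine le_trans (esum_le_esum fun x hx i hx' => le_of_eq ?_) (esum_mono hsr.le fun x i => ?_)
    · rw [h1 x hx, h1 _ hx']; ring
    · have := (ha x i).le; positivity
  have k2 : (esum r fun x i => a x i * ((η x ^ 2 + η (x + step i) ^ 2) / 2 * (w (x + step i) - w x) ^ 2)) ≤
      2 * (esum r fun x i => a x i * (((η (x + step i)) ^ 2 * w (x + step i) - η x ^ 2 * w x) *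
        (w (x + step i) - w x))) +
      2 * esum r fun x i => a x i * (η (x + step i) - η x) ^ 2 * (w x ^ 2 + w (x + step i) ^ 2) := by
    rw [← esum_mul_left, ← esum_mul_left, ← esum_add]
    refine esum_le_esum fun x _ i _ => ?_
    have := mul_le_mul_of_nonneg_left
      (caccioppoli_pointwise (η x) (η (x + step i)) (w x) (w (x + step i))) (ha x i).le
    linarith
  linarith

theorem continuous_esum {r : ℕ} {F : ℝ → (ι → ℤ) → ι → ℝ}
    (h : ∀ x i, Continuous fun t => F t x i) : Continuous fun t => esum r (F t) := by
  unfold esum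
  refine continuous_finsetSum _ fun x _ => continuous_finsetSum _ fun i _ => ?_
  split_ifs
  · exact h x i
  · exact continuous_const

theorem IsSubsol.energy {a : (ι → ℤ) → ι → ℝ} (ha : ∀ x i, 0 < a x i) {N : ℕ}
    {v : ℝ → (ι → ℤ) → ℝ} (h : IsSubsol a N v) {s r : ℕ} (hsr : s < r) (hrN : r ≤ N)
    {η : (ι → ℤ) → ℝ} (h1 : ∀ x ∈ cube ι s, η x = 1)
    (h0 : ∀ x, x ∉ cube ι (r - 1) → η x = 0) {t₁ t₂ : ℝ} (ht₁ : -(N : ℝ) ^ 2 ≤ t₁)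
    (ht : t₁ ≤ t₂) (ht₂ : t₂ ≤ 0) :
    (∑ x ∈ cube ι r, η x ^ 2 * v t₂ x ^ 2) +
        ∫ t in t₁..t₂, (esum s fun x i => a x i * (v t (x + step i) - v t x) ^ 2) ≤
      (∑ x ∈ cube ι r, η x ^ 2 * v t₁ x ^ 2) +
        ∫ t in t₁..t₂, 2 * esum r fun x i => a x i * (η (x + step i) - η x) ^ 2 *
          (v t x ^ 2 + v t (x + step i) ^ 2) := by
  classical
  have hc := h.cont
  have c1 : Continuous fun t => esum s fun x i => a x i * (v t (x + step i) - v t x) ^ 2 :=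
    continuous_esum fun x i => ((hc _).sub (hc x) |>.pow 2).const_mul _ 
  have c2 : Continuous fun t => 2 * esum r fun x i => a x i * (η (x + step i) - η x) ^ 2 *
          (v t x ^ 2 + v t (x + step i) ^ 2) :=
    (continuous_esum fun x i => (((hc x).pow 2).add ((hc _).pow 2)).const_mul _).const_mul _
  have c1' : Continuous fun t => -esum s fun x i => a x i * (v t (x + step i) - v t x) ^ 2 :=
    c1.neg
  -- This form of the fundamental theorem asks for continuity on the closed interval and a
  -- derivative only inside, which suits subsolutions that are differentiable at interior times.
  have key := intervalIntegral.sub_le_integral_of_hasDeriv_right_of_le ht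
    (g := fun t => ∑ x ∈ cube ι r, η x ^ 2 * v t x ^ 2)
    (g' := fun t => ∑ x ∈ cube ι r, η x ^ 2 * (2 * v t x * _root_.deriv (fun s => v s x) t))
    (φ := fun t => -(esum s fun x i => a x i * (v t (x + step i) - v t x) ^ 2) +
      2 * esum r fun x i => a x i * (η (x + step i) - η x) ^ 2 *
          (v t x ^ 2 + v t (x + step i) ^ 2)) ?_ ?_ ?_ ?_
  · rw [intervalIntegral.integral_add (c1'.intervalIntegrable _ _)
      (c2.intervalIntegrable _ _), intervalIntegral.integral_neg] at key
    linarith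
  · refine Continuous.continuousOn (continuous_finsetSum _ fun x _ => ?_)
    exact ((hc x).pow 2).const_mul _
  · intro t ht'
    refine HasDerivAt.hasDerivWithinAt (HasDerivAt.fun_sum fun x _ => ?_)
    by_cases hx : x ∈ cube ι (r - 1)
    · obtain ⟨v', hv, -⟩ := h.deriv t ⟨by linarith [ht'.1], by linarith [ht'.2]⟩ x
        (cube_mono (by omega) hx)
      rw [hv.deriv]
      have := (hv.pow 2).const_mul (η x ^ 2)
      simpa using this
    -- Outside the smaller cube `v` need not be differentiable, but there `η = 0`, so the summand is
    -- constant and the default value of `deriv` is multiplied by zero.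
    · simp only [h0 x hx]
      simpa using hasDerivAt_const t (0 : ℝ)
  · exact ((c1.neg.add c2).continuousOn).integrableOn_Icc
  · intro t ht'
    refine le_trans (sum_le_sum fun x _ => ?_) (energy_pointwise hsr ha (v t) h1 h0)
    by_cases hx : x ∈ cube ι (r - 1)
    · obtain ⟨v', hv, hle⟩ := h.deriv t ⟨by linarith [ht'.1], by linarith [ht'.2]⟩ x
        (cube_mono (by omega) hx)
      rw [hv.deriv]
      have h3 : 0 ≤ 2 * (η x ^ 2 * v t x) := mul_nonneg (by norm_num)
        (mul_nonneg (sq_nonneg _) (h.nonneg t x))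
      calc _ = 2 * (η x ^ 2 * v t x) * v' := by ring
        _ ≤ _ := mul_le_mul_of_nonneg_left hle h3
    · simp [h0 x hx]

/-- The Caccioppoli inequality for a general spatial cut-off function. -/
theorem IsSubsol.caccioppoli {a : (ι → ℤ) → ι → ℝ} (ha : ∀ x i, 0 < a x i) {N : ℕ}
    {v : ℝ → (ι → ℤ) → ℝ} (h : IsSubsol a N v) {s r : ℕ} (hsr : s < r) (hrN : r ≤ N)
    {η : (ι → ℤ) → ℝ} (h1 : ∀ x ∈ cube ι s, η x = 1)
    (h0 : ∀ x, x ∉ cube ι (r - 1) → η x = 0) (hη0 : ∀ x, 0 ≤ η x) (hη1 : ∀ x, η x ≤ 1)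
    {W : ℝ} (hW : (∫ t in (-(N * r : ℝ))..0, ∑ x ∈ cube ι r, v t x ^ 2) / (N * ((r : ℝ) - s)) +
      (∫ t in (-(N * r : ℝ))..0, 2 * esum r fun x i => a x i * (η (x + step i) - η x) ^ 2 *
          (v t x ^ 2 + v t (x + step i) ^ 2)) ≤ W) :
    (∀ t ∈ Set.Icc (-(N * s : ℝ)) 0, ∑ x ∈ cube ι s, v t x ^ 2 ≤ W) ∧
    ∫ t in (-(N * s : ℝ))..0, (esum s fun x i => a x i * (v t (x + step i) - v t x) ^ 2) ≤ W := by
  have hc := h.cont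
  have hN : (0 : ℝ) < N := by exact_mod_cast (by omega : 0 < N)
  have hsr' : (0 : ℝ) < (r : ℝ) - s := by rw [sub_pos]; exact_mod_cast hsr
  have hrN' : (r : ℝ) ≤ N := by exact_mod_cast hrN
  have hs0 : (0 : ℝ) ≤ s := by positivity
  set F := fun t => ∑ x ∈ cube ι r, η x ^ 2 * v t x ^ 2 with hF
  set Dn := fun t => esum s fun x i => a x i * (v t (x + step i) - v t x) ^ 2 with hDn
  set R := fun t => 2 * esum r fun x i => a x i * (η (x + step i) - η x) ^ 2 *
          (v t x ^ 2 + v t (x + step i) ^ 2) with hR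
  have cF : Continuous F := continuous_finsetSum _ fun x _ => ((hc x).pow 2).const_mul _
  have cX : Continuous fun t => ∑ x ∈ cube ι r, v t x ^ 2 :=
    continuous_finsetSum _ fun x _ => (hc x).pow 2
  have cD : Continuous Dn :=
    continuous_esum fun x i => ((hc _).sub (hc x) |>.pow 2).const_mul _ 
  have cR : Continuous R :=
    (continuous_esum fun x i => (((hc x).pow 2).add ((hc _).pow 2)).const_mul _).const_mul _
  have hD0 : ∀ t, 0 ≤ Dn t := fun t => esum_nonneg fun x i => mul_nonneg (ha x i).le (sq_nonneg _)
  have hR0 : ∀ t, 0 ≤ R t := fun t => mul_nonneg (by norm_num) (esum_nonneg fun x i =>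
    mul_nonneg (mul_nonneg (ha x i).le (sq_nonneg _)) (by positivity))
  have hF0 : ∀ t, 0 ≤ F t := fun t => sum_nonneg fun x _ => by positivity
  have hFX : ∀ t, F t ≤ ∑ x ∈ cube ι r, v t x ^ 2 := fun t => sum_le_sum fun x _ =>
    mul_le_of_le_one_left (sq_nonneg _) (pow_le_one₀ (hη0 x) (hη1 x))
  have hle : -(N * r : ℝ) ≤ -(N * s : ℝ) := by nlinarith
  have hs00 : -(N * s : ℝ) ≤ 0 := by nlinarith
  have hNr : -(N : ℝ) ^ 2 ≤ -(N * r : ℝ) := by nlinarith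
  -- a good initial time
  obtain ⟨t₀, ht₀, hmin⟩ : ∃ t₀ ∈ Set.Icc (-(N * r : ℝ)) (-(N * s : ℝ)),
      F t₀ ≤ (∫ t in (-(N * r : ℝ))..0, ∑ x ∈ cube ι r, v t x ^ 2) / (N * ((r : ℝ) - s)) := by
    -- A starting time that minimises `F` replaces a cut-off in time: the minimum is at most the
    -- mean over a window of length `N (r - s)`.
    obtain ⟨t₀, ht₀, hm⟩ := isCompact_Icc.exists_isMinOn (Set.nonempty_Icc.2 hle) cF.continuousOn
    refine ⟨t₀, ht₀, ?_⟩
    rw [le_div_iff₀ (by positivity)]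
    calc F t₀ * (N * ((r : ℝ) - s)) = ∫ _ in (-(N * r : ℝ))..(-(N * s : ℝ)), F t₀ := by
          rw [intervalIntegral.integral_const, smul_eq_mul]; ring
      _ ≤ ∫ t in (-(N * r : ℝ))..(-(N * s : ℝ)), F t :=
          intervalIntegral.integral_mono_on hle (by simp) (cF.intervalIntegrable _ _)
            fun t ht => hm ht
      _ ≤ ∫ t in (-(N * r : ℝ))..(-(N * s : ℝ)), ∑ x ∈ cube ι r, v t x ^ 2 :=
          intervalIntegral.integral_mono_on hle (cF.intervalIntegrable _ _)
            (cX.intervalIntegrable _ _) fun t _ => hFX t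
      _ ≤ _ := intervalIntegral.integral_mono_interval le_rfl hle hs00
          (Filter.Eventually.of_forall fun t => sum_nonneg fun x _ => sq_nonneg _)
          (cX.intervalIntegrable _ _)
  have main : ∀ t ∈ Set.Icc (-(N * s : ℝ)) 0, F t + ∫ τ in t₀..t, Dn τ ≤ W := by
    intro t ht
    have ht₀t : t₀ ≤ t := ht₀.2.trans ht.1
    have e := h.energy ha hsr hrN h1 h0 (hNr.trans ht₀.1) ht₀t ht.2
    have e2 : ∫ τ in t₀..t, R τ ≤ ∫ τ in (-(N * r : ℝ))..0, R τ :=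
      intervalIntegral.integral_mono_interval ht₀.1 ht₀t ht.2
        (Filter.Eventually.of_forall hR0) (cR.intervalIntegrable _ _)
    linarith
  constructor
  · intro t ht
    have h2 : 0 ≤ ∫ τ in t₀..t, Dn τ :=
      intervalIntegral.integral_nonneg (ht₀.2.trans ht.1) fun _ _ => hD0 _
    have h3 : ∑ x ∈ cube ι s, v t x ^ 2 ≤ F t := by
      calc ∑ x ∈ cube ι s, v t x ^ 2 = ∑ x ∈ cube ι s, η x ^ 2 * v t x ^ 2 :=
            sum_congr rfl fun x hx => by rw [h1 x hx]; ring
        _ ≤ _ := sum_le_sum_of_subset_of_nonneg (cube_mono hsr.le) fun x _ _ => by positivity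
    linarith [main t ht]
  · have h2 : ∫ τ in (-(N * s : ℝ))..0, Dn τ ≤ ∫ τ in t₀..0, Dn τ :=
      intervalIntegral.integral_mono_interval ht₀.2 hs00 le_rfl
        (Filter.Eventually.of_forall hD0) (cD.intervalIntegrable _ _)
    linarith [main 0 ⟨hs00, le_rfl⟩, hF0 0]

end RCM

/-! ### Good levels and the adapted cut-off function -/

namespace RCM

open Finset MeasureTheory

/-- Among the levels in `[s, r)` at least a fifth are good for four quantities simultaneously. -/
theorem exists_good_levels {s r : ℕ} (hsr : s < r) (f : Fin 4 → ℕ → ℝ) (T : Fin 4 → ℝ)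
    (hf : ∀ j l, 0 ≤ f j l) (hT : ∀ j, ∑ l ∈ Ico s r, f j l ≤ T j) :
    ∃ G ⊆ Ico s r, ((r : ℝ) - s) ≤ 5 * (G.card : ℝ) ∧
      ∀ l ∈ G, ∀ j, f j l ≤ 5 * T j / ((r : ℝ) - s) := by
  classical
  have hm : (0 : ℝ) < (r : ℝ) - s := by rw [sub_pos]; exact_mod_cast hsr
  set G := (Ico s r).filter fun l => ∀ j, f j l ≤ 5 * T j / ((r : ℝ) - s) with hG
  refine ⟨G, filter_subset _ _, ?_, fun l hl => (mem_filter.1 hl).2⟩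
  -- By Markov's inequality each of the four quantities spoils at most a fifth of the levels, so at
  -- least a fifth remains.
  let bad : Fin 4 → Finset ℕ := fun j => (Ico s r).filter fun l => 5 * T j / ((r : ℝ) - s) < f j l
  have hbad : ∀ j, 5 * ((bad j).card : ℝ) ≤ (r : ℝ) - s := by
    intro j
    have hT0 : 0 ≤ T j := (sum_nonneg fun l _ => hf j l).trans (hT j)
    have h1 : (bad j).card * (5 * T j / ((r : ℝ) - s)) ≤ ∑ l ∈ bad j, f j l := by
      rw [← nsmul_eq_mul]
      exact card_nsmul_le_sum _ _ _ fun l hl => (mem_filter.1 hl).2.le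
    have h2 : ∑ l ∈ bad j, f j l ≤ T j :=
      (sum_le_sum_of_subset_of_nonneg (filter_subset _ _) fun l _ _ => hf j l).trans (hT j)
    rcases hT0.eq_or_lt with h0 | h0
    -- If the total is zero the threshold is zero too and Markov's inequality says nothing; but then
    -- the quantity vanishes at every level.
    · have : bad j = ∅ := by
        rw [filter_eq_empty_iff]
        intro l hl
        have h3 := (single_le_sum (fun l _ => hf j l) hl).trans (hT j)
        rw [← h0] at h3 ⊢
        simpa using h3
      rw [this]; simp [hm.le]
    · have h3 := h1.trans h2
      rw [mul_div_assoc', div_le_iff₀ hm] at h3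
      nlinarith
  have hcov : Ico s r ⊆ G ∪ univ.biUnion bad := by
    intro l hl
    by_cases h : l ∈ G
    · exact mem_union_left _ h
    · refine mem_union_right _ ?_
      rw [mem_biUnion]
      simp only [hG, mem_filter, hl, true_and, not_forall, not_le] at h
      obtain ⟨j, hj⟩ := h
      exact ⟨j, mem_univ _, mem_filter.2 ⟨hl, hj⟩⟩
  have hcard : r - s ≤ G.card + ∑ j, (bad j).card := by
    calc r - s = (Ico s r).card := by simp
      _ ≤ _ := (card_le_card hcov).trans ((card_union_le _ _).trans
          (Nat.add_le_add_left card_biUnion_le _))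
  have hcard' : (r : ℝ) - s ≤ G.card + ∑ j, ((bad j).card : ℝ) := by
    rw [← Nat.cast_sub hsr.le]; exact_mod_cast hcard
  have h5 : ∑ j, 5 * ((bad j).card : ℝ) ≤ ∑ _j : Fin 4, ((r : ℝ) - s) := sum_le_sum fun j _ => hbad j
  rw [← mul_sum, sum_const] at h5
  simp only [card_univ, Fintype.card_fin, nsmul_eq_mul] at h5
  push_cast at h5
  linarith

/-- The radial profile dropping by equal amounts at the levels in `G`. -/
noncomputable def profile (G : Finset ℕ) (l : ℕ) : ℝ := ((G.filter fun l' => l ≤ l').card : ℝ) / G.card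

theorem profile_nonneg (G : Finset ℕ) (l : ℕ) : 0 ≤ profile G l := by unfold profile; positivity

theorem profile_le_one (G : Finset ℕ) (l : ℕ) : profile G l ≤ 1 :=
  div_le_one_of_le₀ (by exact_mod_cast card_filter_le _ _) (by positivity)

theorem profile_eq_one {G : Finset ℕ} (hG : G.Nonempty) {s r l : ℕ} (h : G ⊆ Ico s r) (hl : l ≤ s) :
    profile G l = 1 := by
  unfold profile
  rw [filter_true_of_mem fun l' hl' => hl.trans (mem_Ico.1 (h hl')).1]
  exact div_self (by exact_mod_cast hG.card_pos.ne')

theorem profile_eq_zero {G : Finset ℕ} {s r l : ℕ} (h : G ⊆ Ico s r) (hl : r ≤ l) :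
    profile G l = 0 := by
  unfold profile
  rw [filter_false_of_mem fun l' hl' => by have := (mem_Ico.1 (h hl')).2; omega]
  simp

theorem profile_sub (G : Finset ℕ) (l : ℕ) :
    profile G l - profile G (l + 1) = if l ∈ G then 1 / (G.card : ℝ) else 0 := by
  unfold profile
  have : (G.filter fun l' => l ≤ l') = (G.filter fun l' => l + 1 ≤ l') ∪ G.filter fun l' => l' = l := by
    ext x; simp only [mem_union, mem_filter]; grind
  rw [this, card_union_of_disjoint, filter_eq']
  · split_ifs <;> simp; ring
  · rw [disjoint_filter]; intro x _ h1; omega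

/-- The radial level of the bond between `k` and `k + 1`. -/
def level (k : ℤ) : ℕ := min k.natAbs (k + 1).natAbs

theorem profile_natAbs_sub_sq (G : Finset ℕ) (k : ℤ) :
    (profile G (k + 1).natAbs - profile G k.natAbs) ^ 2 =
      if level k ∈ G then (1 / (G.card : ℝ)) ^ 2 else 0 := by
  have h := profile_sub G (level k)
  rcases le_or_gt 0 k with hk | hk
  · have e1 : level k = k.natAbs := by unfold level; omega
    have e2 : (k + 1).natAbs = level k + 1 := by unfold level; omega
    rw [e2, ← e1, ← neg_sq, neg_sub, h]
    split_ifs <;> simp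
  · have e1 : level k = (k + 1).natAbs := by unfold level; omega
    have e2 : k.natAbs = level k + 1 := by unfold level; omega
    rw [e2, ← e1, h]
    split_ifs <;> simp

/-- The spatial cut-off function with radial profile `profile G`. -/
noncomputable def cutoff {ι : Type*} [Fintype ι] (G : Finset ℕ) (x : ι → ℤ) : ℝ := ∏ i, profile G (x i).natAbs

theorem cutoff_nonneg {ι : Type*} [Fintype ι] (G : Finset ℕ) (x : ι → ℤ) : 0 ≤ cutoff G x :=
  prod_nonneg fun _ _ => profile_nonneg _ _

theorem cutoff_le_one {ι : Type*} [Fintype ι] (G : Finset ℕ) (x : ι → ℤ) : cutoff G x ≤ 1 :=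
  prod_le_one (fun _ _ => profile_nonneg _ _) fun _ _ => profile_le_one _ _

variable {ι : Type*} [Fintype ι] [DecidableEq ι]

theorem cutoff_eq_one {G : Finset ℕ} (hG : G.Nonempty) {s r : ℕ} (h : G ⊆ Ico s r) {x : ι → ℤ}
    (hx : x ∈ cube ι s) : cutoff G x = 1 :=
  prod_eq_one fun i _ => profile_eq_one hG h (by have := mem_cube.1 hx i; omega)

theorem cutoff_eq_zero {G : Finset ℕ} {s r : ℕ} (hr : 1 ≤ r) (h : G ⊆ Ico s r) {x : ι → ℤ}
    (hx : x ∉ cube ι (r - 1)) : cutoff G x = 0 := by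
  rw [mem_cube, not_forall] at hx
  obtain ⟨i, hi⟩ := hx
  exact prod_eq_zero (mem_univ i) (profile_eq_zero h (by omega))

/-- A step in direction `i` changes only the `i`-th factor of the product, and the other factors are
at most one. -/
theorem cutoff_sub_sq_le (G : Finset ℕ) (x : ι → ℤ) (i : ι) :
    (cutoff G (x + step i) - cutoff G x) ^ 2 ≤
      if level (x i) ∈ G then (1 / (G.card : ℝ)) ^ 2 else 0 := by
  rw [← profile_natAbs_sub_sq]
  unfold cutoff
  rw [← mul_prod_erase _ _ (mem_univ i), ← mul_prod_erase univ (fun j => profile G (x j).natAbs) (mem_univ i)]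
  have : ∏ j ∈ univ.erase i, profile G ((x + step i) j).natAbs =
      ∏ j ∈ univ.erase i, profile G (x j).natAbs :=
    prod_congr rfl fun j hj => by simp [step_ne (ne_of_mem_erase hj)]
  rw [this, ← sub_mul, mul_pow]
  simp only [Pi.add_apply, step_same]
  refine mul_le_of_le_one_right (sq_nonneg _) (pow_le_one₀ (prod_nonneg fun _ _ => profile_nonneg _ _) ?_)
  exact prod_le_one (fun _ _ => profile_nonneg _ _) fun _ _ => profile_le_one _ _

/-! ### Hyperplane slices of a cube -/

section slices
variable {D : ℕ}

/-- The point of `ℤ^{D+1}` with `i`-th coordinate `k` and remaining coordinates `y`. -/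
def ins (i : Fin (D + 1)) (k : ℤ) (y : Fin D → ℤ) : Fin (D + 1) → ℤ :=
  Fin.insertNth (α := fun _ => ℤ) i k y

@[simp] theorem ins_same (i : Fin (D + 1)) (k : ℤ) (y : Fin D → ℤ) : ins i k y i = k := by
  simp [ins]

@[simp] theorem ins_succAbove (i : Fin (D + 1)) (k : ℤ) (y : Fin D → ℤ) (j : Fin D) :
    ins i k y (i.succAbove j) = y j := by
  simp [ins]

theorem ins_ext {i : Fin (D + 1)} {x x' : Fin (D + 1) → ℤ} (h : x i = x' i)
    (h' : ∀ j, x (i.succAbove j) = x' (i.succAbove j)) : x = x' := by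
  ext j
  rcases eq_or_ne j i with rfl | hj
  · exact h
  · obtain ⟨j, rfl⟩ := Fin.exists_succAbove_eq hj
    exact h' j

theorem ins_add_step (i : Fin (D + 1)) (k : ℤ) (y : Fin D → ℤ) :
    ins i k y + step i = ins i (k + 1) y :=
  ins_ext (i := i) (by simp) fun j => by simp [step_ne (Fin.succAbove_ne i j)]

theorem ins_add_step_succAbove (i : Fin (D + 1)) (k : ℤ) (y : Fin D → ℤ) (j : Fin D) :
    ins i k y + step (i.succAbove j) = ins i k (y + step j) :=
  ins_ext (i := i) (by simp [step_ne (Fin.succAbove_ne i j).symm]) fun j' => by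
    rcases eq_or_ne j' j with rfl | h
    · simp
    · simp [step_ne h, step_ne (fun h' => h (Fin.succAbove_right_injective h'))]

theorem sum_cube_eq_sum_slices (i : Fin (D + 1)) (r : ℕ) (G : (Fin (D + 1) → ℤ) → ℝ) :
    ∑ x ∈ cube (Fin (D + 1)) r, G x =
      ∑ k ∈ Icc (-(r : ℤ)) r, ∑ y ∈ cube (Fin D) r, G (ins i k y) := by
  rw [← sum_product']
  refine (sum_bij' (fun (e : ℤ × (Fin D → ℤ)) _ => ins i e.1 e.2)
    (fun x _ => (x i, fun j => x (i.succAbove j))) ?_ ?_ ?_ ?_ ?_).symm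
  · intro e he
    rw [mem_product, mem_cube, mem_Icc] at he
    rw [mem_cube, Fin.forall_iff_succAbove i]
    simpa using he
  · intro x hx
    rw [mem_cube, Fin.forall_iff_succAbove i] at hx
    rw [mem_product, mem_cube, mem_Icc]
    exact hx
  · intro e _
    simp
  · intro x _
    exact ins_ext (i := i) (by simp) (by simp)
  · intro e _; rfl

/-- The sum of `h` over the hyperplane slice `{x_i = k}` of the cube. -/
noncomputable def sliceSum (r : ℕ) (h : (Fin (D + 1) → ℤ) → ℝ) (i : Fin (D + 1)) (k : ℤ) : ℝ :=
  ∑ y ∈ cube (Fin D) r, h (ins i k y)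

/-- The sum of `h` over all slices at distance `l` or `l + 1` from the centre. -/
noncomputable def levelSum (r : ℕ) (h : (Fin (D + 1) → ℤ) → ℝ) (l : ℕ) : ℝ :=
  ∑ i, (sliceSum r h i l + sliceSum r h i (-l) + sliceSum r h i (l + 1) + sliceSum r h i (-l - 1))

theorem sliceSum_nonneg {r : ℕ} {h : (Fin (D + 1) → ℤ) → ℝ} (hh : ∀ x, 0 ≤ h x)
    (i : Fin (D + 1)) (k : ℤ) : 0 ≤ sliceSum r h i k := sum_nonneg fun _ _ => hh _

theorem levelSum_nonneg {r : ℕ} {h : (Fin (D + 1) → ℤ) → ℝ} (hh : ∀ x, 0 ≤ h x)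
    (l : ℕ) : 0 ≤ levelSum r h l :=
  sum_nonneg fun i _ => by
    have := sliceSum_nonneg (r := r) hh i
    have h1 := this l
    have h2 := this (-l)
    have h3 := this (l + 1)
    have h4 := this (-l - 1)
    linarith

/-- For each of the `D + 1` directions the levels run through four injective families of slices, and
the disjoint slices of one family fit into the cube. -/
theorem sum_levelSum_le {s r : ℕ} {h : (Fin (D + 1) → ℤ) → ℝ} (hh : ∀ x, 0 ≤ h x) :
    ∑ l ∈ Ico s r, levelSum r h l ≤ 4 * (D + 1) * ∑ x ∈ cube (Fin (D + 1)) r, h x := by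
  unfold levelSum
  rw [sum_comm]
  have key : ∀ i : Fin (D + 1), ∀ f : ℕ → ℤ, Function.Injective f →
      (∀ l ∈ Ico s r, f l ∈ Icc (-(r : ℤ)) r) →
      ∑ l ∈ Ico s r, sliceSum r h i (f l) ≤ ∑ x ∈ cube (Fin (D + 1)) r, h x := by
    intro i f hf hm
    rw [sum_cube_eq_sum_slices i]
    refine (sum_map (Ico s r) ⟨f, hf⟩ (fun k => sliceSum r h i k)).symm.trans_le ?_
    refine sum_le_sum_of_subset_of_nonneg ?_ fun k _ _ => sliceSum_nonneg hh i k
    intro k hk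
    rw [mem_map] at hk
    obtain ⟨l, hl, rfl⟩ := hk
    exact hm l hl
  calc _ ≤ ∑ _i : Fin (D + 1), 4 * ∑ x ∈ cube (Fin (D + 1)) r, h x := by
        refine sum_le_sum fun i _ => ?_
        rw [sum_add_distrib, sum_add_distrib, sum_add_distrib]
        have h1 := key i (fun l => l) (fun a b hab => by simpa using hab)
          (fun l hl => by rw [mem_Ico] at hl; rw [mem_Icc]; omega)
        have h2 := key i (fun l => -l) (fun a b hab => by simpa using hab)
          (fun l hl => by rw [mem_Ico] at hl; rw [mem_Icc]; omega)
        have h3 := key i (fun l => l + 1) (fun a b hab => by simpa using hab)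
          (fun l hl => by rw [mem_Ico] at hl; rw [mem_Icc]; omega)
        have h4 := key i (fun l => -l - 1) (fun a b hab => by simpa using hab)
          (fun l hl => by rw [mem_Ico] at hl; rw [mem_Icc]; omega)
        linarith
    _ = _ := by
        rw [sum_const, card_univ, Fintype.card_fin, nsmul_eq_mul]
        push_cast; ring

theorem sliceSum_le_levelSum {r : ℕ} {h : (Fin (D + 1) → ℤ) → ℝ} (hh : ∀ x, 0 ≤ h x)
    (i : Fin (D + 1)) (k : ℤ) : sliceSum r h i k ≤ levelSum r h (level k) ∧
      sliceSum r h i (k + 1) ≤ levelSum r h (level k) := by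
  have hs := sliceSum_nonneg (r := r) hh
  have hsum : sliceSum r h i (level k) + sliceSum r h i (-level k) +
      sliceSum r h i (level k + 1) + sliceSum r h i (-level k - 1) ≤ levelSum r h (level k) :=
    single_le_sum (f := fun i => sliceSum r h i (level k) + sliceSum r h i (-level k) +
      sliceSum r h i (level k + 1) + sliceSum r h i (-level k - 1)) (fun i _ => by
      linarith [hs i (level k), hs i (-level k), hs i (level k + 1), hs i (-level k - 1)])
      (mem_univ i)
  have h1 := hs i (level k)
  have h2 := hs i (-level k)
  have h3 := hs i (level k + 1)
  have h4 := hs i (-level k - 1)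
  rcases le_or_gt 0 k with hk | hk
  · have e : (level k : ℤ) = k := by unfold level; omega
    rw [e] at h1 h2 h3 h4 hsum
    constructor <;> linarith
  · have e : -(level k : ℤ) - 1 = k := by unfold level; omega
    have e' : -(level k : ℤ) = k + 1 := by omega
    rw [e'] at h2 h4 hsum
    simp only [add_sub_cancel_right] at h4 hsum
    constructor <;> linarith

/-- The directions at a site split into the one transversal to the slice and those within it. The
latter carry the Sobolev inequality on the slice; `sum_slice_le` keeps the former, whose
conductances act as the weight `g`. -/
theorem esum_slice_le {r : ℕ} {F : (Fin (D + 1) → ℤ) → Fin (D + 1) → ℝ} (hF : ∀ x i, 0 ≤ F x i)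
    (i : Fin (D + 1)) (k : ℤ) :
    esum r (fun (y : Fin D → ℤ) j => F (ins i k y) (i.succAbove j)) ≤
      sliceSum r (fun x => ∑ j, if x j < r then F x j else 0) i k := by
  unfold esum sliceSum
  refine sum_le_sum fun y _ => ?_
  beta_reduce
  rw [Fin.sum_univ_succAbove (fun j => if ins i k y j < (r : ℤ) then F (ins i k y) j else 0) i]
  simp only [ins_succAbove, ins_same]
  refine le_add_of_nonneg_left ?_
  split_ifs
  · exact hF _ _
  · rfl

theorem sum_slice_le {r : ℕ} {F : (Fin (D + 1) → ℤ) → Fin (D + 1) → ℝ} (hF : ∀ x i, 0 ≤ F x i)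
    (i : Fin (D + 1)) {k : ℤ} (hk : k < r) :
    ∑ y ∈ cube (Fin D) r, F (ins i k y) i ≤
      sliceSum r (fun x => ∑ j, if x j < r then F x j else 0) i k := by
  unfold sliceSum
  refine sum_le_sum fun y _ => ?_
  beta_reduce
  rw [Fin.sum_univ_succAbove (fun j => if ins i k y j < (r : ℤ) then F (ins i k y) j else 0) i]
  simp only [ins_same, hk, if_true]
  refine le_add_of_nonneg_right (sum_nonneg fun j _ => ?_)
  split_ifs
  · exact hF _ _
  · rfl

/-- The part of a bond sum carried by the bonds where the cut-off function varies. -/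
theorem esum_cutoff_le {r : ℕ} {G : Finset ℕ}
    {F : (Fin (D + 1) → ℤ) → Fin (D + 1) → ℝ} (hF : ∀ x i, 0 ≤ F x i) :
    esum r (fun x i => (cutoff G (x + step i) - cutoff G x) ^ 2 * F x i) ≤
      ∑ i, ∑ k ∈ (Ico (-(r : ℤ)) r).filter (fun k => level k ∈ G),
        (1 / (G.card : ℝ)) ^ 2 * ∑ y ∈ cube (Fin D) r, F (ins i k y) i := by
  unfold esum
  rw [sum_comm]
  refine sum_le_sum fun i _ => ?_
  rw [sum_cube_eq_sum_slices i, sum_filter]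
  have hsub : Ico (-(r : ℤ)) r ⊆ Icc (-(r : ℤ)) r := Ico_subset_Icc_self
  rw [← sum_subset hsub]
  · refine sum_le_sum fun k hk => ?_
    rw [mem_Ico] at hk
    simp only [ins_same, hk.2, if_true]
    have h1 : ∀ y : Fin D → ℤ, (cutoff G (ins i k y + step i) - cutoff G (ins i k y)) ^ 2 * F (ins i k y) i ≤
        (if level k ∈ G then (1 / (G.card : ℝ)) ^ 2 else 0) * F (ins i k y) i := by
      intro y
      have := cutoff_sub_sq_le G (ins i k y) i
      rw [ins_same] at this
      exact mul_le_mul_of_nonneg_right this (hF _ _)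
    refine (sum_le_sum fun y _ => h1 y).trans_eq ?_
    rw [← mul_sum]
    split_ifs <;> simp
  · intro k hk hk'
    have : ¬ k < (r : ℤ) := by rw [mem_Icc] at hk; rw [mem_Ico] at hk'; omega
    simp [this]

/-- On a coordinate axis the level `l` contains just two bonds, with lower end-points `l` and `-l -
1`. -/
theorem card_level_le (G : Finset ℕ) (r : ℕ) :
    ((Ico (-(r : ℤ)) r).filter (fun k => level k ∈ G)).card ≤ 2 * G.card := by
  have : (Ico (-(r : ℤ)) r).filter (fun k => level k ∈ G) ⊆
      G.image (fun l : ℕ => (l : ℤ)) ∪ G.image (fun l : ℕ => -(l : ℤ) - 1) := by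
    intro k hk
    rw [mem_filter] at hk
    rw [mem_union, mem_image, mem_image]
    rcases le_or_gt 0 k with h | h
    · exact Or.inl ⟨_, hk.2, by unfold level; omega⟩
    · exact Or.inr ⟨_, hk.2, by unfold level; omega⟩
  refine (card_le_card this).trans ((card_union_le _ _).trans ?_)
  have h1 := card_image_le (s := G) (f := fun l : ℕ => (l : ℤ))
  have h2 := card_image_le (s := G) (f := fun l : ℕ => -(l : ℤ) - 1)
  omega

end slices

end RCM

/-! ### The cut-off term of the Caccioppoli inequality -/

namespace RCM

open Finset MeasureTheory

/-- The weights do not depend on time, so the interpolation inequality integrates by Hölder in time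
with the weights `1 - 1/θ` and `1/θ`. -/
theorem exists_integral_weighted_interpolation (ι : Type*) [Fintype ι] [DecidableEq ι]
    {p q θ β : ℝ} (hE : InterpExponents (Fintype.card ι) p q θ β) :
    ∃ C : ℝ, 1 ≤ C ∧ ∀ (r : ℕ) (w : ℝ → (ι → ℤ) → ℝ) (_ : ∀ x, Continuous fun t => w t x)
      (_ : ∀ t x, 0 ≤ w t x) (b : (ι → ℤ) → ι → ℝ)
      (_ : ∀ x i, 0 < b x i) (g : (ι → ℤ) → ℝ) (_ : ∀ x, 0 ≤ g x) (t₁ t₂ : ℝ) (_ : t₁ ≤ t₂),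
      ∫ t in t₁..t₂, ∑ x ∈ cube ι r, g x * w t x ^ 2 ≤ (∑ x ∈ cube ι r, g x ^ p) ^ (1 / p) *
        ((∫ t in t₁..t₂, ∑ x ∈ cube ι r, w t x ^ 2) ^ (1 - 1 / θ) * (C * ((2 * r + 1 : ℝ) ^ β *
        ((esum r fun x i => (b x i)⁻¹ ^ q) ^ (1 / q) *
            (∫ t in t₁..t₂, esum r fun x i => b x i * (w t (x + step i) - w t x) ^ 2) +
          (((2 * r + 1 : ℝ)) ^ (Fintype.card ι)) ^ (1 / q) / (2 * r + 1) ^ 2 *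
            ∫ t in t₁..t₂, ∑ x ∈ cube ι r, w t x ^ 2))) ^ (1 / θ)) := by
  obtain ⟨C, hC, H⟩ := exists_weighted_interpolation ι hE
  have hθ := hE.2.2.1
  have hθi0 : 0 < 1 / θ := by positivity
  have hθi : 1 / θ < 1 := by rw [div_lt_one (by linarith)]; exact hθ
  refine ⟨C, hC, fun r w hc hw b hb g hg t₁ t₂ ht => ?_⟩
  set m : ℝ := 2 * r + 1
  set Q := (esum r fun x i => (b x i)⁻¹ ^ q) ^ (1 / q)
  set c := (m ^ (Fintype.card ι)) ^ (1 / q) / m ^ 2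
  have hQ : 0 ≤ Q := Real.rpow_nonneg (esum_nonneg fun x i =>
    Real.rpow_nonneg (inv_nonneg.2 (hb x i).le) _) _
  have hm : 0 < m := by positivity
  have hcc : 0 ≤ c := by positivity
  have cV : Continuous fun t => ∑ x ∈ cube ι r, w t x ^ 2 :=
    continuous_finsetSum _ fun x _ => (hc x).pow 2
  have cY : Continuous fun t => esum r fun x i => b x i * (w t (x + step i) - w t x) ^ 2 :=
    continuous_esum fun x i => ((hc _).sub (hc x) |>.pow 2).const_mul _
  have cT : Continuous fun t => C * (m ^ β * (Q * (esum r fun x i => b x i * (w t (x + step i) - w t x) ^ 2) +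
      c * ∑ x ∈ cube ι r, w t x ^ 2)) := ((((cY.const_mul Q)).add (cV.const_mul c)).const_mul _).const_mul _
  have hV0 : ∀ t, 0 ≤ ∑ x ∈ cube ι r, w t x ^ 2 := fun t => sum_nonneg fun x _ => sq_nonneg _
  have hY0 : ∀ t, 0 ≤ esum r fun x i => b x i * (w t (x + step i) - w t x) ^ 2 := fun t =>
    esum_nonneg fun x i => mul_nonneg (hb x i).le (sq_nonneg _)
  have hT0 : ∀ t, 0 ≤ C * (m ^ β * (Q * (esum r fun x i => b x i * (w t (x + step i) - w t x) ^ 2) +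
      c * ∑ x ∈ cube ι r, w t x ^ 2)) := fun t => by
    have := hV0 t
    have := hY0 t
    positivity
  have hG0 : 0 ≤ ∑ x ∈ cube ι r, g x ^ p := sum_nonneg fun x _ => Real.rpow_nonneg (hg x) _
  have h1 := integral_rpow_mul_rpow_le ht cV cT hV0 hT0 (by linarith : 0 ≤ 1 - 1 / θ) hθi0.le (by ring)
  rw [intervalIntegral.integral_const_mul, intervalIntegral.integral_const_mul,
    intervalIntegral.integral_add ((cY.const_mul Q).intervalIntegrable _ _)
      ((cV.const_mul c).intervalIntegrable _ _), intervalIntegral.integral_const_mul,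
    intervalIntegral.integral_const_mul] at h1
  refine le_trans ?_ (mul_le_mul_of_nonneg_left h1 (Real.rpow_nonneg hG0 _))
  rw [← intervalIntegral.integral_const_mul]
  refine intervalIntegral.integral_mono_on ht ?_ ?_ fun t _ => H r (w t) (hw t) b hb g hg
  · exact Continuous.intervalIntegrable (continuous_finsetSum _ fun x _ => ((hc x).pow 2).const_mul _) _ _
  · refine Continuous.intervalIntegrable (Continuous.const_mul ?_ _) _ _
    exact (cV.rpow_const fun _ => Or.inr (by linarith)).mul (cT.rpow_const fun _ => Or.inr hθi0.le)

variable {ι : Type*} [Fintype ι] [DecidableEq ι]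

/-- The space-time integral of `v²` over the cylinder of radius `r`. -/
noncomputable def mass (N : ℕ) (v : ℝ → (ι → ℤ) → ℝ) (r : ℕ) : ℝ :=
  ∫ t in (-(N * r : ℝ))..0, ∑ x ∈ cube ι r, v t x ^ 2

/-- The space-time Dirichlet energy over the cylinder of radius `r`. -/
noncomputable def energy (a : (ι → ℤ) → ι → ℝ) (N : ℕ) (v : ℝ → (ι → ℤ) → ℝ) (r : ℕ) : ℝ :=
  ∫ t in (-(N * r : ℝ))..0, esum r fun x i => a x i * (v t (x + step i) - v t x) ^ 2

theorem integral_esum {r : ℕ} {F : ℝ → (ι → ℤ) → ι → ℝ}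
    (h : ∀ x i, Continuous fun t => F t x i) (t₁ t₂ : ℝ) :
    ∫ t in t₁..t₂, esum r (F t) = esum r fun x i => ∫ t in t₁..t₂, F t x i := by
  simp only [esum_eq]
  exact intervalIntegral.integral_finsetSum fun e _ => (h _ _).intervalIntegrable _ _

theorem integral_esum_grad (r : ℕ) {b : (ι → ℤ) → ι → ℝ} {w : ℝ → (ι → ℤ) → ℝ}
    (hc : ∀ x, Continuous fun t => w t x) (t₁ t₂ : ℝ) :
    ∫ t in t₁..t₂, (esum r fun x i => b x i * (w t (x + step i) - w t x) ^ 2) =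
      esum r fun x i => ∫ t in t₁..t₂, b x i * (w t (x + step i) - w t x) ^ 2 :=
  integral_esum (F := fun t x i => b x i * (w t (x + step i) - w t x) ^ 2)
    (fun x _ => ((hc _).sub (hc x) |>.pow 2).const_mul _) t₁ t₂

theorem mass_nonneg (N : ℕ) (v : ℝ → (ι → ℤ) → ℝ) (r : ℕ) : 0 ≤ mass N v r :=
  intervalIntegral.integral_nonneg (by rw [neg_nonpos]; positivity) fun _ _ =>
    sum_nonneg fun _ _ => sq_nonneg _

theorem energy_nonneg {a : (ι → ℤ) → ι → ℝ} (ha : ∀ x i, 0 < a x i) (N : ℕ)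
    (v : ℝ → (ι → ℤ) → ℝ) (r : ℕ) : 0 ≤ energy a N v r :=
  intervalIntegral.integral_nonneg (by rw [neg_nonpos]; positivity) fun _ _ =>
    esum_nonneg fun x i => mul_nonneg (ha x i).le (sq_nonneg _)

set_option maxHeartbeats 1000000 in
/-- The contribution of the cut-off function to the Caccioppoli inequality, for a cut-off function
adapted to the solution and the conductances. -/
theorem exists_cutoff {D : ℕ} {p q θ β : ℝ} (hE : InterpExponents D p q θ β) :
    ∃ C : ℝ, 1 ≤ C ∧ ∀ (a : (Fin (D + 1) → ℤ) → Fin (D + 1) → ℝ) (_ : ∀ x i, 0 < a x i)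
      (v : ℝ → (Fin (D + 1) → ℤ) → ℝ) (_ : ∀ x, Continuous fun t => v t x)
      (_ : ∀ t x, 0 ≤ v t x) (N s r : ℕ) (_ : s < r),
      ∃ G ⊆ Ico s r, G.Nonempty ∧
      ∀ z : ℝ, z = 20 * (D + 1) / ((r : ℝ) - s) →
      (∫ t in (-(N * r : ℝ))..0, 2 * esum r fun x i =>
        a x i * (cutoff G (x + step i) - cutoff G x) ^ 2 * (v t x ^ 2 + v t (x + step i) ^ 2)) ≤
      2 * z * ((z * esum r fun x i => a x i ^ p) ^ (1 / p) *
        ((z * mass N v r) ^ (1 - 1 / θ) * (C * ((2 * r + 1 : ℝ) ^ β *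
          ((z * esum r fun x i => (a x i)⁻¹ ^ q) ^ (1 / q) * (z * energy a N v r) +
          ((2 * r + 1 : ℝ) ^ D) ^ (1 / q) / (2 * r + 1) ^ 2 * (z * mass N v r)))) ^ (1 / θ))) := by
  obtain ⟨C, hC, H⟩ := exists_integral_weighted_interpolation (Fin D) (p := p) (q := q) (θ := θ)
    (β := β) (by rwa [Fintype.card_fin])
  have hp := hE.1
  have hq := hE.2.1
  have hθ := hE.2.2.1
  have hθi : 1 / θ < 1 := by rw [div_lt_one (by linarith)]; exact hθ
  have hθi' : 0 ≤ 1 - 1 / θ := by linarith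
  refine ⟨C, hC, fun a ha v hc hv N s r hsr => ?_⟩
  rw [Fintype.card_fin] at H
  set t₁ : ℝ := -(N * r : ℝ) with ht₁
  have ht : t₁ ≤ 0 := by rw [ht₁, neg_nonpos]; positivity
  set Fp : (Fin (D + 1) → ℤ) → Fin (D + 1) → ℝ := fun x i => a x i ^ p with hFp
  set Fq : (Fin (D + 1) → ℤ) → Fin (D + 1) → ℝ := fun x i => (a x i)⁻¹ ^ q with hFq
  set Fe : (Fin (D + 1) → ℤ) → Fin (D + 1) → ℝ :=
    fun x i => ∫ t in t₁..0, a x i * (v t (x + step i) - v t x) ^ 2 with hFe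
  have hFp0 : ∀ x i, 0 ≤ Fp x i := fun x i => Real.rpow_nonneg (ha x i).le _
  have hFq0 : ∀ x i, 0 ≤ Fq x i := fun x i => Real.rpow_nonneg (inv_nonneg.2 (ha x i).le) _
  have hFe0 : ∀ x i, 0 ≤ Fe x i := fun x i => intervalIntegral.integral_nonneg ht fun t _ =>
    mul_nonneg (ha x i).le (sq_nonneg _)
  set hm : (Fin (D + 1) → ℤ) → ℝ := fun x => ∫ t in t₁..0, v t x ^ 2 with hhm
  have hm0 : ∀ x, 0 ≤ hm x := fun x => intervalIntegral.integral_nonneg ht fun t _ => sq_nonneg _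
  let S : ((Fin (D + 1) → ℤ) → Fin (D + 1) → ℝ) → (Fin (D + 1) → ℤ) → ℝ :=
    fun F x => ∑ j, if x j < r then F x j else 0
  have hS0 : ∀ F : (Fin (D + 1) → ℤ) → Fin (D + 1) → ℝ, (∀ x i, 0 ≤ F x i) → ∀ x, 0 ≤ S F x :=
    fun F hF x => sum_nonneg fun j _ => by split_ifs; exacts [hF _ _, le_rfl]
  -- The four quantities that enter the interpolation on a slice: the `p`-th moment of the
  -- conductances, the mass, the energy and the inverse `q`-th moment.
  let h : Fin 4 → (Fin (D + 1) → ℤ) → ℝ := ![S Fp, hm, S Fe, S Fq]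
  have h0 : ∀ j x, 0 ≤ h j x := by
    intro j
    fin_cases j
    exacts [hS0 _ hFp0, hm0, hS0 _ hFe0, hS0 _ hFq0]
  obtain ⟨G, hG, hcard, hgood⟩ := exists_good_levels hsr (fun j l => levelSum r (h j) l)
    (fun j => 4 * (D + 1) * ∑ x ∈ cube (Fin (D + 1)) r, h j x)
    (fun j l => levelSum_nonneg (h0 j) l) (fun j => sum_levelSum_le (h0 j))
  have hsr' : (0 : ℝ) < (r : ℝ) - s := by rw [sub_pos]; exact_mod_cast hsr
  have hGc : (0 : ℝ) < G.card := by linarith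
  refine ⟨G, hG, card_pos.1 (by exact_mod_cast hGc), fun z hz => ?_⟩
  have hz0 : 0 < z := by rw [hz]; positivity
  have hgood' : ∀ l ∈ G, ∀ j, levelSum r (h j) l ≤ z * ∑ x ∈ cube (Fin (D + 1)) r, h j x := by
    intro l hl j
    refine (hgood l hl j).trans_eq ?_
    rw [hz]; ring
  have eX : mass N v r = ∑ x ∈ cube (Fin (D + 1)) r, hm x := by
    unfold mass
    exact intervalIntegral.integral_finsetSum fun x _ => ((hc x).pow 2).intervalIntegrable _ _
  have eE : energy a N v r = ∑ x ∈ cube (Fin (D + 1)) r, S Fe x := by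
    unfold energy
    rw [integral_esum_grad r hc]
    rfl
  have eP : esum r Fp = ∑ x ∈ cube (Fin (D + 1)) r, S Fp x := rfl
  have eQ : esum r Fq = ∑ x ∈ cube (Fin (D + 1)) r, S Fq x := rfl
  set m : ℝ := 2 * r + 1
  have hmp : 0 < m := by positivity
  set B := (z * esum r Fp) ^ (1 / p) * ((z * mass N v r) ^ (1 - 1 / θ) * (C * (m ^ β *
          ((z * esum r Fq) ^ (1 / q) * (z * energy a N v r) +
          (m ^ D) ^ (1 / q) / m ^ 2 * (z * mass N v r)))) ^ (1 / θ)) with hB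
  have hX0 := mass_nonneg N v r
  have hE0 := energy_nonneg ha N v r
  have hP0 : 0 ≤ esum r Fp := esum_nonneg hFp0
  have hQ0 : 0 ≤ esum r Fq := esum_nonneg hFq0
  -- the bound on a good slice
  have slice : ∀ i k k', k < (r : ℤ) → level k ∈ G → (k' = k ∨ k' = k + 1) →
      ∫ t in t₁..0, ∑ y ∈ cube (Fin D) r, a (ins i k y) i * v t (ins i k' y) ^ 2 ≤ B := by
    intro i k k' hk hl hk'
    -- A level sum contains the slices at both ends of the bonds of that level, so goodness of
    -- `level k` controls the slices `k` and `k + 1` alike.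
    have hsl : ∀ j, sliceSum r (h j) i k' ≤ z * ∑ x ∈ cube (Fin (D + 1)) r, h j x := by
      intro j
      have := sliceSum_le_levelSum (r := r) (h0 j) i k
      rcases hk' with rfl | rfl
      exacts [this.1.trans (hgood' _ hl j), this.2.trans (hgood' _ hl j)]
    have hslk : sliceSum r (S Fp) i k ≤ z * esum r Fp :=
      (sliceSum_le_levelSum (r := r) (h0 0) i k).1.trans (hgood' _ hl 0)
    have key := H r (fun t y => v t (ins i k' y)) (fun y => hc _) (fun t y => hv t _)
      (fun y j => a (ins i k' y) (i.succAbove j)) (fun y j => ha _ _)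
      (fun y => a (ins i k y) i) (fun y => (ha _ _).le) t₁ 0 ht
    refine key.trans ?_
    have b1 : ∑ y ∈ cube (Fin D) r, a (ins i k y) i ^ p ≤ z * esum r Fp :=
      (sum_slice_le hFp0 i hk).trans hslk
    have b2 : ∫ t in t₁..0, ∑ y ∈ cube (Fin D) r, v t (ins i k' y) ^ 2 ≤ z * mass N v r := by
      rw [eX]
      refine le_trans (le_of_eq ?_) (hsl 1)
      exact intervalIntegral.integral_finsetSum fun x _ => ((hc _).pow 2).intervalIntegrable _ _
    have b3 : (∫ t in t₁..0, esum r fun (y : Fin D → ℤ) j => a (ins i k' y) (i.succAbove j) *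
        (v t (ins i k' (y + step j)) - v t (ins i k' y)) ^ 2) ≤ z * energy a N v r := by
      rw [eE]
      refine le_trans (le_of_eq ?_) ((esum_slice_le hFe0 i k').trans (hsl 2))
      rw [integral_esum_grad r (w := fun t y => v t (ins i k' y)) fun y => hc _]
      simp only [hFe, ins_add_step_succAbove]
    have b4 : (esum r fun (y : Fin D → ℤ) j => (a (ins i k' y) (i.succAbove j))⁻¹ ^ q) ≤
        z * esum r Fq := (esum_slice_le hFq0 i k').trans (hsl 3)
    have n1 : 0 ≤ ∑ y ∈ cube (Fin D) r, a (ins i k y) i ^ p := sum_nonneg fun y _ => hFp0 _ _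
    have n2 : 0 ≤ ∫ t in t₁..0, ∑ y ∈ cube (Fin D) r, v t (ins i k' y) ^ 2 :=
      intervalIntegral.integral_nonneg ht fun t _ => sum_nonneg fun y _ => sq_nonneg _
    have n3 : 0 ≤ (∫ t in t₁..0, esum r fun (y : Fin D → ℤ) j => a (ins i k' y) (i.succAbove j) *
        (v t (ins i k' (y + step j)) - v t (ins i k' y)) ^ 2) :=
      intervalIntegral.integral_nonneg ht fun t _ => esum_nonneg fun y j =>
        mul_nonneg (ha _ _).le (sq_nonneg _)
    have n4 : 0 ≤ (esum r fun (y : Fin D → ℤ) j => (a (ins i k' y) (i.succAbove j))⁻¹ ^ q) :=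
      esum_nonneg fun y j => hFq0 _ _
    rw [hB]
    gcongr
  have hB0 : 0 ≤ B := by positivity
  have slice2 : ∀ i k, k ∈ (Ico (-(r : ℤ)) r).filter (fun k => level k ∈ G) →
      ∫ t in t₁..0, ∑ y ∈ cube (Fin D) r, a (ins i k y) i *
        (v t (ins i k y) ^ 2 + v t (ins i k y + step i) ^ 2) ≤ 2 * B := by
    intro i k hk
    rw [mem_filter, mem_Ico] at hk
    have s1 := slice i k k hk.1.2 hk.2 (Or.inl rfl)
    have s2 := slice i k (k + 1) hk.1.2 hk.2 (Or.inr rfl)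
    simp_rw [ins_add_step, mul_add, sum_add_distrib]
    rw [intervalIntegral.integral_add]
    · linarith
    · exact Continuous.intervalIntegrable
        (continuous_finsetSum _ fun x _ => ((hc _).pow 2).const_mul _) _ _
    · exact Continuous.intervalIntegrable
        (continuous_finsetSum _ fun x _ => ((hc _).pow 2).const_mul _) _ _
  set K := (Ico (-(r : ℤ)) r).filter (fun k => level k ∈ G) with hK
  have c1 : ∀ i k, Continuous fun t => ∑ y ∈ cube (Fin D) r, a (ins i k y) i *
        (v t (ins i k y) ^ 2 + v t (ins i k y + step i) ^ 2) := fun i k =>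
    continuous_finsetSum _ fun x _ => (((hc _).pow 2).add ((hc _).pow 2)).const_mul _
  have hKc : (K.card : ℝ) ≤ 2 * G.card := by exact_mod_cast card_level_le G r
  calc (∫ t in t₁..0, 2 * esum r fun x i =>
        a x i * (cutoff G (x + step i) - cutoff G x) ^ 2 * (v t x ^ 2 + v t (x + step i) ^ 2))
      ≤ ∫ t in t₁..0, 2 * ∑ i, ∑ k ∈ K, (1 / (G.card : ℝ)) ^ 2 * ∑ y ∈ cube (Fin D) r,
          a (ins i k y) i * (v t (ins i k y) ^ 2 + v t (ins i k y + step i) ^ 2) := by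
        refine intervalIntegral.integral_mono_on ht ?_ ?_ fun t _ => ?_
        · exact Continuous.intervalIntegrable ((continuous_esum fun x i =>
            (((hc x).pow 2).add ((hc _).pow 2)).const_mul _).const_mul _) _ _
        · exact Continuous.intervalIntegrable ((continuous_finsetSum _ fun i _ =>
            continuous_finsetSum _ fun k _ => (c1 i k).const_mul _).const_mul _) _ _
        · refine mul_le_mul_of_nonneg_left ?_ (by norm_num)
          refine le_trans (le_of_eq ?_) (esum_cutoff_le (F := fun x i =>
            a x i * (v t x ^ 2 + v t (x + step i) ^ 2)) fun x i =>
              mul_nonneg (ha x i).le (by positivity))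
          congr 1
          ext x i
          ring
    _ = 2 * ∑ i, ∑ k ∈ K, (1 / (G.card : ℝ)) ^ 2 * ∫ t in t₁..0, ∑ y ∈ cube (Fin D) r,
          a (ins i k y) i * (v t (ins i k y) ^ 2 + v t (ins i k y + step i) ^ 2) := by
        rw [intervalIntegral.integral_const_mul, intervalIntegral.integral_finsetSum]
        · congr 1
          refine sum_congr rfl fun i _ => ?_
          rw [intervalIntegral.integral_finsetSum]
          · exact sum_congr rfl fun k _ => intervalIntegral.integral_const_mul _ _
          · exact fun k _ => ((c1 i k).const_mul _).intervalIntegrable _ _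
        · exact fun i _ => Continuous.intervalIntegrable
            (continuous_finsetSum _ fun k _ => (c1 i k).const_mul _) _ _
    _ ≤ 2 * ∑ _i : Fin (D + 1), ∑ _k ∈ K, (1 / (G.card : ℝ)) ^ 2 * (2 * B) := by
        gcongr with i _ k hk
        exact slice2 i k hk
    _ = 4 * (D + 1) * K.card * (1 / (G.card : ℝ)) ^ 2 * B := by
        simp only [sum_const, card_univ, Fintype.card_fin, nsmul_eq_mul]
        push_cast
        ring
    -- There are at most `2|G|` active slices per direction, each with squared slope `|G|⁻²`, so one
    -- factor `1/|G| ≤ 5/(r-s)` survives. With the `4 (D+1)` from summing the levels this explains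
    -- the 20 in `z`.
    _ ≤ 4 * (D + 1) * (2 * G.card) * (1 / (G.card : ℝ)) ^ 2 * B := by gcongr
    _ = 8 * (D + 1) * (1 / (G.card : ℝ)) * B := by field_simp; ring
    _ ≤ 8 * (D + 1) * (5 / ((r : ℝ) - s)) * B := by
        have : 1 / (G.card : ℝ) ≤ 5 / ((r : ℝ) - s) := by
          rw [div_le_div_iff₀ hGc hsr']; linarith
        gcongr
    _ = 2 * z * B := by rw [hz]; ring

end RCM

/-! ### Caccioppoli inequality with a sublinear energy term -/

namespace RCM

open Finset MeasureTheory

/-- `(c N^{d} L^p / N)^{1/p} ≤ c N^{(d-1)/p} L`. -/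
theorem rpow_inv_le_of_le {N c P L p : ℝ} {D : ℕ} (hN : 0 < N) (hc : 1 ≤ c) (hp : 1 < p)
    (hP0 : 0 ≤ P) (hL : 0 ≤ L) (hP : P ≤ N ^ (D + 1) * L ^ p) :
    (c / N * P) ^ (1 / p) ≤ c * N ^ ((D : ℝ) / p) * L := by
  have hp0 : 0 < p := by linarith
  calc (c / N * P) ^ (1 / p) ≤ (c / N * (N ^ (D + 1) * L ^ p)) ^ (1 / p) := by gcongr
    _ = (c * (N ^ (D : ℝ) * L ^ p)) ^ (1 / p) := by
        congr 1
        rw [pow_succ, Real.rpow_natCast]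
        field_simp
    _ = c ^ (1 / p) * (N ^ ((D : ℝ) / p) * L) := by
        rw [Real.mul_rpow (by linarith) (by positivity), Real.mul_rpow (by positivity) (by positivity),
          ← Real.rpow_mul hN.le, ← Real.rpow_mul hL, mul_one_div_cancel hp0.ne', Real.rpow_one,
          mul_one_div]
    _ ≤ c * (N ^ ((D : ℝ) / p) * L) := by
        have : c ^ (1 / p) ≤ c := by
          calc c ^ (1 / p) ≤ c ^ (1 : ℝ) := Real.rpow_le_rpow_of_exponent_le hc
                (by rw [div_le_one hp0]; exact hp.le)
            _ = c := Real.rpow_one c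
        gcongr
    _ = _ := by ring

theorem rpow_le_self_of_one_le {c e : ℝ} (hc : 1 ≤ c) (he : e ≤ 1) : c ^ e ≤ c :=
  (Real.rpow_le_rpow_of_exponent_le hc he).trans_eq (Real.rpow_one c)

/-- A count of powers of `N`: by `he` the exponents coming from the moments, from the slice
dimension and from the defect `β` add up to `-1`, which with the prefactor gives the parabolic
`N⁻²`. The constants are raised to powers of at most one, so they are bounded by themselves; the
five factors `z` come from the prefactor, the `p`-th moment, the mass and, twice, the energy
bracket. -/
theorem cutoff_bound_scaling {D : ℕ} {p q θ β N m z C P Q X E Lp Lq : ℝ} (hp : 1 < p) (hq : 1 < q)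
    (hθ : 1 < θ) (hβ0 : 0 ≤ β) (hβ1 : β ≤ 1) (he : θ * D / p + β + D / q = 2) (hN : 0 < N)
    (hm1 : N ≤ m) (hm2 : m ≤ 3 * N) (hz : 1 ≤ z) (hC : 1 ≤ C) (hP0 : 0 ≤ P) (hQ0 : 0 ≤ Q)
    (hX0 : 0 ≤ X) (hE0 : 0 ≤ E) (hLp : 0 ≤ Lp) (hLq : 0 ≤ Lq)
    (hP : P ≤ N ^ (D + 1) * Lp ^ p) (hQ : Q ≤ N ^ (D + 1) * Lq ^ q) :
    2 * (z / N) * ((z / N * P) ^ (1 / p) * ((z / N * X) ^ (1 - 1 / θ) * (C * (m ^ β *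
        ((z / N * Q) ^ (1 / q) * (z / N * E) + (m ^ D) ^ (1 / q) / m ^ 2 * (z / N * X)))) ^ (1 / θ))) ≤
      2 * C * 3 ^ (D + 1) * z ^ 5 / N ^ 2 *
        (Lp * X ^ (1 - 1 / θ) * (N ^ 2 * Lq * E + X) ^ (1 / θ)) := by
  have hθi : 1 / θ < 1 := by rw [div_lt_one (by linarith)]; exact hθ
  have hθi0 : 0 < 1 / θ := by positivity
  have hm : 0 < m := by linarith
  have hz0 : 0 < z := by linarith
  have hqi : 1 / q ≤ 1 := by rw [div_le_one (by linarith)]; exact hq.le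
  have e1 := rpow_inv_le_of_le hN hz hp hP0 hLp hP
  have e1' := rpow_inv_le_of_le hN hz hq hQ0 hLq hQ
  have e2 : (z / N * X) ^ (1 - 1 / θ) ≤ z * (N ^ (-(1 - 1 / θ)) * X ^ (1 - 1 / θ)) := by
    rw [Real.mul_rpow (by positivity) hX0, Real.div_rpow hz0.le hN.le, Real.rpow_neg hN.le]
    have := rpow_le_self_of_one_le hz (by linarith : 1 - 1 / θ ≤ 1)
    calc z ^ (1 - 1 / θ) / N ^ (1 - 1 / θ) * X ^ (1 - 1 / θ) ≤
        z / N ^ (1 - 1 / θ) * X ^ (1 - 1 / θ) := by gcongr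
      _ = _ := by ring
  have e3 : m ^ β ≤ 3 * N ^ β := by
    calc m ^ β ≤ (3 * N) ^ β := by gcongr
      _ = 3 ^ β * N ^ β := Real.mul_rpow (by norm_num) hN.le
      _ ≤ 3 * N ^ β := by
        have := rpow_le_self_of_one_le (by norm_num : (1 : ℝ) ≤ 3) hβ1
        gcongr
  have e4 : (m ^ D) ^ (1 / q) / m ^ 2 ≤ 3 ^ D * N ^ ((D : ℝ) / q) / N ^ 2 := by
    have h1 : (m ^ D) ^ (1 / q) ≤ 3 ^ D * N ^ ((D : ℝ) / q) := by
      calc (m ^ D) ^ (1 / q) ≤ ((3 * N) ^ D) ^ (1 / q) := by gcongr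
        _ = (3 ^ D) ^ (1 / q) * N ^ ((D : ℝ) / q) := by
          rw [mul_pow, Real.mul_rpow (by positivity) (by positivity), ← Real.rpow_natCast N,
            ← Real.rpow_mul hN.le, mul_one_div]
        _ ≤ _ := by
          have := rpow_le_self_of_one_le (one_le_pow₀ (by norm_num : (1 : ℝ) ≤ 3) : (1 : ℝ) ≤ 3 ^ D) hqi
          gcongr
    gcongr
  have h3D : (1 : ℝ) ≤ 3 ^ D := one_le_pow₀ (by norm_num)
  have e5 : (z / N * Q) ^ (1 / q) * (z / N * E) + (m ^ D) ^ (1 / q) / m ^ 2 * (z / N * X) ≤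
      3 ^ D * z ^ 2 * (N ^ ((D : ℝ) / q) * N ^ (-3 : ℝ)) * (N ^ 2 * Lq * E + X) := by
    have hN3 : N ^ (-3 : ℝ) = 1 / N ^ 3 := by
      rw [Real.rpow_neg hN.le, one_div]; norm_cast
    have hz2 : z ≤ z ^ 2 := by nlinarith
    calc _ ≤ z * N ^ ((D : ℝ) / q) * Lq * (z / N * E) + 3 ^ D * N ^ ((D : ℝ) / q) / N ^ 2 * (z / N * X) := by
          gcongr
      _ = 1 * z ^ 2 * (N ^ ((D : ℝ) / q) * (1 / N ^ 3)) * (N ^ 2 * Lq * E) +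
          3 ^ D * z * (N ^ ((D : ℝ) / q) * (1 / N ^ 3)) * X := by
          field_simp
      _ ≤ 3 ^ D * z ^ 2 * (N ^ ((D : ℝ) / q) * (1 / N ^ 3)) * (N ^ 2 * Lq * E) +
          3 ^ D * z ^ 2 * (N ^ ((D : ℝ) / q) * (1 / N ^ 3)) * X := by gcongr
      _ = _ := by rw [hN3]; ring
  have e6 : (C * (m ^ β * ((z / N * Q) ^ (1 / q) * (z / N * E) +
      (m ^ D) ^ (1 / q) / m ^ 2 * (z / N * X)))) ^ (1 / θ) ≤
      C * 3 ^ (D + 1) * z ^ 2 * (N ^ ((β + D / q - 3) / θ) * (N ^ 2 * Lq * E + X) ^ (1 / θ)) := by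
    have hK : 1 ≤ C * 3 ^ (D + 1) * z ^ 2 :=
      one_le_mul_of_one_le_of_one_le (one_le_mul_of_one_le_of_one_le hC
        (one_le_pow₀ (by norm_num))) (one_le_pow₀ hz)
    calc _ ≤ (C * (3 * N ^ β * (3 ^ D * z ^ 2 * (N ^ ((D : ℝ) / q) * N ^ (-3 : ℝ)) *
          (N ^ 2 * Lq * E + X)))) ^ (1 / θ) := by gcongr
      _ = (C * 3 ^ (D + 1) * z ^ 2 * (N ^ (β + D / q - 3) * (N ^ 2 * Lq * E + X))) ^ (1 / θ) := by
          have : N ^ (β + D / q - 3) = N ^ β * (N ^ ((D : ℝ) / q) * N ^ (-3 : ℝ)) := by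
            rw [← Real.rpow_add hN, ← Real.rpow_add hN]; congr 1; ring
          rw [this]; congr 1; ring
      _ = (C * 3 ^ (D + 1) * z ^ 2) ^ (1 / θ) *
          (N ^ ((β + D / q - 3) / θ) * (N ^ 2 * Lq * E + X) ^ (1 / θ)) := by
          rw [Real.mul_rpow (x := C * 3 ^ (D + 1) * z ^ 2) (by positivity) (by positivity),
            Real.mul_rpow (x := N ^ (β + D / q - 3)) (by positivity) (by positivity),
            ← Real.rpow_mul hN.le, mul_one_div]
      _ ≤ _ := by
          have := rpow_le_self_of_one_le hK hθi.le
          gcongr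
  have e7 : N ^ ((D : ℝ) / p) * (N ^ (-(1 - 1 / θ)) * N ^ ((β + D / q - 3) / θ)) = N / N ^ 2 := by
    have : N / N ^ 2 = N ^ (-1 : ℝ) := by rw [Real.rpow_neg_one]; field_simp
    rw [this, ← Real.rpow_add hN, ← Real.rpow_add hN]
    congr 1
    field_simp
    field_simp at he
    linarith
  calc _ ≤ 2 * (z / N) * ((z * N ^ ((D : ℝ) / p) * Lp) *
        ((z * (N ^ (-(1 - 1 / θ)) * X ^ (1 - 1 / θ))) * (C * 3 ^ (D + 1) * z ^ 2 *
          (N ^ ((β + D / q - 3) / θ) * (N ^ 2 * Lq * E + X) ^ (1 / θ))))) := by gcongr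
    _ = 2 * C * 3 ^ (D + 1) * z ^ 5 / N *
        (N ^ ((D : ℝ) / p) * (N ^ (-(1 - 1 / θ)) * N ^ ((β + D / q - 3) / θ))) *
        (Lp * X ^ (1 - 1 / θ) * (N ^ 2 * Lq * E + X) ^ (1 / θ)) := by ring
    _ = _ := by rw [e7]; field_simp

/-- The energy at the larger radius returns on the right, but only with the power `1/θ < 1`; this
makes absorption possible. -/
theorem exists_caccioppoli {D : ℕ} {p q θ β : ℝ} (hE : InterpExponents D p q θ β)
    (hβ0 : 0 ≤ β) (hβ1 : β ≤ 1) (he : θ * D / p + β + D / q = 2) :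
    ∃ C : ℝ, 1 ≤ C ∧ ∀ (a : (Fin (D + 1) → ℤ) → Fin (D + 1) → ℝ) (_ : ∀ x i, 0 < a x i) (N : ℕ)
      (v : ℝ → (Fin (D + 1) → ℤ) → ℝ) (_ : IsSubsol a N v) (Lp Lq : ℝ) (_ : 0 ≤ Lp) (_ : 0 ≤ Lq)
      (_ : (esum N fun x i => a x i ^ p) ≤ (N : ℝ) ^ (D + 1) * Lp ^ p)
      (_ : (esum N fun x i => (a x i)⁻¹ ^ q) ≤ (N : ℝ) ^ (D + 1) * Lq ^ q)
      (s r : ℕ) (_ : s < r) (_ : r ≤ N) (_ : N ≤ 2 * r) (W : ℝ)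
      (_ : C * (N / ((r : ℝ) - s)) ^ 5 / N ^ 2 * (mass N v r + Lp * mass N v r ^ (1 - 1 / θ) *
        ((N : ℝ) ^ 2 * Lq * energy a N v r + mass N v r) ^ (1 / θ)) ≤ W),
      (∀ t ∈ Set.Icc (-(N * s : ℝ)) 0, ∑ x ∈ cube (Fin (D + 1)) s, v t x ^ 2 ≤ W) ∧
      energy a N v s ≤ W := by
  obtain ⟨C, hC, H⟩ := exists_cutoff hE
  have hc0 : (1 : ℝ) ≤ 20 * (D + 1) := by
    have : (0 : ℝ) ≤ D := by positivity
    linarith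
  refine ⟨2 * C * 3 ^ (D + 1) * (20 * (D + 1)) ^ 5, ?_, ?_⟩
  · have h1 : (1 : ℝ) ≤ 3 ^ (D + 1) := one_le_pow₀ (by norm_num)
    have h2 : (1 : ℝ) ≤ (20 * (D + 1)) ^ 5 := one_le_pow₀ hc0
    exact one_le_mul_of_one_le_of_one_le (one_le_mul_of_one_le_of_one_le (by linarith) h1) h2
  intro a ha N v hv Lp Lq hLp hLq hP hQ s r hsr hrN hNr W hW
  obtain ⟨G, hG, hGne, hcut⟩ := H a ha v hv.cont hv.nonneg N s r hsr
  have hsr' : (0 : ℝ) < (r : ℝ) - s := by rw [sub_pos]; exact_mod_cast hsr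
  have hN : (0 : ℝ) < N := by exact_mod_cast (by omega : 0 < N)
  have hrN' : (r : ℝ) ≤ N := by exact_mod_cast hrN
  have hNr' : (N : ℝ) ≤ 2 * r := by exact_mod_cast hNr
  have hs0 : (0 : ℝ) ≤ s := by positivity
  have hρ : 1 ≤ N / ((r : ℝ) - s) := by rw [le_div_iff₀ hsr']; linarith
  have hN1 : (1 : ℝ) ≤ N := by exact_mod_cast (by omega : 1 ≤ N)
  have hP' := (esum_mono hrN fun x i => Real.rpow_nonneg (ha x i).le p).trans hP
  have hQ' := (esum_mono hrN fun x i => Real.rpow_nonneg (inv_nonneg.2 (ha x i).le) q).trans hQ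
  have hX0 := mass_nonneg N v r
  have hE0 := energy_nonneg ha N v r
  have hcut' := hcut (20 * (D + 1) * (N / ((r : ℝ) - s)) / N) (by field_simp)
  have hsc := cutoff_bound_scaling (D := D) (m := 2 * r + 1) (z := 20 * (D + 1) * (N / ((r : ℝ) - s)))
    hE.1 hE.2.1 hE.2.2.1 hβ0 hβ1 he hN (by linarith) (by linarith)
    (one_le_mul_of_one_le_of_one_le hc0 hρ) hC
    (esum_nonneg fun x i => Real.rpow_nonneg (ha x i).le p)
    (esum_nonneg fun x i => Real.rpow_nonneg (inv_nonneg.2 (ha x i).le) q) hX0 hE0 hLp hLq hP' hQ'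
  refine hv.caccioppoli ha hsr hrN (η := cutoff G) (fun x hx => cutoff_eq_one hGne hG hx)
    (fun x hx => cutoff_eq_zero (by omega) hG hx) (cutoff_nonneg G) (cutoff_le_one G) ?_
  have hK : (1 : ℝ) ≤ 2 * C * 3 ^ (D + 1) * (20 * (D + 1)) ^ 5 :=
    one_le_mul_of_one_le_of_one_le (one_le_mul_of_one_le_of_one_le (by linarith)
      (one_le_pow₀ (by norm_num))) (one_le_pow₀ hc0)
  have hfirst : mass N v r / (N * ((r : ℝ) - s)) ≤
      2 * C * 3 ^ (D + 1) * (20 * (D + 1)) ^ 5 * (N / ((r : ℝ) - s)) ^ 5 / N ^ 2 * mass N v r := by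
    have h1 : mass N v r / (N * ((r : ℝ) - s)) = 1 * (N / ((r : ℝ) - s)) / N ^ 2 * mass N v r := by
      field_simp
    have h2 : N / ((r : ℝ) - s) ≤ (N / ((r : ℝ) - s)) ^ 5 := le_self_pow₀ hρ (by norm_num)
    rw [h1]
    gcongr
  refine le_trans (add_le_add hfirst (hcut'.trans hsc)) (le_trans (le_of_eq ?_) hW)
  ring

end RCM

/-! ### Absorption of the energy -/

namespace RCM

open Finset MeasureTheory

/-- The factor in the Caccioppoli inequality after absorption of the energy. -/
noncomputable def caccFactor (θ Lp Lq : ℝ) : ℝ := (1 + Lp) * (Lq * (1 + Lp)) ^ (1 / (θ - 1))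

theorem one_add_le_caccFactor {θ Lp Lq : ℝ} (hθ : 1 < θ) (hLp : 0 ≤ Lp)
    (hA : 1 ≤ Lq * (1 + Lp)) : 1 + Lp ≤ caccFactor θ Lp Lq := by
  have : 0 ≤ 1 / (θ - 1) := by
    have : 0 < θ - 1 := by linarith
    positivity
  exact le_mul_of_one_le_right (by linarith) (Real.one_le_rpow hA this)

/-- Young's inequality, used to absorb the energy. -/
theorem absorb_young {θ c ε N Lp Lq E X : ℝ} (hθ : 1 < θ) (hc : 1 ≤ c) (hε : 0 < ε) (hε1 : ε ≤ 1)
    (hN : 0 < N) (hLp : 0 ≤ Lp) (hLq : 0 < Lq) (hA : 1 ≤ Lq * (1 + Lp)) (hE : 0 ≤ E) (hX : 0 ≤ X) :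
    c / N ^ 2 * (X + Lp * X ^ (1 - 1 / θ) * (N ^ 2 * Lq * E + X) ^ (1 / θ)) ≤
      ε * E + (2 + (1 / ε) ^ (1 / (θ - 1))) * c ^ (θ / (θ - 1)) / N ^ 2 * caccFactor θ Lp Lq * X := by
  have hθ1 : 0 < θ - 1 := by linarith
  have hθi : 1 / θ < 1 := by rw [div_lt_one (by linarith)]; exact hθ
  have hθi0 : 0 < 1 / θ := by positivity
  set M := caccFactor θ Lp Lq with hM
  have hPM := one_add_le_caccFactor hθ hLp hA
  rw [← hM] at hPM
  set e := 1 / (θ - 1) with he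
  have he0 : 0 < e := by positivity
  have hθ' : θ / (θ - 1) = 1 + e := by rw [he]; field_simp; ring
  rw [hθ']
  set Y := N ^ 2 * Lq * E + X with hY
  have hY0 : 0 ≤ Y := by positivity
  -- Young's inequality is weighted so that `μ · N² Lq E = ε N² E`; the compensating power of `μ`
  -- accounts for the powers of `Lq` and `1/ε` in the factor of the mass.
  set μ := ε / Lq with hμ
  have hμ0 : 0 < μ := by positivity
  have hc0 : 0 < c := by linarith
  have hyoung := Real.geom_mean_le_arith_mean2_weighted (w₁ := 1 - 1 / θ) (w₂ := 1 / θ)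
    (p₁ := (c * Lp) ^ (1 + e) * μ ^ (-e) * X) (p₂ := μ * Y) (by linarith) hθi0.le (by positivity)
    (by positivity) (by ring)
  have h1 : ((c * Lp) ^ (1 + e) * μ ^ (-e) * X) ^ (1 - 1 / θ) * (μ * Y) ^ (1 / θ) =
      c * Lp * X ^ (1 - 1 / θ) * Y ^ (1 / θ) := by
    rw [Real.mul_rpow (by positivity) hX, Real.mul_rpow (by positivity) (by positivity),
      Real.mul_rpow hμ0.le hY0, ← Real.rpow_mul (by positivity), ← Real.rpow_mul hμ0.le]
    have e1 : (1 + e) * (1 - 1 / θ) = 1 := by rw [he]; field_simp; ring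
    have e2 : -e * (1 - 1 / θ) = -(1 / θ) := by rw [he]; field_simp
    rw [e1, e2, Real.rpow_one, Real.rpow_neg hμ0.le]
    have := (Real.rpow_pos_of_pos hμ0 (1 / θ)).ne'
    field_simp
  rw [h1] at hyoung
  have hA0 : 0 ≤ (c * Lp) ^ (1 + e) * μ ^ (-e) * X := by positivity
  have h2 : c * Lp * X ^ (1 - 1 / θ) * Y ^ (1 / θ) ≤ (c * Lp) ^ (1 + e) * μ ^ (-e) * X + μ * Y := by
    have a1 : (1 - 1 / θ) * ((c * Lp) ^ (1 + e) * μ ^ (-e) * X) ≤ (c * Lp) ^ (1 + e) * μ ^ (-e) * X :=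
      mul_le_of_le_one_left hA0 (by linarith)
    have a2 : 1 / θ * (μ * Y) ≤ μ * Y := mul_le_of_le_one_left (by positivity) hθi.le
    linarith
  have hc1 : c ≤ c ^ (1 + e) := by
    calc c = c ^ (1 : ℝ) := (Real.rpow_one c).symm
      _ ≤ _ := Real.rpow_le_rpow_of_exponent_le hc (by linarith)
  have hc2 : 1 ≤ c ^ (1 + e) := hc.trans hc1
  have h3 : (c * Lp) ^ (1 + e) * μ ^ (-e) ≤ (1 / ε) ^ e * c ^ (1 + e) * M := by
    have b1 : μ ^ (-e) = (1 / ε) ^ e * Lq ^ e := by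
      rw [Real.rpow_neg hμ0.le, ← Real.inv_rpow hμ0.le, hμ, inv_div,
        ← Real.mul_rpow (by positivity) hLq.le]
      congr 1; ring
    have b2 : Lp ^ (1 + e) * Lq ^ e ≤ M := by
      rw [hM, caccFactor, Real.rpow_add_of_nonneg hLp (by norm_num) he0.le, Real.rpow_one, mul_assoc,
        ← Real.mul_rpow hLp hLq.le, mul_comm Lq]
      gcongr <;> linarith
    rw [b1, Real.mul_rpow hc0.le hLp]
    calc c ^ (1 + e) * Lp ^ (1 + e) * ((1 / ε) ^ e * Lq ^ e) =
        (1 / ε) ^ e * c ^ (1 + e) * (Lp ^ (1 + e) * Lq ^ e) := by ring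
      _ ≤ _ := by gcongr
  have h4 : μ * Y ≤ ε * N ^ 2 * E + M * X := by
    have : μ * Y = ε * N ^ 2 * E + μ * X := by rw [hμ, hY]; field_simp
    rw [this]
    have h5 : μ ≤ M := by
      refine le_trans ?_ hPM
      rw [hμ, div_le_iff₀ hLq]
      linarith
    gcongr
  have h6 : M ≤ c ^ (1 + e) * M := le_mul_of_one_le_left (by linarith) hc2
  have h7 : c * X ≤ c ^ (1 + e) * M * X := by
    refine mul_le_mul_of_nonneg_right (hc1.trans ?_) hX
    exact le_mul_of_one_le_right (by linarith) (by linarith)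
  have h8 : M * X ≤ c ^ (1 + e) * M * X := mul_le_mul_of_nonneg_right h6 hX
  have h9 := mul_le_mul_of_nonneg_right h3 hX
  have total : c * (X + Lp * X ^ (1 - 1 / θ) * Y ^ (1 / θ)) ≤
      ε * E * N ^ 2 + (2 + (1 / ε) ^ e) * c ^ (1 + e) * M * X := by linarith
  calc _ = c * (X + Lp * X ^ (1 - 1 / θ) * Y ^ (1 / θ)) / N ^ 2 := by ring
    _ ≤ (ε * E * N ^ 2 + (2 + (1 / ε) ^ e) * c ^ (1 + e) * M * X) / N ^ 2 := by gcongr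
    _ = _ := by field_simp

variable {ι : Type*} [Fintype ι] [DecidableEq ι]

theorem mass_mono (N : ℕ) {v : ℝ → (ι → ℤ) → ℝ} (hc : ∀ x, Continuous fun t => v t x) {s r : ℕ}
    (h : s ≤ r) : mass N v s ≤ mass N v r := by
  have h' : (s : ℝ) ≤ r := by exact_mod_cast h
  have h1 : -(N * r : ℝ) ≤ -(N * s : ℝ) := by
    have : (N * s : ℝ) ≤ N * r := by gcongr
    linarith
  have h2 : -(N * s : ℝ) ≤ 0 := by rw [neg_nonpos]; positivity
  have c : ∀ r, Continuous fun t => ∑ x ∈ cube ι r, v t x ^ 2 := fun r =>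
    continuous_finsetSum _ fun x _ => (hc x).pow 2
  calc mass N v s ≤ ∫ t in (-(N * s : ℝ))..0, ∑ x ∈ cube ι r, v t x ^ 2 :=
        intervalIntegral.integral_mono_on h2 ((c s).intervalIntegrable _ _)
          ((c r).intervalIntegrable _ _) fun t _ =>
            sum_le_sum_of_subset_of_nonneg (cube_mono h) fun _ _ _ => sq_nonneg _
    _ ≤ _ := intervalIntegral.integral_mono_interval h1 h2 le_rfl
        (Filter.Eventually.of_forall fun t => sum_nonneg fun x _ => sq_nonneg _)
        ((c r).intervalIntegrable _ _)

/-- The crude discrete bound of the energy by the mass. -/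
theorem energy_le_mass {a : (ι → ℤ) → ι → ℝ} {N r : ℕ} {v : ℝ → (ι → ℤ) → ℝ}
    (hc : ∀ x, Continuous fun t => v t x) (hv : ∀ t x, 0 ≤ v t x) {B : ℝ} (hB0 : 0 ≤ B)
    (hB : ∀ x ∈ cube ι r, ∀ i, x + step i ∈ cube ι r → a x i ≤ B) :
    energy a N v r ≤ 2 * Fintype.card ι * B * mass N v r := by
  have h2 : -(N * r : ℝ) ≤ 0 := by rw [neg_nonpos]; positivity
  unfold energy mass
  rw [← intervalIntegral.integral_const_mul]
  refine intervalIntegral.integral_mono_on h2 ?_ ?_ fun t _ => ?_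
  · exact Continuous.intervalIntegrable
      (continuous_esum fun x i => ((hc _).sub (hc x) |>.pow 2).const_mul _) _ _
  · exact Continuous.intervalIntegrable
      ((continuous_finsetSum _ fun x _ => (hc x).pow 2).const_mul _) _ _
  · calc _ ≤ esum r (fun x i => B * (v t x ^ 2 + v t (x + step i) ^ 2)) := by
          refine esum_le_esum fun x hx i hx' => ?_
          have : (v t (x + step i) - v t x) ^ 2 ≤ v t x ^ 2 + v t (x + step i) ^ 2 := by
            nlinarith [mul_nonneg (hv t x) (hv t (x + step i))]
          exact mul_le_mul (hB x hx i hx') this (sq_nonneg _) hB0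
      _ = B * (esum r (fun x _ => v t x ^ 2) + esum r fun x i => v t (x + step i) ^ 2) := by
          rw [esum_mul_left, esum_add]
      _ ≤ B * (Fintype.card ι * ∑ x ∈ cube ι r, v t x ^ 2 + Fintype.card ι * ∑ x ∈ cube ι r, v t x ^ 2) := by
          have e1 := esum_left_le r (f := fun x => v t x ^ 2) fun x => sq_nonneg _
          have e2 := esum_right_le r (f := fun x => v t x ^ 2) fun x => sq_nonneg _
          gcongr
      _ = _ := by ring

/-- One bond is bounded by the sum over all bonds. The loss of a power of `N` is affordable, since
this only starts the induction on the width of the annulus. -/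
theorem le_of_esum_rpow_le {a : (ι → ℤ) → ι → ℝ} (ha : ∀ x i, 0 < a x i) {p Lp : ℝ} (hp : 1 < p)
    (hLp : 0 ≤ Lp) {N d : ℕ} (hN : 1 ≤ N)
    (hP : (esum N fun x i => a x i ^ p) ≤ (N : ℝ) ^ d * Lp ^ p) {x : ι → ℤ} (hx : x ∈ cube ι N)
    {i : ι} (hx' : x + step i ∈ cube ι N) : a x i ≤ (N : ℝ) ^ d * Lp := by
  have hp0 : 0 < p := by linarith
  have hN1 : (1 : ℝ) ≤ N := by exact_mod_cast hN
  have h1 : a x i ^ p ≤ esum N fun x i => a x i ^ p := by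
    rw [esum_eq]
    refine single_le_sum (f := fun e : (ι → ℤ) × ι => a e.1 e.2 ^ p)
      (fun e _ => Real.rpow_nonneg (ha _ _).le _) (a := (x, i)) ?_
    simp only [edges, mem_filter, mem_product, mem_univ, and_true]
    exact ⟨hx, lt_of_add_step_mem hx'⟩
  have h2 : (N : ℝ) ^ d ≤ ((N : ℝ) ^ d) ^ p := by
    calc (N : ℝ) ^ d = ((N : ℝ) ^ d) ^ (1 : ℝ) := (Real.rpow_one _).symm
      _ ≤ _ := Real.rpow_le_rpow_of_exponent_le (one_le_pow₀ hN1) hp.le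
  have h3 : a x i ^ p ≤ ((N : ℝ) ^ d * Lp) ^ p := by
    rw [Real.mul_rpow (by positivity) hLp]
    refine (h1.trans hP).trans ?_
    gcongr
  exact (Real.rpow_le_rpow_iff (ha x i).le (by positivity) hp0).1 h3

-- Strong induction on the width of the annulus replaces the usual infinite iteration over radii.
-- Each step halves the annulus and leaves a small multiple of the energy at the middle radius. At
-- width one the energy is bounded crudely by the mass.
set_option maxHeartbeats 1000000 in
theorem exists_absorbed_caccioppoli {D : ℕ} {p q θ β : ℝ} (hE : InterpExponents D p q θ β)
    (hβ0 : 0 ≤ β) (hβ1 : β ≤ 1) (he : θ * D / p + β + D / q = 2) :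
    ∃ (K : ℝ) (k : ℕ), 1 ≤ K ∧ ∀ (a : (Fin (D + 1) → ℤ) → Fin (D + 1) → ℝ) (_ : ∀ x i, 0 < a x i)
      (N : ℕ) (v : ℝ → (Fin (D + 1) → ℤ) → ℝ) (_ : IsSubsol a N v) (Lp Lq : ℝ) (_ : 0 ≤ Lp)
      (_ : 0 < Lq) (_ : 1 ≤ Lq * (1 + Lp))
      (_ : (esum N fun x i => a x i ^ p) ≤ (N : ℝ) ^ (D + 1) * Lp ^ p)
      (_ : (esum N fun x i => (a x i)⁻¹ ^ q) ≤ (N : ℝ) ^ (D + 1) * Lq ^ q)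
      (s r : ℕ) (_ : s < r) (_ : r ≤ N) (_ : N ≤ 2 * s) (W : ℝ)
      (_ : K * (N / ((r : ℝ) - s)) ^ k / N ^ 2 * caccFactor θ Lp Lq * mass N v r ≤ W),
      (∀ t ∈ Set.Icc (-(N * s : ℝ)) 0, ∑ x ∈ cube (Fin (D + 1)) s, v t x ^ 2 ≤ W) ∧
      energy a N v s ≤ W := by
  obtain ⟨C, hC, H⟩ := exists_caccioppoli hE hβ0 hβ1 he
  have hθ := hE.2.2.1
  have hp := hE.1
  -- The first entry covers the power of the fifth power of `N/(r-s)` left by Young's inequality;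
  -- the second lets `N^k/N²` dominate the loss `N^(D+1)` at width one.
  set k : ℕ := max (⌈5 * (θ / (θ - 1))⌉₊) (D + 3) with hk
  have hk1 : 5 * (θ / (θ - 1)) ≤ k :=
    (Nat.le_ceil _).trans (by exact_mod_cast le_max_left _ _)
  have hk2 : D + 3 ≤ k := le_max_right _ _
  -- Halving the width costs a factor `2^k`, and `ε 2^k = 1/2` makes the induction contract.
  set ε : ℝ := 1 / 2 / 2 ^ k with hε
  have hε0 : 0 < ε := by positivity
  have hε1 : ε ≤ 1 / 2 := div_le_self (by norm_num) (one_le_pow₀ (by norm_num))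
  set K₁ : ℝ := (2 + (1 / ε) ^ (1 / (θ - 1))) * C ^ (θ / (θ - 1)) with hK₁
  have hK₁0 : 1 ≤ K₁ := by
    have : 0 ≤ (1 / ε) ^ (1 / (θ - 1)) := by positivity
    refine one_le_mul_of_one_le_of_one_le (by linarith) (Real.one_le_rpow hC ?_)
    have : 0 < θ - 1 := by linarith
    positivity
  set K : ℝ := 2 * K₁ * 3 ^ k + 2 * (D + 1) with hK
  have h3k : (1 : ℝ) ≤ 3 ^ k := one_le_pow₀ (by norm_num)
  have hD0 : (0 : ℝ) ≤ D := by positivity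
  have hK0 : 1 ≤ K := by
    have := mul_le_mul_of_nonneg_left h3k (by linarith : 0 ≤ K₁)
    linarith
  refine ⟨K, k, hK0, ?_⟩
  intro a ha N v hv Lp Lq hLp hLq hA hP hQ s r hsr hrN hNs
  have hN : (0 : ℝ) < N := by exact_mod_cast (by omega : 0 < N)
  have hN1 : (1 : ℝ) ≤ N := by exact_mod_cast (by omega : 1 ≤ N)
  set M := caccFactor θ Lp Lq with hM
  have hPM : 1 + Lp ≤ M := one_add_le_caccFactor hθ hLp hA
  have hM0 : 0 < M := by linarith
  -- one step, with a small multiple of the energy on the right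
  have one_step : ∀ s' r' : ℕ, s' < r' → r' ≤ r → s ≤ s' → ∀ W : ℝ,
      ε * energy a N v r' + K₁ * (N / ((r' : ℝ) - s')) ^ k / N ^ 2 * M * mass N v r ≤ W →
      (∀ t ∈ Set.Icc (-(N * s' : ℝ)) 0, ∑ x ∈ cube (Fin (D + 1)) s', v t x ^ 2 ≤ W) ∧
      energy a N v s' ≤ W := by
    intro s' r' h1 h2 h3 W hW
    refine H a ha N v hv Lp Lq hLp hLq.le hP hQ s' r' h1 (by omega) (by omega) W ?_
    have hsr' : (0 : ℝ) < (r' : ℝ) - s' := by rw [sub_pos]; exact_mod_cast h1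
    have hρ : 1 ≤ N / ((r' : ℝ) - s') := by
      rw [le_div_iff₀ hsr']
      have : (r' : ℝ) ≤ N := by exact_mod_cast h2.trans hrN
      have : (0 : ℝ) ≤ s' := by positivity
      linarith
    have hρ5 : 1 ≤ (N / ((r' : ℝ) - s')) ^ 5 := one_le_pow₀ hρ
    have hy := absorb_young (c := C * (N / ((r' : ℝ) - s')) ^ 5) hθ
      (one_le_mul_of_one_le_of_one_le hC hρ5) hε0 (by linarith) hN hLp hLq hA
      (energy_nonneg ha N v r') (mass_nonneg N v r')
    refine hy.trans (le_trans (add_le_add le_rfl ?_) hW)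
    have hpow : (C * (N / ((r' : ℝ) - s')) ^ 5) ^ (θ / (θ - 1)) ≤
        C ^ (θ / (θ - 1)) * (N / ((r' : ℝ) - s')) ^ k := by
      rw [Real.mul_rpow (by linarith) (by positivity), ← Real.rpow_natCast, ← Real.rpow_natCast,
        ← Real.rpow_mul (by positivity)]
      gcongr
      push_cast
      exact hk1
    have hmm := mass_mono N hv.cont h2
    have hm0 := mass_nonneg N v r'
    have : 0 ≤ (1 / ε) ^ (1 / (θ - 1)) := by positivity
    calc _ ≤ (2 + (1 / ε) ^ (1 / (θ - 1))) * (C ^ (θ / (θ - 1)) * (N / ((r' : ℝ) - s')) ^ k) / N ^ 2 *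
          M * mass N v r := by gcongr
      _ = _ := by rw [hK₁]; ring
  have hX0 := mass_nonneg N v r
  have main : ∀ g : ℕ, ∀ s' : ℕ, r = s' + g → 1 ≤ g → s ≤ s' →
      ∀ W : ℝ, K * (N / (g : ℝ)) ^ k / N ^ 2 * M * mass N v r ≤ W →
      (∀ t ∈ Set.Icc (-(N * s' : ℝ)) 0, ∑ x ∈ cube (Fin (D + 1)) s', v t x ^ 2 ≤ W) ∧
      energy a N v s' ≤ W := by
    intro g
    induction g using Nat.strong_induction_on with
    | _ g ih =>
      intro s' hr hg hs' W hW
      rcases hg.eq_or_lt with rfl | hg2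
      · refine one_step s' r (by omega) le_rfl hs' W (le_trans ?_ hW)
        have e1 : (r : ℝ) - s' = 1 := by rw [hr]; push_cast; ring
        have hB := energy_le_mass (a := a) (N := N) (r := r) hv.cont hv.nonneg
          (B := (N : ℝ) ^ (D + 1) * Lp) (by positivity) fun x hx i hx' =>
            le_of_esum_rpow_le ha hp hLp (by omega) hP (cube_mono hrN hx) (cube_mono hrN hx')
        rw [Fintype.card_fin] at hB
        push_cast at hB
        have hpw : (N : ℝ) ^ (D + 1) ≤ N ^ k / N ^ 2 := by
          rw [le_div_iff₀ (by positivity), ← pow_add]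
          exact pow_le_pow_right₀ hN1 (by omega)
        have hB' : energy a N v r ≤ 2 * (D + 1) * (N ^ k / N ^ 2) * M * mass N v r := by
          refine hB.trans ?_
          have : Lp ≤ M := by linarith
          calc 2 * (D + 1 : ℝ) * (N ^ (D + 1) * Lp) * mass N v r ≤
              2 * (D + 1 : ℝ) * ((N ^ k / N ^ 2) * M) * mass N v r := by gcongr
            _ = _ := by ring
        have hEr := energy_nonneg ha N v r
        rw [e1, Nat.cast_one, div_one]
        have h5 : K₁ ≤ 2 * K₁ * 3 ^ k := by
          have := mul_le_mul_of_nonneg_left h3k (by linarith : 0 ≤ K₁)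
          linarith
        have h6 : 0 ≤ (N : ℝ) ^ k / N ^ 2 * M * mass N v r := by positivity
        calc ε * energy a N v r + K₁ * (N : ℝ) ^ k / N ^ 2 * M * mass N v r
            ≤ 1 * energy a N v r + K₁ * (N : ℝ) ^ k / N ^ 2 * M * mass N v r := by
              gcongr; linarith
          _ ≤ 2 * (D + 1) * (N ^ k / N ^ 2) * M * mass N v r +
              2 * K₁ * 3 ^ k * (N ^ k / N ^ 2 * M * mass N v r) := by
              have h7 := mul_le_mul_of_nonneg_right h5 h6
              have h8 : K₁ * (N : ℝ) ^ k / N ^ 2 * M * mass N v r =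
                  K₁ * ((N : ℝ) ^ k / N ^ 2 * M * mass N v r) := by ring
              rw [h8, one_mul]
              exact add_le_add hB' h7
          _ = _ := by rw [hK]; ring
      -- With integer division and `g ≥ 2`, the part `h` is at least `g/3` and the rest at least
      -- `g/2`. Hence the step closes because `K/2 + K₁ 3^k ≤ K`.
      · set h := g / 2 with hh
        have hgR : (0 : ℝ) < g := by exact_mod_cast (by omega : 0 < g)
        have ihm := (ih (g - h) (by omega) (s' + h) (by omega) (by omega) (by omega) _ le_rfl).2
        refine one_step s' (s' + h) (by omega) (by omega) hs' W (le_trans ?_ hW)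
        have e1 : ((s' + h : ℕ) : ℝ) - s' = h := by push_cast; ring
        rw [e1]
        have b1 : (g : ℝ) ≤ 2 * (g - h : ℕ) := by exact_mod_cast (by omega : g ≤ 2 * (g - h))
        have b2 : (g : ℝ) ≤ 3 * h := by exact_mod_cast (by omega : g ≤ 3 * h)
        have c1 : (N : ℝ) / (g - h : ℕ) ≤ 2 * (N / g) := by
          rw [mul_div_assoc', div_le_div_iff₀ (by linarith) hgR]
          have := mul_le_mul_of_nonneg_left b1 hN.le
          linarith
        have c2 : (N : ℝ) / h ≤ 3 * (N / g) := by
          rw [mul_div_assoc', div_le_div_iff₀ (by linarith) hgR]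
          have := mul_le_mul_of_nonneg_left b2 hN.le
          linarith
        calc ε * energy a N v (s' + h) + K₁ * (N / (h : ℝ)) ^ k / N ^ 2 * M * mass N v r
            ≤ ε * (K * (2 * (N / g)) ^ k / N ^ 2 * M * mass N v r) +
              K₁ * (3 * (N / (g : ℝ))) ^ k / N ^ 2 * M * mass N v r := by
              gcongr
              refine ihm.trans ?_
              gcongr
          _ = (ε * 2 ^ k * K + K₁ * 3 ^ k) * ((N / (g : ℝ)) ^ k / N ^ 2 * M * mass N v r) := by
              rw [mul_pow, mul_pow]; ring
          _ ≤ K * ((N / (g : ℝ)) ^ k / N ^ 2 * M * mass N v r) := by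
              have : ε * 2 ^ k = 1 / 2 := by rw [hε]; field_simp
              rw [this]
              gcongr
              rw [hK]
              linarith
          _ = _ := by ring
  intro W hW
  refine main (r - s) s (by omega) (by omega) le_rfl W ?_
  rwa [Nat.cast_sub hsr.le]

end RCM

/-! ### Gain of integrability and the Moser recursion -/

namespace RCM

open Finset MeasureTheory

/-- Conductances `a` whose `p`-th and inverse `q`-th moments over the cube of radius `N` are
controlled by `Lp` and `Lq`. -/
structure MomentBound {ι : Type*} [Fintype ι] [DecidableEq ι] (p q : ℝ)
    (a : (ι → ℤ) → ι → ℝ) (N : ℕ) (Lp Lq : ℝ) : Prop where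
  pos : ∀ x i, 0 < a x i
  left_nonneg : 0 ≤ Lp
  right_pos : 0 < Lq
  one_le : 1 ≤ Lq * (1 + Lp)
  left : (esum N fun x i => a x i ^ p) ≤ (N : ℝ) ^ (Fintype.card ι) * Lp ^ p
  right : (esum N fun x i => (a x i)⁻¹ ^ q) ≤ (N : ℝ) ^ (Fintype.card ι) * Lq ^ q

/-- The Caccioppoli inequality in terms of the averaged mass, and the gain of integrability. -/
theorem exists_gain {D : ℕ} {p q θ β δ : ℝ} (hE : InterpExponents D p q θ β)
    (hβ0 : 0 ≤ β) (hβ1 : β ≤ 1) (he : θ * D / p + β + D / q = 2) (hδ0 : 0 < δ) (hδ1 : δ < 1)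
    (hδ : δ = 2 / (D + 1 : ℝ) - 1 / q) :
    ∃ (K : ℝ) (k : ℕ), 1 ≤ K ∧ ∀ (a : (Fin (D + 1) → ℤ) → Fin (D + 1) → ℝ)
      (N : ℕ) (Lp Lq : ℝ) (_ : MomentBound p q a N Lp Lq)
      (v : ℝ → (Fin (D + 1) → ℤ) → ℝ) (_ : IsSubsol a N v)
      (s r : ℕ) (_ : s < r) (_ : r ≤ N) (_ : N ≤ 2 * s),
      (∀ t ∈ Set.Icc (-(N * s : ℝ)) 0, ∑ x ∈ cube (Fin (D + 1)) s, v t x ^ 2 ≤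
        K * (N / ((r : ℝ) - s)) ^ k * caccFactor θ Lp Lq * (N : ℝ) ^ (D + 1) *
          (mass N v r / (N : ℝ) ^ (D + 3))) ∧
      mass N (fun t x => v t x ^ (1 + δ)) s / (N : ℝ) ^ (D + 3) ≤
        K * ((N / ((r : ℝ) - s)) ^ k) ^ 2 * (Lq * caccFactor θ Lp Lq ^ (1 + δ)) *
          (mass N v r / (N : ℝ) ^ (D + 3)) ^ (1 + δ) := by
  obtain ⟨K, k, hK, H⟩ := exists_absorbed_caccioppoli hE hβ0 hβ1 he
  have hD : 1 ≤ D := by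
    rcases hE.2.2.2 with h | h
    · exact h.1.ge
    · exact le_trans (by norm_num) h.1
  have hq := hE.2.1
  have hq0 : 0 < q := by linarith
  have hqi : 1 / q ≤ 1 := by rw [div_le_one hq0]; exact hq.le
  have hθ := hE.2.2.1
  obtain ⟨C, hC, I⟩ := exists_parabolic_interpolation (Fin (D + 1)) (q := q) (δ := δ)
    (by rw [Fintype.card_fin]; omega) hq hδ0.le hδ1 (by rw [Fintype.card_fin]; push_cast; exact hδ)
  rw [Fintype.card_fin] at I
  have h3D : (1 : ℝ) ≤ 3 ^ (D + 1) := one_le_pow₀ (by norm_num)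
  have hK1 : K ≤ 2 * C * 3 ^ (D + 1) * K ^ (1 + δ) := by
    have h1 : K ≤ K ^ (1 + δ) := by
      calc K = K ^ (1 : ℝ) := (Real.rpow_one K).symm
        _ ≤ _ := Real.rpow_le_rpow_of_exponent_le hK (by linarith)
    have h2 : 1 ≤ 2 * C * 3 ^ (D + 1) := one_le_mul_of_one_le_of_one_le (by linarith) h3D
    exact h1.trans (le_mul_of_one_le_left (by linarith) h2)
  refine ⟨2 * C * 3 ^ (D + 1) * K ^ (1 + δ), k, hK.trans hK1, ?_⟩
  intro a N Lp Lq hL v hv s r hsr hrN hNs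
  have ha := hL.pos
  have hLp := hL.left_nonneg
  have hLq := hL.right_pos
  have hA := hL.one_le
  have hP := hL.left
  have hQ := hL.right
  rw [Fintype.card_fin] at hP hQ
  have hN : (0 : ℝ) < N := by exact_mod_cast (by omega : 0 < N)
  have hsr' : (0 : ℝ) < (r : ℝ) - s := by rw [sub_pos]; exact_mod_cast hsr
  have hrN' : (r : ℝ) ≤ N := by exact_mod_cast hrN
  have hNs' : (N : ℝ) ≤ 2 * s := by exact_mod_cast hNs
  have hs0 : (0 : ℝ) ≤ s := by positivity
  set ρ := N / ((r : ℝ) - s) with hρd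
  have hρ : 1 ≤ ρ := by rw [hρd, le_div_iff₀ hsr']; linarith
  set M := caccFactor θ Lp Lq with hM
  have hPM : 1 + Lp ≤ M := one_add_le_caccFactor hθ hLp hA
  have hM0 : 0 < M := by linarith
  have hX0 := mass_nonneg N v r
  set X := mass N v r with hX
  obtain ⟨h1, h2⟩ := H a ha N v hv Lp Lq hLp hLq hA hP hQ s r hsr hrN hNs _ le_rfl
  set W := K * ρ ^ k / N ^ 2 * M * X with hW
  have hW0 : 0 ≤ W := by positivity
  have eW : W = K * ρ ^ k * M * (N : ℝ) ^ (D + 1) * (X / (N : ℝ) ^ (D + 3)) := by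
    rw [hW]; field_simp; ring
  refine ⟨fun t ht => (h1 t ht).trans ?_, ?_⟩
  · rw [eW]; gcongr
  have hc := hv.cont
  have ht : -(N * s : ℝ) ≤ 0 := by rw [neg_nonpos]; positivity
  set Q := (esum s fun x i => (a x i)⁻¹ ^ q) with hQd
  have hQ0 : 0 ≤ Q := esum_nonneg fun x i => Real.rpow_nonneg (inv_nonneg.2 (ha x i).le) q
  set c := ((2 * s + 1 : ℝ) ^ (D + 1)) ^ (1 / q) / (2 * s + 1) ^ 2 with hcd
  have hc0 : 0 ≤ c := by positivity
  have cV : Continuous fun t => ∑ x ∈ cube (Fin (D + 1)) s, v t x ^ 2 :=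
    continuous_finsetSum _ fun x _ => (hc x).pow 2
  have cY : Continuous fun t => esum s fun x i => a x i * (v t (x + step i) - v t x) ^ 2 :=
    continuous_esum fun x i => ((hc _).sub (hc x) |>.pow 2).const_mul _
  have hV0 : ∀ t, 0 ≤ ∑ x ∈ cube (Fin (D + 1)) s, v t x ^ 2 := fun t => sum_nonneg fun x _ => sq_nonneg _
  have hY0 : ∀ t, 0 ≤ esum s fun x i => a x i * (v t (x + step i) - v t x) ^ 2 := fun t =>
    esum_nonneg fun x i => mul_nonneg (ha x i).le (sq_nonneg _)
  -- The bound `W`, uniform in time, is pulled out with the power `δ`; what remains under the time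
  -- integral is linear in energy and mass.
  have b1 : mass N (fun t x => v t x ^ (1 + δ)) s ≤
      W ^ δ * (C * (Q ^ (1 / q) * energy a N v s + c * mass N v s)) := by
    unfold mass energy
    rw [← intervalIntegral.integral_const_mul, ← intervalIntegral.integral_const_mul,
      ← intervalIntegral.integral_add ((cY.const_mul _).intervalIntegrable _ _)
      ((cV.const_mul c).intervalIntegrable _ _), ← intervalIntegral.integral_const_mul,
      ← intervalIntegral.integral_const_mul]
    refine intervalIntegral.integral_mono_on ht ?_ ?_ fun t htt => ?_
    · exact Continuous.intervalIntegrable (continuous_finsetSum _ fun x _ =>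
        ((hc x).rpow_const fun _ => Or.inr (by linarith)).pow 2) _ _
    · exact Continuous.intervalIntegrable ((((cY.const_mul _).add (cV.const_mul c)).const_mul _).const_mul _) _ _
    · refine (I s (v t) (hv.nonneg t) a ha).trans ?_
      have := hV0 t
      have := hY0 t
      have := h1 t htt
      gcongr
  have q1 : Q ^ (1 / q) ≤ (N : ℝ) ^ ((D + 1 : ℝ) / q) * Lq := by
    have hQ' : Q ≤ (N : ℝ) ^ (D + 1) * Lq ^ q :=
      (esum_mono (by omega) fun x i => Real.rpow_nonneg (inv_nonneg.2 (ha x i).le) q).trans hQ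
    calc Q ^ (1 / q) ≤ ((N : ℝ) ^ (D + 1) * Lq ^ q) ^ (1 / q) := by gcongr
      _ = _ := by
        rw [Real.mul_rpow (by positivity) (by positivity), ← Real.rpow_mul hLq.le,
          mul_one_div_cancel hq0.ne', Real.rpow_one, ← Real.rpow_natCast, ← Real.rpow_mul hN.le,
          mul_one_div]
        push_cast
        rfl
  have q2 : c ≤ 3 ^ (D + 1) * (N : ℝ) ^ ((D + 1 : ℝ) / q) / N ^ 2 := by
    have e1 : ((2 * s + 1 : ℝ) ^ (D + 1)) ^ (1 / q) ≤ 3 ^ (D + 1) * (N : ℝ) ^ ((D + 1 : ℝ) / q) := by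
      have hs1 : (2 * s + 1 : ℝ) ≤ 3 * N := by
        have : (s : ℝ) ≤ N := by exact_mod_cast (hsr.le.trans hrN)
        have : (1 : ℝ) ≤ N := by exact_mod_cast (by omega : 1 ≤ N)
        linarith
      calc ((2 * s + 1 : ℝ) ^ (D + 1)) ^ (1 / q) ≤ ((3 * N : ℝ) ^ (D + 1)) ^ (1 / q) := by gcongr
        _ = (3 ^ (D + 1)) ^ (1 / q) * (N : ℝ) ^ ((D + 1 : ℝ) / q) := by
          rw [mul_pow, Real.mul_rpow (by positivity) (by positivity), ← Real.rpow_natCast (N : ℝ),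
            ← Real.rpow_mul hN.le, mul_one_div]
          push_cast
          rfl
        _ ≤ _ := by
          have := rpow_le_self_of_one_le h3D hqi
          gcongr
    rw [hcd]
    gcongr
    linarith
  -- The zero-order term joins the energy term because `1 ≤ Lq M`.
  have q3 : mass N v s / N ^ 2 ≤ Lq * W := by
    have e1 : mass N v s ≤ X := mass_mono N hc hsr.le
    have e2 : 1 ≤ Lq * M := hA.trans (by gcongr)
    have e3 : 1 ≤ K * ρ ^ k := one_le_mul_of_one_le_of_one_le hK (one_le_pow₀ hρ)
    calc mass N v s / N ^ 2 ≤ X / N ^ 2 := by gcongr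
      _ ≤ (Lq * M) * (K * ρ ^ k) * (X / N ^ 2) :=
          le_mul_of_one_le_left (by positivity) (one_le_mul_of_one_le_of_one_le e2 e3)
      _ = _ := by rw [hW]; ring
  have q4 : Q ^ (1 / q) * energy a N v s + c * mass N v s ≤
      2 * 3 ^ (D + 1) * (N : ℝ) ^ ((D + 1 : ℝ) / q) * Lq * W := by
    have := energy_nonneg ha N v s
    have := mass_nonneg N v s
    calc _ ≤ (N : ℝ) ^ ((D + 1 : ℝ) / q) * Lq * W +
          3 ^ (D + 1) * (N : ℝ) ^ ((D + 1 : ℝ) / q) / N ^ 2 * mass N v s := by gcongr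
      _ = 1 * (N : ℝ) ^ ((D + 1 : ℝ) / q) * Lq * W +
          3 ^ (D + 1) * (N : ℝ) ^ ((D + 1 : ℝ) / q) * (mass N v s / N ^ 2) := by ring
      _ ≤ 3 ^ (D + 1) * (N : ℝ) ^ ((D + 1 : ℝ) / q) * Lq * W +
          3 ^ (D + 1) * (N : ℝ) ^ ((D + 1 : ℝ) / q) * (Lq * W) := by gcongr
      _ = _ := by ring
  have hδe : (1 + δ) ≤ 2 := by linarith
  have hWp : W ^ δ * W = W ^ (1 + δ) := by
    rw [Real.rpow_add' hW0 (by linarith), Real.rpow_one, mul_comm]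
  have hy0 : 0 ≤ X / (N : ℝ) ^ (D + 3) := by positivity
  have hW1 : W ^ (1 + δ) ≤ K ^ (1 + δ) * (ρ ^ k) ^ 2 * M ^ (1 + δ) *
      (N : ℝ) ^ ((D + 1) * (1 + δ)) * (X / (N : ℝ) ^ (D + 3)) ^ (1 + δ) := by
    have e1 : (ρ ^ k) ^ (1 + δ) ≤ (ρ ^ k) ^ 2 := by
      rw [← Real.rpow_natCast _ 2]
      exact Real.rpow_le_rpow_of_exponent_le (one_le_pow₀ hρ) (by push_cast; linarith)
    rw [eW, Real.mul_rpow (by positivity) hy0, Real.mul_rpow (by positivity) (by positivity),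
      Real.mul_rpow (by positivity) hM0.le, Real.mul_rpow (by positivity) (by positivity),
      ← Real.rpow_natCast (N : ℝ) (D + 1), ← Real.rpow_mul hN.le]
    push_cast
    gcongr
  -- By the choice of `δ`, `(D+1)(1/q + 1 + δ) = D + 3`, so the inequality for averaged masses
  -- carries no power of `N`.
  have hexp : (N : ℝ) ^ ((D + 1 : ℝ) / q) * (N : ℝ) ^ ((D + 1) * (1 + δ)) = (N : ℝ) ^ (D + 3) := by
    rw [← Real.rpow_add hN, ← Real.rpow_natCast]
    congr 1
    push_cast
    rw [hδ]
    field_simp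
    ring
  rw [div_le_iff₀ (by positivity)]
  calc mass N (fun t x => v t x ^ (1 + δ)) s
      ≤ W ^ δ * (C * (2 * 3 ^ (D + 1) * (N : ℝ) ^ ((D + 1 : ℝ) / q) * Lq * W)) := by
        refine b1.trans ?_
        gcongr
    _ = 2 * C * 3 ^ (D + 1) * (N : ℝ) ^ ((D + 1 : ℝ) / q) * Lq * (W ^ δ * W) := by ring
    _ ≤ 2 * C * 3 ^ (D + 1) * (N : ℝ) ^ ((D + 1 : ℝ) / q) * Lq * (K ^ (1 + δ) * (ρ ^ k) ^ 2 * M ^ (1 + δ) *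
      (N : ℝ) ^ ((D + 1) * (1 + δ)) * (X / (N : ℝ) ^ (D + 3)) ^ (1 + δ)) := by
        rw [hWp]; gcongr
    _ = 2 * C * 3 ^ (D + 1) * K ^ (1 + δ) * (ρ ^ k) ^ 2 * (Lq * M ^ (1 + δ)) *
          (X / (N : ℝ) ^ (D + 3)) ^ (1 + δ) *
          ((N : ℝ) ^ ((D + 1 : ℝ) / q) * (N : ℝ) ^ ((D + 1) * (1 + δ))) := by ring
    _ = _ := by rw [hexp]

/-- The recursion of the Moser iteration. -/
theorem moser_recursion {y : ℕ → ℝ} {H B δ : ℝ} (hδ : 0 < δ) (hH : 1 ≤ H) (hB : 1 ≤ B) {J : ℕ}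
    (hy : ∀ j, 0 ≤ y j) (h : ∀ j < J, y (j + 1) ≤ H * B ^ j * y j ^ (1 + δ)) :
    y J ≤ H ^ (((1 + δ) ^ J - 1) / δ) * B ^ ((1 + δ) ^ J / δ ^ 2) * y 0 ^ ((1 + δ) ^ J) := by
  have hH0 : 0 < H := by linarith
  have hB0 : 0 < B := by linarith
  -- The two exponents start from zero and solve `e' = (1+δ)e + 1` and `e' = (1+δ)e + j`. The
  -- negative terms of the second are dropped at the end.
  have key : ∀ j ≤ J, y j ≤ H ^ (((1 + δ) ^ j - 1) / δ) *
      B ^ ((1 + δ) ^ j / δ ^ 2 - j / δ - 1 / δ ^ 2) * y 0 ^ ((1 + δ) ^ j) := by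
    intro j
    induction j with
    | zero => intro _; simp
    | succ j ih =>
      intro hj
      have ih' := ih (by omega)
      have h1 := h j (by omega)
      refine h1.trans ?_
      have h0 := hy j
      have hy0 := hy 0
      calc H * B ^ j * y j ^ (1 + δ) ≤ H * B ^ j * (H ^ (((1 + δ) ^ j - 1) / δ) *
            B ^ ((1 + δ) ^ j / δ ^ 2 - j / δ - 1 / δ ^ 2) * y 0 ^ ((1 + δ) ^ j)) ^ (1 + δ) := by gcongr
        _ = (H ^ (1 : ℝ) * H ^ (((1 + δ) ^ j - 1) / δ * (1 + δ))) *
            (B ^ (j : ℝ) * B ^ (((1 + δ) ^ j / δ ^ 2 - j / δ - 1 / δ ^ 2) * (1 + δ))) *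
            y 0 ^ ((1 + δ) ^ j * (1 + δ)) := by
          rw [Real.mul_rpow (by positivity) (by positivity), Real.mul_rpow (by positivity) (by positivity),
            ← Real.rpow_mul hH0.le, ← Real.rpow_mul hB0.le, ← Real.rpow_mul hy0, Real.rpow_one,
            Real.rpow_natCast]
          ring
        _ = _ := by
          rw [← Real.rpow_add hH0, ← Real.rpow_add hB0, ← pow_succ]
          congr 2
          · congr 1
            field_simp
            ring
          · congr 1
            push_cast
            field_simp
            ring
  refine (key J le_rfl).trans ?_
  have := hy 0
  gcongr
  have : 0 ≤ (J : ℝ) / δ := by positivity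
  have : 0 ≤ 1 / δ ^ 2 := by positivity
  linarith

end RCM

/-! ### Iteration over shrinking cubes and the maximal inequality -/

namespace RCM

open Finset MeasureTheory

/-- The radii of the cubes in the Moser iteration, decreasing from `N` to `3N/4`. -/
def radius (N : ℕ) : ℕ → ℕ
  | 0 => N
  | j + 1 => radius N j - N / 2 ^ (j + 3)

/-- The lower bound is `3N/4` plus the part of the geometric series not yet removed; rounding the
gaps down only enlarges the radii. -/
theorem radius_bounds (N j : ℕ) :
    (3 / 4 * N + N / 2 ^ (j + 2) : ℝ) ≤ radius N j ∧ radius N j ≤ N := by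
  induction j with
  | zero => exact ⟨le_of_eq (by simp [radius]; ring), le_rfl⟩
  | succ j ih =>
    refine ⟨?_, (Nat.sub_le _ _).trans ih.2⟩
    have h1 : (radius N j : ℝ) ≤ radius N (j + 1) + (N / 2 ^ (j + 3) : ℕ) := by
      have : radius N j ≤ radius N (j + 1) + N / 2 ^ (j + 3) := by
        simp only [radius]; omega
      exact_mod_cast this
    have h2 : ((N / 2 ^ (j + 3) : ℕ) : ℝ) ≤ N / 2 ^ (j + 3) := by
      refine Nat.cast_div_le.trans (le_of_eq ?_); push_cast; rfl
    have h3 : (N / 2 ^ (j + 2) : ℝ) = 2 * (N / 2 ^ (j + 3)) := by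
      rw [pow_succ 2 (j + 2)]; field_simp
    have h4 : (N / 2 ^ (j + 1 + 2) : ℝ) = N / 2 ^ (j + 3) := rfl
    linarith [ih.1]

/-- As long as `2^(j+3) ≤ N` the integer gap is at least one, and rounding it down loses at most a
factor two. -/
theorem radius_gap {N j : ℕ} (h : 2 ^ (j + 3) ≤ N) :
    radius N (j + 1) < radius N j ∧ N ≤ 2 * radius N (j + 1) ∧
      N / ((radius N j : ℝ) - radius N (j + 1)) ≤ 2 ^ (j + 4) := by
  have hm : 1 ≤ N / 2 ^ (j + 3) := (Nat.one_le_div_iff (by positivity)).2 h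
  have hN : (0 : ℝ) ≤ N := N.cast_nonneg
  have hle : N / 2 ^ (j + 3) ≤ radius N j := by
    have h1 := (radius_bounds N j).1
    have h2 : ((N / 2 ^ (j + 3) : ℕ) : ℝ) ≤ N / 2 ^ (j + 2) := by
      refine Nat.cast_div_le.trans ?_
      push_cast
      gcongr <;> norm_num
    have h3 : ((N / 2 ^ (j + 3) : ℕ) : ℝ) ≤ radius N j := by linarith
    exact_mod_cast h3
  have hgap : (radius N j : ℝ) - radius N (j + 1) = (N / 2 ^ (j + 3) : ℕ) := by
    simp only [radius]; rw [Nat.cast_sub hle]; ring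
  refine ⟨by simp only [radius]; omega, ?_, ?_⟩
  · have h1 := (radius_bounds N (j + 1)).1
    have : (0 : ℝ) ≤ N / 2 ^ (j + 1 + 2) := by positivity
    have : (N : ℝ) ≤ 2 * radius N (j + 1) := by linarith
    exact_mod_cast this
  · rw [hgap, div_le_iff₀ (by exact_mod_cast hm)]
    have h1 : N < 2 ^ (j + 3) * (N / 2 ^ (j + 3) + 1) := Nat.lt_mul_div_succ N (by positivity)
    have h2 : N ≤ 2 ^ (j + 4) * (N / 2 ^ (j + 3)) := by
      calc N ≤ 2 ^ (j + 3) * (N / 2 ^ (j + 3) + N / 2 ^ (j + 3)) := h1.le.trans (by gcongr)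
        _ = _ := by ring
    exact_mod_cast h2

/-- The maximal inequality: local boundedness of nonnegative subsolutions. -/
theorem exists_maximal_inequality {D : ℕ} {p q θ β δ : ℝ} (hE : InterpExponents D p q θ β)
    (hβ0 : 0 ≤ β) (hβ1 : β ≤ 1) (he : θ * D / p + β + D / q = 2) (hδ0 : 0 < δ) (hδ1 : δ < 1)
    (hδ : δ = 2 / (D + 1 : ℝ) - 1 / q) :
    ∃ C : ℝ, 1 ≤ C ∧ ∀ (a : (Fin (D + 1) → ℤ) → Fin (D + 1) → ℝ)
      (N : ℕ) (Lp Lq : ℝ) (_ : MomentBound p q a N Lp Lq) (_ : 8 ≤ N)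
      (u : ℝ → (Fin (D + 1) → ℤ) → ℝ) (_ : IsSubsol a N u),
      ∀ t ∈ Set.Icc (-(3 / 4 * N ^ 2 : ℝ)) 0, ∀ x : Fin (D + 1) → ℤ,
        (∀ i, |(x i : ℝ)| ≤ 3 / 4 * N) →
        u t x ^ 2 ≤ C * (Lq * caccFactor θ Lp Lq ^ (1 + δ)) ^ (1 / δ) *
          (mass N u N / (N : ℝ) ^ (D + 3)) := by
  obtain ⟨K, k, hK, H⟩ := exists_gain hE hβ0 hβ1 he hδ0 hδ1 hδ
  have h2k : (1 : ℝ) ≤ 2 ^ k := one_le_pow₀ (by norm_num)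
  have h4k : (1 : ℝ) ≤ 4 ^ k := one_le_pow₀ (by norm_num)
  have h28 : (1 : ℝ) ≤ 2 ^ (8 * k) := one_le_pow₀ (by norm_num)
  have h2δ : (1 : ℝ) ≤ 2 ^ (4 / δ) := Real.one_le_rpow (by norm_num) (by positivity)
  set C₁ : ℝ := K * 2 ^ k * (2 ^ (4 / δ)) ^ (k + D + 1) with hC₁
  have hKk : 1 ≤ K * 2 ^ k := one_le_mul_of_one_le_of_one_le hK h2k
  have hK8 : 1 ≤ K * 2 ^ (8 * k) := one_le_mul_of_one_le_of_one_le hK h28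
  have h1C : 1 ≤ C₁ := one_le_mul_of_one_le_of_one_le hKk (one_le_pow₀ h2δ)
  have hB1 : (1 : ℝ) ≤ (4 ^ k) ^ (1 / δ ^ 2) := Real.one_le_rpow h4k (by positivity)
  refine ⟨C₁ * (K * 2 ^ (8 * k)) ^ (1 / δ) * (4 ^ k) ^ (1 / δ ^ 2), ?_, ?_⟩
  · exact one_le_mul_of_one_le_of_one_le (one_le_mul_of_one_le_of_one_le h1C
      (Real.one_le_rpow hK8 (by positivity))) hB1
  intro a N Lp Lq hL hN8 u hu t ht x hx
  have hLp := hL.left_nonneg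
  have hLq := hL.right_pos
  have hθ := hE.2.2.1
  set M := caccFactor θ Lp Lq with hM
  have hPM : 1 + Lp ≤ M := one_add_le_caccFactor hθ hLp hL.one_le
  have hM1 : 1 ≤ M := by linarith
  have hM0 : 0 < M := by linarith
  have hLM : 1 ≤ Lq * M := hL.one_le.trans (by gcongr)
  set G := Lq * M ^ (1 + δ) with hG
  have hMG : M ^ δ ≤ G := by
    rw [hG, Real.rpow_add hM0, Real.rpow_one, ← mul_assoc]
    exact le_mul_of_one_le_left (by positivity) hLM
  have hG1 : 1 ≤ G := (Real.one_le_rpow hM1 hδ0.le).trans hMG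
  clear_value M G
  have hN : (0 : ℝ) < N := by exact_mod_cast (by omega : 0 < N)
  -- The iteration runs until the gap between consecutive radii has shrunk to the lattice spacing.
  obtain ⟨J, hJ1, hJ2⟩ : ∃ J, 2 ^ (J + 3) ≤ N ∧ N < 2 ^ (J + 4) := by
    have h3 : 3 ≤ Nat.log 2 N := Nat.le_log_of_pow_le (by norm_num) (by omega)
    refine ⟨Nat.log 2 N - 3, ?_, ?_⟩
    · rw [show Nat.log 2 N - 3 + 3 = Nat.log 2 N by omega]
      exact Nat.pow_log_le_self 2 (by omega)
    · rw [show Nat.log 2 N - 3 + 4 = Nat.log 2 N + 1 by omega]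
      exact Nat.lt_pow_succ_log_self (by norm_num) N
  set v : ℕ → ℝ → (Fin (D + 1) → ℤ) → ℝ := fun j t x => u t x ^ ((1 + δ) ^ j) with hv
  have hvs : ∀ j, IsSubsol a N (v j) := fun j =>
    hu.rpow hL.pos (one_le_pow₀ (by linarith))
  have hvv : ∀ j, (fun t x => v j t x ^ (1 + δ)) = v (j + 1) := fun j => by
    funext t x
    simp only [hv]
    rw [← Real.rpow_mul (hu.nonneg t x), pow_succ]
  set y : ℕ → ℝ := fun j => mass N (v j) (radius N j) / (N : ℝ) ^ (D + 3) with hy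
  have hy0 : ∀ j, 0 ≤ y j := fun j => div_nonneg (mass_nonneg _ _ _) (by positivity)
  have hρ : ∀ j ≤ J, 2 ^ (j + 3) ≤ N := fun j hj =>
    (Nat.pow_le_pow_right (by norm_num) (by omega)).trans hJ1
  have hstep : ∀ j < J, y (j + 1) ≤ K * 2 ^ (8 * k) * G * (4 ^ k) ^ j * y j ^ (1 + δ) := by
    intro j hj
    obtain ⟨g1, g2, g3⟩ := radius_gap (hρ j hj.le)
    have h := (H a N Lp Lq hL (v j) (hvs j) _ _ g1 (radius_bounds N j).2 g2).2
    rw [hvv] at h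
    have g0 : (0 : ℝ) < (radius N j : ℝ) - radius N (j + 1) := by
      rw [sub_pos]; exact_mod_cast g1
    have := hy0 j
    calc y (j + 1) ≤ _ := h
      _ ≤ K * (((2 : ℝ) ^ (j + 4)) ^ k) ^ 2 * G * y j ^ (1 + δ) := by
        rw [← hM, ← hG]
        gcongr
      _ = _ := by
        have e : (((2 : ℝ) ^ (j + 4)) ^ k) ^ 2 = 2 ^ (8 * k) * (4 ^ k) ^ j := by
          rw [show (4 : ℝ) = 2 ^ 2 by norm_num, ← pow_mul, ← pow_mul, ← pow_mul, ← pow_mul, ← pow_add]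
          congr 1
          ring
        rw [e]
        ring
  have hrec := moser_recursion (H := K * 2 ^ (8 * k) * G) (B := 4 ^ k) hδ0
    (one_le_mul_of_one_le_of_one_le hK8 hG1) h4k hy0 hstep
  obtain ⟨g1, g2, g3⟩ := radius_gap (hρ J le_rfl)
  have g0 : (0 : ℝ) < (radius N J : ℝ) - radius N (J + 1) := by
    rw [sub_pos]; exact_mod_cast g1
  have h := (H a N Lp Lq hL (v J) (hvs J) _ _ g1 (radius_bounds N J).2 g2).1
  have hr := (radius_bounds N (J + 1)).1
  have hr' : (3 / 4 * N : ℝ) ≤ radius N (J + 1) := by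
    have : (0 : ℝ) ≤ N / 2 ^ (J + 1 + 2) := by positivity
    linarith
  have htm : t ∈ Set.Icc (-(N * radius N (J + 1) : ℝ)) 0 := by
    refine ⟨le_trans ?_ ht.1, ht.2⟩
    rw [neg_le_neg_iff]
    calc (3 / 4 * N ^ 2 : ℝ) = N * (3 / 4 * N) := by ring
      _ ≤ _ := by gcongr
  have hxm : x ∈ cube (Fin (D + 1)) (radius N (J + 1)) := by
    rw [mem_cube]
    intro i
    have h1 : ((|x i| : ℤ) : ℝ) ≤ radius N (J + 1) := by
      rw [Int.cast_abs]; exact (hx i).trans hr'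
    have h2 : |x i| ≤ (radius N (J + 1) : ℤ) := by exact_mod_cast h1
    exact abs_le.1 h2
  -- No limit is needed on the lattice: a single site is bounded by the sum over the cube, at the
  -- price of a fixed power of `N`.
  have hpt : v J t x ^ 2 ≤ K * ((2 : ℝ) * N) ^ k * M * (N : ℝ) ^ (D + 1) * y J := by
    have h1 := h t htm
    have h2 := single_le_sum (f := fun x => v J t x ^ 2) (fun z _ => sq_nonneg _) hxm
    refine h2.trans (h1.trans ?_)
    have := hy0 J
    have g4 : (2 : ℝ) ^ (J + 4) ≤ 2 * N := by
      have : 2 ^ (J + 4) ≤ 2 * N := by rw [pow_succ]; omega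
      exact_mod_cast this
    have g5 := g3.trans g4
    rw [← hM]
    gcongr
  set X : ℝ := (1 + δ) ^ J with hX
  have hX1 : 1 ≤ X := one_le_pow₀ (by linarith)
  have hX0 : 0 < X := by linarith
  -- Bernoulli's inequality: `J` is at most of order `(1+δ)^J`. As `N < 2^(J+4)`, the root of order
  -- `X` of the power of `N` is then bounded independently of `N`.
  have hJX : (J + 4 : ℝ) ≤ 4 / δ * X := by
    have h1 : 1 + (J : ℝ) * δ ≤ X := one_add_mul_le_pow (by linarith) J
    have h2 : 4 / δ * (1 + J * δ) ≤ 4 / δ * X := by gcongr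
    have h3 : 4 / δ * (1 + J * δ) = 4 / δ + 4 * J := by field_simp
    have h4 : 4 ≤ 4 / δ := by rw [le_div_iff₀ hδ0]; linarith
    have : (0 : ℝ) ≤ J := J.cast_nonneg
    linarith
  have hNX : (N : ℝ) ≤ (2 ^ (4 / δ)) ^ X := by
    calc (N : ℝ) ≤ 2 ^ (J + 4) := by exact_mod_cast hJ2.le
      _ = (2 : ℝ) ^ (J + 4 : ℝ) := by rw [← Real.rpow_natCast]; push_cast; rfl
      _ ≤ 2 ^ (4 / δ * X) := Real.rpow_le_rpow_of_exponent_le (by norm_num) hJX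
      _ = _ := Real.rpow_mul (by norm_num) _ _
  have hu0 := hu.nonneg t x
  have hyz : y 0 = mass N u N / (N : ℝ) ^ (D + 3) := by
    have : v 0 = u := by funext t x; simp [hv]
    simp only [hy, this, radius]
  have hyz0 := hy0 0
  rw [← hyz]
  have hH0 : 0 < K * 2 ^ (8 * k) * G := by positivity
  -- The spare factor `M` of the last step fits into one factor `h^(1/δ)` and completes
  -- `h^((X-1)/δ)` to `h^(X/δ)`.
  have hMH : M ≤ (K * 2 ^ (8 * k) * G) ^ (1 / δ) := by
    calc M = (M ^ δ) ^ (1 / δ) := by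
          rw [← Real.rpow_mul hM0.le, mul_one_div_cancel hδ0.ne', Real.rpow_one]
      _ ≤ _ := by
          have : G ≤ K * 2 ^ (8 * k) * G := le_mul_of_one_le_left (by linarith) hK8
          have := hMG.trans this
          gcongr
  have hKX : K * 2 ^ k ≤ (K * 2 ^ k) ^ X := by
    calc K * 2 ^ k = (K * 2 ^ k) ^ (1 : ℝ) := (Real.rpow_one _).symm
      _ ≤ _ := Real.rpow_le_rpow_of_exponent_le hKk hX1
  set h := K * 2 ^ (8 * k) * G with hh
  clear_value h
  have hmain : (u t x ^ 2) ^ X ≤ (C₁ * h ^ (1 / δ) * (4 ^ k) ^ (1 / δ ^ 2) * y 0) ^ X := by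
    have e1 : (u t x ^ 2) ^ X = v J t x ^ 2 := by
      simp only [hv]
      rw [← Real.rpow_natCast, ← Real.rpow_natCast, ← Real.rpow_mul hu0, ← Real.rpow_mul hu0,
        mul_comm]
    rw [e1]
    calc v J t x ^ 2 ≤ K * ((2 : ℝ) * N) ^ k * M * (N : ℝ) ^ (D + 1) * y J := hpt
      _ ≤ K * ((2 : ℝ) * N) ^ k * M * (N : ℝ) ^ (D + 1) *
          (h ^ ((X - 1) / δ) * (4 ^ k) ^ (X / δ ^ 2) * y 0 ^ X) := by gcongr
      _ = (K * 2 ^ k) * (N : ℝ) ^ (k + D + 1) * (M * h ^ ((X - 1) / δ)) *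
          (4 ^ k) ^ (X / δ ^ 2) * y 0 ^ X := by ring
      _ ≤ (K * 2 ^ k) ^ X * ((2 ^ (4 / δ)) ^ X) ^ (k + D + 1) *
          (h ^ (1 / δ) * h ^ ((X - 1) / δ)) * (4 ^ k) ^ (X / δ ^ 2) * y 0 ^ X := by gcongr
      _ = _ := by
        conv_rhs => rw [hC₁, Real.mul_rpow (by positivity) hyz0,
          Real.mul_rpow (by positivity) (by positivity), Real.mul_rpow (by positivity) (by positivity),
          Real.mul_rpow (x := K * 2 ^ k) (by positivity) (by positivity)]
        rw [← Real.rpow_add hH0, ← Real.rpow_mul hH0.le, ← Real.rpow_mul (x := (4 : ℝ) ^ k) (by positivity),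
          Real.rpow_pow_comm (x := (2 : ℝ) ^ (4 / δ)) (by positivity)]
        congr 4
        · field_simp
          ring
        · field_simp
  have := (Real.rpow_le_rpow_iff (sq_nonneg _) (by positivity) hX0).1 hmain
  refine this.trans (le_of_eq ?_)
  rw [hh, Real.mul_rpow (by positivity) (by linarith)]
  ring

end RCM

/-! ### Admissible exponents and the constant -/

namespace RCM

open Finset MeasureTheory

/-- The integrability assumptions supply admissible interpolation exponents. -/
theorem exists_interpExponents {D : ℕ} (hD : 1 ≤ D) {p q : ℝ} (hp : 1 < p)
    (hq : ((D + 1 : ℕ) : ℝ) / 2 < q) (hpq : 1 / p + 1 / q < 2 / (((D + 1 : ℕ) : ℝ) - 1)) :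
    (∃ β, InterpExponents D p q (theta (D + 1) p q) β ∧ 0 ≤ β ∧ β ≤ 1 ∧
      theta (D + 1) p q * D / p + β + D / q = 2) ∧
    0 < delta₂ (D + 1) q ∧ delta₂ (D + 1) q < 1 ∧
    delta₂ (D + 1) q = 2 / (D + 1 : ℝ) - 1 / q ∧
    delta₂ (D + 1) q * (p - 1) ≤ theta (D + 1) p q := by
  have hD' : (1 : ℝ) ≤ D := by exact_mod_cast hD
  have hp0 : 0 < p := by linarith
  push_cast at hq hpq
  rw [add_sub_cancel_right] at hpq
  have hq1 : 1 < q := by linarith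
  have hq0 : 0 < q := by linarith
  have hqi : 0 < 1 / q := by positivity
  have hqi1 : 1 / q < 1 := by rw [div_lt_one hq0]; exact hq1
  have hδ : delta₂ (D + 1) q = 2 / (D + 1 : ℝ) - 1 / q := by rw [delta₂]; push_cast; rfl
  have hδ0 : 0 < delta₂ (D + 1) q := by
    rw [hδ, sub_pos, div_lt_div_iff₀ hq0 (by positivity)]; linarith
  have hδ1 : delta₂ (D + 1) q < 1 := by
    have : 2 / (D + 1 : ℝ) ≤ 1 := by rw [div_le_one (by positivity)]; linarith
    rw [hδ]; linarith
  rcases hD.eq_or_lt with h | h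
  · subst h
    have hθ : theta (1 + 1) p q = p := by simp [theta]
    refine ⟨⟨1 - 1 / q, ⟨hp, hq1, by rwa [hθ], Or.inl ⟨rfl, hθ, rfl⟩⟩, by linarith, by linarith, ?_⟩,
      hδ0, hδ1, hδ, ?_⟩
    · rw [hθ]; push_cast; field_simp; ring
    · rw [hθ]
      have : delta₂ (1 + 1) q * (p - 1) ≤ 1 * (p - 1) := by gcongr
      linarith
  · have h2 : 2 ≤ D := h
    have h2' : (2 : ℝ) ≤ D := by exact_mod_cast h2
    have hD2 : 2 / (D : ℝ) ≤ 1 := by rw [div_le_one (by positivity)]; exact h2'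
    -- In this form `θ > 1` is just the assumption `1/p + 1/q < 2/D`, and `κ` is read off from `θ =
    -- p (1 - 1/κ)`.
    have hθ : theta (D + 1) p q = p * (2 / D - 1 / q) := by
      rw [theta, if_neg (by omega), delta₁]
      push_cast
      rw [add_sub_cancel_right]
      field_simp
      ring
    have hk0 : 0 < 1 + 1 / q - 2 / (D : ℝ) := by linarith
    have hpi : 0 < 1 / p := by positivity
    have hc : 0 < 2 / (D : ℝ) - 1 / q := by linarith
    have hθ1 : 1 < theta (D + 1) p q := by
      rw [hθ]
      have : 1 / p < 2 / (D : ℝ) - 1 / q := by linarith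
      rwa [div_lt_iff₀' hp0] at this
    refine ⟨⟨0, ⟨hp, hq1, hθ1, Or.inr ⟨h2, rfl, (1 + 1 / q - 2 / (D : ℝ))⁻¹, ?_, ?_, ?_⟩⟩,
      le_rfl, zero_le_one, ?_⟩, hδ0, hδ1, hδ, ?_⟩
    · exact (one_le_inv₀ hk0).2 (by linarith)
    · rw [one_div, inv_inv]
    · rw [one_div (1 + 1 / q - 2 / (D : ℝ))⁻¹, inv_inv, hθ,
        show 1 - (1 + 1 / q - 2 / (D : ℝ)) = 2 / D - 1 / q by ring]
      generalize 2 / (D : ℝ) - 1 / q = X at hc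
      field_simp
    · rw [hθ]; field_simp; ring
    · rw [hθ]
      have e1 : delta₂ (D + 1) q ≤ 2 / D - 1 / q := by
        rw [hδ]; gcongr; linarith
      calc delta₂ (D + 1) q * (p - 1) ≤ (2 / D - 1 / q) * p := by
            have : 0 ≤ p - 1 := by linarith
            gcongr
            linarith
        _ = _ := mul_comm _ _

/-- The constant of the maximal inequality in terms of averaged norms. -/
theorem gain_factor_le {θ δ p c Lp Lq : ℝ} (hθ : 1 < θ) (hδ : 0 < δ) (hp : 1 < p) (hc : 1 ≤ c)
    (hLp : 0 ≤ Lp) (hLq : 0 < Lq) (hA : 1 ≤ Lq * (1 + Lp)) (h : δ * (p - 1) ≤ θ) :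
    (c * Lq * caccFactor θ (c * Lp) (c * Lq) ^ (1 + δ)) ^ (1 / δ) ≤
      (c * (c * (c * c) ^ (1 / (θ - 1))) ^ (1 + δ)) ^ (1 / δ) *
      ((Lq * (1 + Lp)) ^ (1 / (δ * (1 - 1 / θ))) * (1 + Lp)) ^ (p / (p - 1)) := by
  have hθ0 : 0 < θ - 1 := by linarith
  have hp0 : 0 < p - 1 := by linarith
  have hc0 : 0 < c := by linarith
  have hcP : 1 + c * Lp ≤ c * (1 + Lp) := by linarith
  set P := 1 + Lp with hP
  have hP1 : 1 ≤ P := by linarith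
  have hP0 : 0 < P := by linarith
  set A := Lq * P with hAd
  have hA0 : 0 < A := by linarith
  have e1 : caccFactor θ (c * Lp) (c * Lq) ≤
      (c * (c * c) ^ (1 / (θ - 1))) * (P * A ^ (1 / (θ - 1))) := by
    rw [caccFactor]
    calc (1 + c * Lp) * (c * Lq * (1 + c * Lp)) ^ (1 / (θ - 1))
        ≤ (c * P) * (c * Lq * (c * P)) ^ (1 / (θ - 1)) := by gcongr
      _ = (c * P) * ((c * c) * A) ^ (1 / (θ - 1)) := by rw [hAd]; ring_nf
      _ = _ := by rw [Real.mul_rpow (by positivity) hA0.le]; ring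
  have hcf : 0 ≤ caccFactor θ (c * Lp) (c * Lq) := by rw [caccFactor]; positivity
  have e2 : c * Lq * caccFactor θ (c * Lp) (c * Lq) ^ (1 + δ) ≤
      (c * (c * (c * c) ^ (1 / (θ - 1))) ^ (1 + δ)) * (P ^ δ * A ^ (1 + (1 + δ) / (θ - 1))) := by
    calc _ ≤ c * Lq * ((c * (c * c) ^ (1 / (θ - 1))) * (P * A ^ (1 / (θ - 1)))) ^ (1 + δ) := by gcongr
      _ = (c * (c * (c * c) ^ (1 / (θ - 1))) ^ (1 + δ)) *
          (Lq * P ^ (1 + δ) * A ^ ((1 + δ) / (θ - 1))) := by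
        rw [Real.mul_rpow (by positivity) (by positivity), Real.mul_rpow hP0.le (by positivity),
          ← Real.rpow_mul hA0.le, one_div_mul_eq_div]
        ring
      _ = _ := by
        rw [Real.rpow_add hP0, Real.rpow_add hA0, Real.rpow_one, Real.rpow_one, hAd]
        ring
  clear_value A
  refine (Real.rpow_le_rpow (by positivity) e2 (by positivity)).trans ?_
  rw [Real.mul_rpow (by positivity) (by positivity)]
  gcongr
  rw [Real.mul_rpow (by positivity) (by positivity), ← Real.rpow_mul hP0.le,
    mul_one_div_cancel hδ.ne', Real.rpow_one, Real.mul_rpow (by positivity) hP0.le,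
    ← Real.rpow_mul hA0.le, ← Real.rpow_mul hA0.le, mul_comm]
  have hpp : 1 ≤ p / (p - 1) := by rw [one_le_div hp0]; linarith
  gcongr ?_ * ?_
  · refine Real.rpow_le_rpow_of_exponent_le hA ?_
    -- Over the common factor `1/((θ-1)δ)` the comparison of exponents is `(θ + δ)(p-1) ≤ pθ`, that
    -- is, the hypothesis `δ(p-1) ≤ θ`. It is paid for by the outer power `p/(p-1)`.
    have f1 : (1 + (1 + δ) / (θ - 1)) * (1 / δ) = (θ + δ) * (1 / ((θ - 1) * δ)) := by
      field_simp
      ring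
    have f2 : 1 / (δ * (1 - 1 / θ)) * (p / (p - 1)) = (p * θ / (p - 1)) * (1 / ((θ - 1) * δ)) := by
      have : (1 - 1 / θ) = (θ - 1) / θ := by field_simp
      rw [this]
      field_simp
    rw [f1, f2]
    gcongr
    rw [le_div_iff₀ hp0]
    linarith
  · calc P = P ^ (1 : ℝ) := (Real.rpow_one P).symm
      _ ≤ _ := Real.rpow_le_rpow_of_exponent_le hP1 hpp

/-- The scale-invariant form of the constant `C(ω,S,τ)`. -/
theorem scaled_const_eq {α τ Λp Λq : ℝ} (hα : 0 < α) (hτ : 0 < τ) (hp : 0 ≤ Λp) (hq : 0 < Λq) :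
    (τ ^ (1 / 2 : ℝ) * (Λq * (Λp + τ⁻¹) ^ (1 + α)) ^ (1 / (2 * α))) ^ 2 =
      (τ⁻¹ * Λq * (1 + τ * Λp)) ^ (1 / α) * (1 + τ * Λp) := by
  have hP0 : 0 < 1 + τ * Λp := by positivity
  have e1 : Λp + τ⁻¹ = τ⁻¹ * (1 + τ * Λp) := by field_simp; ring
  rw [e1]
  set P := 1 + τ * Λp
  have e2 : Λq * (τ⁻¹ * P) ^ (1 + α) = (τ⁻¹ * Λq * P) * (τ⁻¹ * P) ^ α := by
    rw [Real.rpow_add (by positivity), Real.rpow_one]; ring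
  have hA : 0 < τ⁻¹ * Λq * P := by positivity
  rw [e2, mul_pow, ← Real.rpow_natCast, ← Real.rpow_natCast, ← Real.rpow_mul hτ.le,
    ← Real.rpow_mul (by positivity)]
  push_cast
  rw [show (1 / 2 : ℝ) * 2 = 1 by norm_num, Real.rpow_one,
    show 1 / (2 * α) * 2 = 1 / α by field_simp, Real.mul_rpow hA.le (by positivity),
    ← Real.rpow_mul (x := τ⁻¹ * P) (by positivity), mul_one_div_cancel hα.ne', Real.rpow_one]
  field_simp

end RCM

/-! ### Translation from boxes and bonds to cubes and directions -/

namespace RCM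

open Finset MeasureTheory

theorem step_injective {ι : Type*} [DecidableEq ι] : Function.Injective (step (ι := ι)) := by
  intro i j h
  by_contra hij
  have := congrFun h i
  rw [step_same, step_ne hij] at this
  exact one_ne_zero this

theorem step_add_step_ne_zero {ι : Type*} [DecidableEq ι] (i j : ι) : step i + step j ≠ 0 := by
  intro h
  have h1 := congrFun h i
  by_cases hij : i = j
  · subst hij; simp at h1
  · simp [step_ne hij] at h1

theorem lattice_adj_add_step {d : ℕ} (x : Fin d → ℤ) (i : Fin d) :
    (lattice d).Adj x (x + step i) := by
  change ∑ j, (x j - (x + step i) j) ^ 2 = 1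
  rw [sum_eq_single i (fun j _ hj => by simp [step_ne hj]) (by simp)]
  simp

/-- A sum of integer squares equals one only if a single term is nonzero, and that term is one. -/
theorem lattice_adj_iff {d : ℕ} {x y : Fin d → ℤ} :
    (lattice d).Adj x y ↔ ∃ i, y = x + step i ∨ y = x - step i := by
  constructor
  · intro h
    change ∑ j, (x j - y j) ^ 2 = 1 at h
    obtain ⟨i, hi⟩ : ∃ i, x i - y i ≠ 0 := by
      by_contra! h0
      simp [h0] at h
    have h1 := add_sum_erase univ (fun j => (x j - y j) ^ 2) (mem_univ i)
    have h2 : 1 ≤ (x i - y i) ^ 2 := by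
      have : 0 < (x i - y i) ^ 2 := by positivity
      omega
    have h3 : ∀ j ∈ univ.erase i, 0 ≤ (x j - y j) ^ 2 := fun j _ => sq_nonneg _
    have h4 : ∑ j ∈ univ.erase i, (x j - y j) ^ 2 = 0 := by
      have := sum_nonneg h3
      omega
    have h5 : ∀ j, j ≠ i → y j = x j := fun j hj => by
      have := (sum_eq_zero_iff_of_nonneg h3).1 h4 j (mem_erase.2 ⟨hj, mem_univ j⟩)
      have := pow_eq_zero_iff (two_ne_zero) |>.1 this
      omega
    have h6 : (x i - y i) ^ 2 = 1 := by omega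
    refine ⟨i, ?_⟩
    rcases eq_or_eq_neg_of_sq_eq_sq _ _ (h6.trans (one_pow 2).symm) with h7 | h7
    · right
      funext j
      by_cases hj : j = i
      · subst hj; simp; omega
      · simp [step_ne hj, h5 j hj]
    · left
      funext j
      by_cases hj : j = i
      · subst hj; simp; omega
      · simp [step_ne hj, h5 j hj]
  · rintro ⟨i, rfl | rfl⟩
    · exact lattice_adj_add_step x i
    · have := (lattice_adj_add_step (x - step i) i).symm
      rwa [sub_add_cancel] at this

theorem generator_eq {d : ℕ} (ω : Sym2 (Fin d → ℤ) → ℝ) (v : (Fin d → ℤ) → ℝ) (x : Fin d → ℤ) :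
    generator ω v x = ∑ i, (ω s(x, x + step i) * (v (x + step i) - v x) +
      ω s(x - step i, x) * (v (x - step i) - v x)) := by
  classical
  have h : (lattice d).neighborSet x =
      ((univ.image fun i => x + step i) ∪ univ.image fun i => x - step i : Finset (Fin d → ℤ)) := by
    ext y
    simp only [SimpleGraph.mem_neighborSet, lattice_adj_iff, coe_union, coe_image, coe_univ,
      Set.image_univ, Set.mem_union, Set.mem_range, eq_comm, exists_or]
  have hd : Disjoint (univ.image fun i : Fin d => x + step i)
      (univ.image fun i : Fin d => x - step i) := by
    rw [disjoint_left]
    intro y h1 h2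
    obtain ⟨i, -, hi⟩ := mem_image.1 h1
    obtain ⟨j, -, hj⟩ := mem_image.1 h2
    refine step_add_step_ne_zero i j ?_
    have : x + step i = x - step j := hi.trans hj.symm
    funext k
    have := congrFun this k
    simp only [Pi.add_apply, Pi.sub_apply, Pi.zero_apply] at this ⊢
    omega
  rw [generator, h, finsum_mem_coe_finset, sum_union hd,
    sum_image fun i _ j _ hij => step_injective (add_left_cancel hij),
    sum_image fun i _ j _ hij => step_injective (sub_right_injective hij), ← sum_add_distrib]
  simp only [Sym2.eq_swap (a := x) (b := x - step _)]

theorem mem_box_iff {d : ℕ} {x₀ y : Fin d → ℤ} {r : ℝ} (hr : 0 ≤ r) :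
    y ∈ box x₀ r ↔ y - x₀ ∈ cube (Fin d) ⌊r⌋₊ := by
  have : ((⌊r⌋₊ : ℕ) : ℤ) = ⌊r⌋ := Int.natCast_floor_eq_floor hr
  rw [mem_cube, box, Fintype.mem_piFinset]
  refine forall_congr' fun i => ?_
  rw [mem_Icc, this, Pi.sub_apply]
  omega

theorem sum_box {d : ℕ} {x₀ : Fin d → ℤ} {r : ℝ} (hr : 0 ≤ r) (f : (Fin d → ℤ) → ℝ) :
    ∑ y ∈ box x₀ r, f y = ∑ x ∈ cube (Fin d) ⌊r⌋₊, f (x₀ + x) := by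
  refine sum_nbij' (fun y => y - x₀) (fun x => x₀ + x) ?_ ?_ ?_ ?_ ?_
  · exact fun y hy => (mem_box_iff hr).1 hy
  · exact fun x hx => (mem_box_iff hr).2 (by simpa using hx)
  · simp
  · simp
  · simp

theorem card_box {d : ℕ} (x₀ : Fin d → ℤ) {r : ℝ} (hr : 0 ≤ r) :
    ((box x₀ r).card : ℝ) = (2 * ⌊r⌋₊ + 1) ^ d := by
  have := sum_box (x₀ := x₀) hr fun _ => (1 : ℝ)
  rw [sum_const, sum_const, card_cube, nsmul_one, nsmul_one] at this
  rw [this]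
  simp

theorem mem_edges {ι : Type*} [Fintype ι] [DecidableEq ι] {r : ℕ} {e : (ι → ℤ) × ι} :
    e ∈ edges ι r ↔ e.1 ∈ cube ι r ∧ e.1 + step e.2 ∈ cube ι r := by
  simp only [edges, mem_filter, mem_product, mem_univ, and_true]
  exact ⟨fun h => ⟨h.1, add_step_mem h.1 h.2⟩, fun h => ⟨h.1, lt_of_add_step_mem h.2⟩⟩

theorem mem_bonds {d : ℕ} {x₀ : Fin d → ℤ} {r : ℝ} (hr : 0 ≤ r) {y z : Fin d → ℤ} :
    s(y, z) ∈ bonds (box x₀ r) ↔ (y - x₀ ∈ cube (Fin d) ⌊r⌋₊ ∧ z - x₀ ∈ cube (Fin d) ⌊r⌋₊) ∧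
      (lattice d).Adj y z := by
  classical
  rw [bonds, mem_filter, mk_mem_sym2_iff, mem_box_iff hr, mem_box_iff hr,
    SimpleGraph.mem_edgeSet]

/-- Each unordered bond has exactly one representation by a lower end-point and a direction; the
reversed identification would require two unit steps with sum zero. -/
theorem sum_bonds {d : ℕ} (x₀ : Fin d → ℤ) {r : ℝ} (hr : 0 ≤ r) (f : Sym2 (Fin d → ℤ) → ℝ) :
    ∑ e ∈ bonds (box x₀ r), f e = esum ⌊r⌋₊ fun x i => f s(x₀ + x, x₀ + x + step i) := by
  rw [esum_eq]
  symm
  refine sum_nbij (fun e => s(x₀ + e.1, x₀ + e.1 + step e.2)) ?_ ?_ ?_ (fun _ _ => rfl)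
  · rintro ⟨x, i⟩ he
    rw [mem_edges] at he
    rw [mem_bonds hr]
    refine ⟨⟨by simpa using he.1, ?_⟩, lattice_adj_add_step _ _⟩
    have : x₀ + x + step i - x₀ = x + step i := by abel
    simpa [this] using he.2
  · rintro ⟨x, i⟩ - ⟨y, j⟩ - h
    simp only [Sym2.eq_iff] at h
    rcases h with ⟨h1, h2⟩ | ⟨h1, h2⟩
    · have hxy : x = y := add_left_cancel h1
      subst hxy
      rw [step_injective (add_left_cancel h2)]
    · exfalso
      refine step_add_step_ne_zero i j ?_
      rw [h1] at h2
      have : x₀ + y + (step j + step i) = x₀ + y + 0 := by rw [add_zero, ← add_assoc, h2]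
      rw [add_comm]
      exact add_left_cancel this
  · intro e he
    induction e using Sym2.inductionOn with
    | hf y z =>
      rw [mem_coe, mem_bonds hr] at he
      obtain ⟨⟨h1, h2⟩, h3⟩ := he
      obtain ⟨i, h | h⟩ := lattice_adj_iff.1 h3 <;> subst h
      · refine ⟨(y - x₀, i), ?_, ?_⟩
        · rw [mem_coe, mem_edges]
          refine ⟨h1, ?_⟩
          have : y + step i - x₀ = y - x₀ + step i := by abel
          rwa [this] at h2
        · simp
      · refine ⟨(y - step i - x₀, i), ?_, ?_⟩
        · rw [mem_coe, mem_edges]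
          refine ⟨h2, ?_⟩
          have : y - step i - x₀ + step i = y - x₀ := by abel
          simp only [this]
          exact h1
        · simp [Sym2.eq_swap]

theorem card_bonds {d : ℕ} (x₀ : Fin d → ℤ) {r : ℝ} (hd : 1 ≤ d) (hr : 1 ≤ r) :
    0 < (bonds (box x₀ r)).card ∧
      ((bonds (box x₀ r)).card : ℝ) ≤ d * 3 ^ d * (⌊r⌋₊ : ℝ) ^ d := by
  have hr0 : 0 ≤ r := by linarith
  have hN : 1 ≤ ⌊r⌋₊ := (Nat.one_le_floor_iff r).2 hr
  have h := sum_bonds x₀ hr0 fun _ => (1 : ℝ)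
  rw [sum_const, nsmul_one] at h
  constructor
  · have h0 : ((0, ⟨0, hd⟩) : (Fin d → ℤ) × Fin d) ∈ edges (Fin d) ⌊r⌋₊ := by
      rw [edges, mem_filter, mem_product]
      refine ⟨⟨mem_cube.2 fun i => by simp, mem_univ _⟩, ?_⟩
      simp only [Pi.zero_apply]
      omega
    have : (0 : ℝ) < (bonds (box x₀ r)).card := by
      rw [h, esum_eq, sum_const, nsmul_one]
      exact_mod_cast card_pos.2 ⟨_, h0⟩
    exact_mod_cast this
  · rw [h]
    refine (esum_left_le (f := fun _ => (1 : ℝ)) _ fun _ => zero_le_one).trans ?_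
    rw [sum_const, card_cube, nsmul_one, Fintype.card_fin, mul_assoc, ← mul_pow]
    push_cast
    have : (1 : ℝ) ≤ ⌊r⌋₊ := by exact_mod_cast hN
    gcongr
    linarith

/-- Jensen's inequality: averaged norms of a positive function and of its inverse. -/
theorem one_le_average_rpow_mul {κ : Type*} {s : Finset κ} (hs : 0 < s.card) {f : κ → ℝ}
    (hf : ∀ e ∈ s, 0 < f e) {p q : ℝ} (hp : 1 ≤ p) (hq : 1 ≤ q) :
    1 ≤ ((s.card : ℝ)⁻¹ * ∑ e ∈ s, |(f e)⁻¹| ^ q) ^ (1 / q) *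
      ((s.card : ℝ)⁻¹ * ∑ e ∈ s, |f e| ^ p) ^ (1 / p) := by
  have hc : (0 : ℝ) < s.card := by exact_mod_cast hs
  have key : ∀ (g : κ → ℝ) (r : ℝ), (∀ e ∈ s, 0 < g e) → 1 ≤ r →
      (s.card : ℝ)⁻¹ * ∑ e ∈ s, g e ≤ ((s.card : ℝ)⁻¹ * ∑ e ∈ s, |g e| ^ r) ^ (1 / r) := by
    intro g r hg hr
    have := Real.arith_mean_le_rpow_mean s (fun _ => (s.card : ℝ)⁻¹) g (fun _ _ => by positivity)
      (by rw [sum_const, nsmul_eq_mul, mul_inv_cancel₀ hc.ne']) (fun e he => (hg e he).le) hr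
    rw [← mul_sum, ← mul_sum] at this
    rwa [sum_congr rfl fun e he => congrArg (· ^ r) (abs_of_pos (hg e he))]
  have h1 := key f p hf hp
  have h2 := key (fun e => (f e)⁻¹) q (fun e he => inv_pos.2 (hf e he)) hq
  -- Cauchy–Schwarz for `1 = f⁻¹ f` compares the two arithmetic means, which are below the power
  -- means.
  have h3 : (s.card : ℝ) ^ 2 ≤ (∑ e ∈ s, (f e)⁻¹) * ∑ e ∈ s, f e := by
    have := sum_sq_le_sum_mul_sum_of_sq_le_mul s (r := fun _ => (1 : ℝ)) (f := fun e => (f e)⁻¹)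
      (g := f) (fun e he => (inv_pos.2 (hf e he)).le) (fun e he => (hf e he).le)
      (fun e he => by rw [inv_mul_cancel₀ (hf e he).ne', one_pow])
    simpa using this
  have h4 : 0 ≤ ∑ e ∈ s, f e := sum_nonneg fun e he => (hf e he).le
  have h5 : 0 ≤ ∑ e ∈ s, (f e)⁻¹ := sum_nonneg fun e he => (inv_pos.2 (hf e he)).le
  calc (1 : ℝ) = (s.card : ℝ)⁻¹ ^ 2 * (s.card : ℝ) ^ 2 := by field_simp
    _ ≤ (s.card : ℝ)⁻¹ ^ 2 * ((∑ e ∈ s, (f e)⁻¹) * ∑ e ∈ s, f e) := by gcongr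
    _ = ((s.card : ℝ)⁻¹ * ∑ e ∈ s, (f e)⁻¹) * ((s.card : ℝ)⁻¹ * ∑ e ∈ s, f e) := by ring
    _ ≤ _ := by gcongr

end RCM

/-! ### Rescaling in time and verification of the hypotheses -/

namespace RCM

open Finset MeasureTheory

/-- The conductances around `x₀` in the coordinate form, with time measured in units of `τ`. -/
def localConductance {d : ℕ} (ω : Sym2 (Fin d → ℤ) → ℝ) (x₀ : Fin d → ℤ) (τ : ℝ)
    (x : Fin d → ℤ) (i : Fin d) : ℝ := τ * ω s(x₀ + x, x₀ + x + step i)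

theorem localConductance_pos {d : ℕ} {ω : Sym2 (Fin d → ℤ) → ℝ} (hω : IsConductance ω)
    (x₀ : Fin d → ℤ) {τ : ℝ} (hτ : 0 < τ) (x : Fin d → ℤ) (i : Fin d) :
    0 < localConductance ω x₀ τ x i :=
  mul_pos hτ (hω _ (lattice_adj_add_step _ _))

theorem sum_bonds_pos {d : ℕ} {ω : Sym2 (Fin d → ℤ) → ℝ} (hω : IsConductance ω)
    (S : Finset (Fin d → ℤ)) : ∀ e ∈ bonds S, 0 < ω e := fun e he => by
  classical
  rw [bonds, mem_filter] at he
  exact hω e he.2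

theorem sum_rpow_eq_bondNorm {d : ℕ} {S : Finset (Fin d → ℤ)} (hS : 0 < (bonds S).card)
    {r : ℝ} (hr : 0 < r) (F : Sym2 (Fin d → ℤ) → ℝ) :
    ∑ e ∈ bonds S, |F e| ^ r = (bonds S).card * bondNorm r S F ^ r := by
  have hc : (0 : ℝ) < (bonds S).card := by exact_mod_cast hS
  have : 0 ≤ ∑ e ∈ bonds S, |F e| ^ r := sum_nonneg fun _ _ => by positivity
  rw [bondNorm, ← Real.rpow_mul (by positivity), one_div_mul_cancel hr.ne', Real.rpow_one]
  field_simp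

theorem bondNorm_nonneg {d : ℕ} (r : ℝ) (S : Finset (Fin d → ℤ)) (F : Sym2 (Fin d → ℤ) → ℝ) :
    0 ≤ bondNorm r S F :=
  Real.rpow_nonneg (mul_nonneg (by positivity) (sum_nonneg fun _ _ => by positivity)) _

/-- The box has at most `d 3^d N^d` bonds, and as `r ≥ 1` the constant may be moved inside the
`r`-th power. -/
theorem esum_rpow_le_bondNorm {d : ℕ} (hd : 1 ≤ d) (x₀ : Fin d → ℤ) {n : ℝ} (hn : 1 ≤ n)
    {r : ℝ} (hr : 1 ≤ r) {F : Sym2 (Fin d → ℤ) → ℝ} {σ : ℝ} (hσ : 0 < σ)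
    (hF : ∀ x i, 0 < F s(x, x + step i)) :
    (esum ⌊n⌋₊ fun x i => (σ * F s(x₀ + x, x₀ + x + step i)) ^ r) ≤
      (⌊n⌋₊ : ℝ) ^ d * (d * 3 ^ d * (σ * bondNorm r (box x₀ n) F)) ^ r := by
  have hn0 : 0 ≤ n := by linarith
  obtain ⟨h1, h2⟩ := card_bonds x₀ hd hn
  have hb := bondNorm_nonneg r (box x₀ n) F
  have e1 : (esum ⌊n⌋₊ fun x i => (σ * F s(x₀ + x, x₀ + x + step i)) ^ r) =
      σ ^ r * ∑ e ∈ bonds (box x₀ n), |F e| ^ r := by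
    rw [sum_bonds x₀ hn0, ← esum_mul_left]
    congr 1
    funext x i
    rw [Real.mul_rpow hσ.le (hF _ _).le, abs_of_pos (hF _ _)]
  have hc : (1 : ℝ) ≤ d * 3 ^ d :=
    one_le_mul_of_one_le_of_one_le (by exact_mod_cast hd) (one_le_pow₀ (by norm_num))
  have e2 : (d * 3 ^ d : ℝ) ≤ (d * 3 ^ d) ^ r := by
    calc (d * 3 ^ d : ℝ) = (d * 3 ^ d) ^ (1 : ℝ) := (Real.rpow_one _).symm
      _ ≤ _ := Real.rpow_le_rpow_of_exponent_le hc hr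
  rw [e1, sum_rpow_eq_bondNorm h1 (by linarith), Real.mul_rpow (by positivity) (by positivity),
    Real.mul_rpow hσ.le hb]
  calc σ ^ r * ((bonds (box x₀ n)).card * bondNorm r (box x₀ n) F ^ r)
      ≤ σ ^ r * ((d * 3 ^ d) ^ r * (⌊n⌋₊ : ℝ) ^ d * bondNorm r (box x₀ n) F ^ r) := by
        have := h2.trans (mul_le_mul_of_nonneg_right e2 (by positivity))
        gcongr
    _ = _ := by ring

/-- In time units of `τ` the conductances become `τ ω`, so the two norms acquire the factors `τ` and
`τ⁻¹`, which cancel in their product. By Jensen's inequality that product is at least one. -/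
theorem momentBound_localConductance {d : ℕ} (hd : 1 ≤ d) {p q : ℝ} (hp : 1 ≤ p) (hq : 1 ≤ q)
    {ω : Sym2 (Fin d → ℤ) → ℝ} (hω : IsConductance ω) (x₀ : Fin d → ℤ) {τ n : ℝ} (hτ : 0 < τ)
    (hn : 1 ≤ n) :
    0 < bondNorm q (box x₀ n) (fun e => (ω e)⁻¹) ∧
    1 ≤ τ⁻¹ * bondNorm q (box x₀ n) (fun e => (ω e)⁻¹) * (1 + τ * bondNorm p (box x₀ n) ω) ∧
    MomentBound p q (localConductance ω x₀ τ) ⌊n⌋₊ (d * 3 ^ d * (τ * bondNorm p (box x₀ n) ω))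
      (d * 3 ^ d * (τ⁻¹ * bondNorm q (box x₀ n) (fun e => (ω e)⁻¹))) := by
  obtain ⟨h1, h2⟩ := card_bonds x₀ hd hn
  have hω' : ∀ x i, 0 < ω s(x, x + step i) := fun x i => hω _ (lattice_adj_add_step _ _)
  have hJ := one_le_average_rpow_mul h1 (sum_bonds_pos hω (box x₀ n)) hp hq
  have hP := bondNorm_nonneg p (box x₀ n) ω
  have hQ := bondNorm_nonneg q (box x₀ n) fun e => (ω e)⁻¹
  have l1 := esum_rpow_le_bondNorm hd x₀ hn hp hτ hω'
  have l2 := esum_rpow_le_bondNorm hd x₀ hn hq (F := fun e => (ω e)⁻¹) (inv_pos.2 hτ)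
    fun x i => inv_pos.2 (hω' x i)
  change 1 ≤ bondNorm q (box x₀ n) (fun e => (ω e)⁻¹) * bondNorm p (box x₀ n) ω at hJ
  set Λp := bondNorm p (box x₀ n) ω
  set Λq := bondNorm q (box x₀ n) fun e => (ω e)⁻¹
  have hQ0 : 0 < Λq := by
    rcases hQ.eq_or_lt with h | h
    · rw [← h, zero_mul] at hJ; linarith
    · exact h
  have hA : 1 ≤ τ⁻¹ * Λq * (1 + τ * Λp) := by
    have : τ⁻¹ * Λq * (1 + τ * Λp) = τ⁻¹ * Λq + Λq * Λp := by field_simp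
    have : 0 ≤ τ⁻¹ * Λq := by positivity
    linarith
  have hc : (1 : ℝ) ≤ d * 3 ^ d :=
    one_le_mul_of_one_le_of_one_le (by exact_mod_cast hd) (one_le_pow₀ (by norm_num))
  refine ⟨hQ0, hA, ⟨fun x i => localConductance_pos hω x₀ hτ x i, by positivity, by positivity, ?_,
    ?_, ?_⟩⟩
  · refine hA.trans ?_
    have h3 : τ * Λp ≤ d * 3 ^ d * (τ * Λp) := le_mul_of_one_le_left (by positivity) hc
    have h4 : τ⁻¹ * Λq ≤ d * 3 ^ d * (τ⁻¹ * Λq) := le_mul_of_one_le_left (by positivity) hc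
    gcongr
  · rw [Fintype.card_fin]; exact l1
  · rw [Fintype.card_fin]
    refine le_trans (le_of_eq ?_) l2
    congr 1
    funext x i
    rw [localConductance, mul_inv]

/-- The function `u` in the rescaled time `s = (t - t₀) / τ`, clamped to `[-N², 0]`, around `x₀`
and extended by zero outside the cube of radius `N`. -/
noncomputable def rescale {d : ℕ} (u : ℝ → (Fin d → ℤ) → ℝ) (t₀ : ℝ) (x₀ : Fin d → ℤ) (τ : ℝ)
    (N : ℕ) (s : ℝ) (x : Fin d → ℤ) : ℝ :=
  if x ∈ cube (Fin d) N then u (t₀ + τ * max (-(N : ℝ) ^ 2) (min s 0)) (x₀ + x) else 0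

theorem rescale_eq {d : ℕ} (u : ℝ → (Fin d → ℤ) → ℝ) (t₀ : ℝ) (x₀ : Fin d → ℤ) (τ : ℝ)
    {N : ℕ} {s : ℝ} {x : Fin d → ℤ} (hs : s ∈ Set.Icc (-(N : ℝ) ^ 2) 0) (hx : x ∈ cube (Fin d) N) :
    rescale u t₀ x₀ τ N s x = u (t₀ + τ * s) (x₀ + x) := by
  rw [rescale, if_pos hx, min_eq_left hs.2, max_eq_right hs.1]

theorem time_mem {t₀ τ n s : ℝ} {N : ℕ} (hτ : 0 < τ) (hN : (N : ℝ) ≤ n)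
    (hs : s ∈ Set.Icc (-(N : ℝ) ^ 2) 0) : t₀ + τ * s ∈ timeInterval 1 t₀ τ n := by
  have h1 : (N : ℝ) ^ 2 ≤ n ^ 2 := by gcongr
  have h2 : τ * (-n ^ 2) ≤ τ * s := by gcongr; linarith [hs.1]
  have h3 : τ * s ≤ 0 := mul_nonpos_of_nonneg_of_nonpos hτ.le hs.2
  exact ⟨by linarith, by linarith⟩

theorem IsSubcaloric.continuousOn {d : ℕ} {ω : Sym2 (Fin d → ℤ) → ℝ}
    {u : ℝ → (Fin d → ℤ) → ℝ} {I : Set ℝ} {S : Finset (Fin d → ℤ)} (h : IsSubcaloric ω u I S)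
    {x : Fin d → ℤ} (hx : x ∈ S) : ContinuousOn (fun t => u t x) I :=
  fun t ht => (h t ht x hx).1.continuousWithinAt

theorem isSubsol_rescale {d : ℕ} {ω : Sym2 (Fin d → ℤ) → ℝ} {u : ℝ → (Fin d → ℤ) → ℝ}
    {t₀ τ n : ℝ} {x₀ : Fin d → ℤ} (hτ : 0 < τ) (hn : 1 ≤ n)
    (hu : ∀ t ∈ timeInterval 1 t₀ τ n, ∀ x ∈ box x₀ (1 * n), 0 < u t x)
    (h : IsSubcaloric ω u (timeInterval 1 t₀ τ n) (box x₀ (1 * n))) :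
    IsSubsol (localConductance ω x₀ τ) ⌊n⌋₊ (rescale u t₀ x₀ τ ⌊n⌋₊) := by
  rw [one_mul] at hu h
  have hn0 : 0 ≤ n := by linarith
  have hNn : ((⌊n⌋₊ : ℕ) : ℝ) ≤ n := Nat.floor_le hn0
  have hN1 : 1 ≤ ⌊n⌋₊ := (Nat.one_le_floor_iff n).2 hn
  set N := ⌊n⌋₊
  have hbox : ∀ {x}, x ∈ cube (Fin d) N → x₀ + x ∈ box x₀ n := fun {x} hx =>
    (mem_box_iff hn0).2 (by simpa using hx)
  have hclamp : ∀ s : ℝ, max (-(N : ℝ) ^ 2) (min s 0) ∈ Set.Icc (-(N : ℝ) ^ 2) 0 := fun s =>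
    ⟨le_max_left _ _, max_le (neg_nonpos.2 (sq_nonneg _)) (min_le_right _ _)⟩
  refine ⟨fun x => ?_, fun t x => ?_, fun t ht x hx => ?_⟩
  -- Clamping the time keeps the argument inside the interval, so continuity of `u` there yields
  -- continuity for all times.
  · by_cases hx : x ∈ cube (Fin d) N
    · simp only [rescale, if_pos hx]
      refine (h.continuousOn (hbox hx)).comp_continuous (by fun_prop) fun s => ?_
      exact time_mem hτ hNn (hclamp s)
    · simp only [rescale, if_neg hx]; exact continuous_const
  · rw [rescale]
    split_ifs with hx
    · exact (hu _ (time_mem hτ hNn (hclamp t)) _ (hbox hx)).le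
    · exact le_rfl
  · have htI : t ∈ Set.Icc (-(N : ℝ) ^ 2) 0 := Set.Ioo_subset_Icc_self ht
    have hxN : x ∈ cube (Fin d) N := cube_mono (Nat.sub_le _ _) hx
    have hxp : ∀ i, x + step i ∈ cube (Fin d) N := fun i =>
      add_step_mem hxN (by have := (mem_cube.1 hx i).2; omega)
    have hxm : ∀ i, x - step i ∈ cube (Fin d) N := fun i => by
      rw [mem_cube]
      intro j
      have h1 := mem_cube.1 hx j
      rw [Pi.sub_apply]
      by_cases hj : j = i
      · subst hj; rw [step_same]; omega
      · rw [step_ne hj]; omega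
    -- At interior times the interval is a neighbourhood, so the one-sided derivative is the
    -- ordinary one.
    have hmem : timeInterval 1 t₀ τ n ∈ nhds (t₀ + τ * t) := by
      have h1 : (N : ℝ) ^ 2 ≤ n ^ 2 := by gcongr
      have h2 : τ * (-n ^ 2) < τ * t := mul_lt_mul_of_pos_left (by linarith [ht.1]) hτ
      have h3 : τ * t < 0 := mul_neg_of_pos_of_neg hτ ht.2
      exact Icc_mem_nhds (by linarith) (by linarith)
    obtain ⟨d1, d2⟩ := h _ (time_mem hτ hNn htI) _ (hbox hxN)
    rw [derivWithin_of_mem_nhds hmem] at d2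
    have d3 := (d1.differentiableAt hmem).hasDerivAt
    have d4 : HasDerivAt (fun s => t₀ + τ * s) τ t := by
      simpa using ((hasDerivAt_id t).const_mul τ).const_add t₀
    refine ⟨_, (d3.comp t d4).congr_of_eventuallyEq ?_, ?_⟩
    · filter_upwards [Icc_mem_nhds ht.1 ht.2] with s hs
      exact rescale_eq u t₀ x₀ τ hs hxN
    · have e : lap (localConductance ω x₀ τ) (rescale u t₀ x₀ τ N t) x =
          τ * generator ω (u (t₀ + τ * t)) (x₀ + x) := by
        rw [lap, generator_eq, mul_sum]
        refine sum_congr rfl fun i _ => ?_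
        rw [rescale_eq u t₀ x₀ τ htI hxN, rescale_eq u t₀ x₀ τ htI (hxp i),
          rescale_eq u t₀ x₀ τ htI (hxm i), localConductance, localConductance, add_assoc,
          add_assoc, ← add_sub_assoc x₀ x, sub_add_cancel]
        ring
      rw [e, mul_comm]
      have : deriv (fun s => u s (x₀ + x)) (t₀ + τ * t) ≤
          generator ω (u (t₀ + τ * t)) (x₀ + x) := by linarith
      gcongr

/-- A change of variables in time, followed by comparing normalisations: `n ≤ 2N` gives the 4 and
`2N + 1 ≤ 3N` gives `3^d`. -/
theorem mass_rescale_le {d : ℕ} {ω : Sym2 (Fin d → ℤ) → ℝ} {u : ℝ → (Fin d → ℤ) → ℝ}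
    {t₀ τ n : ℝ} {x₀ : Fin d → ℤ} (hτ : 0 < τ) (hn : 1 ≤ n)
    (h : IsSubcaloric ω u (timeInterval 1 t₀ τ n) (box x₀ (1 * n))) :
    mass ⌊n⌋₊ (rescale u t₀ x₀ τ ⌊n⌋₊) ⌊n⌋₊ / (⌊n⌋₊ : ℝ) ^ (d + 2) ≤
      4 * 3 ^ d * avgL2Norm u (timeInterval 1 t₀ τ n) (box x₀ (1 * n)) ^ 2 := by
  rw [one_mul] at h ⊢
  have hn0 : 0 ≤ n := by linarith
  have hNn : ((⌊n⌋₊ : ℕ) : ℝ) ≤ n := Nat.floor_le hn0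
  have hnN : n < (⌊n⌋₊ : ℕ) + 1 := Nat.lt_floor_add_one n
  have hN1 : 1 ≤ ⌊n⌋₊ := (Nat.one_le_floor_iff n).2 hn
  have hcard := card_box x₀ hn0
  have hsum := fun f : (Fin d → ℤ) → ℝ => sum_box (x₀ := x₀) hn0 f
  set N := ⌊n⌋₊
  have hN1' : (1 : ℝ) ≤ N := by exact_mod_cast hN1
  have hN0 : (0 : ℝ) < N := by linarith
  set f : ℝ → ℝ := fun t => ∑ y ∈ box x₀ n, |u t y| ^ 2 with hf
  have hf0 : ∀ t, 0 ≤ f t := fun t => sum_nonneg fun y _ => by positivity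
  have hfc : ContinuousOn f (timeInterval 1 t₀ τ n) :=
    continuousOn_finsetSum _ fun y hy => ((h.continuousOn hy).abs).pow 2
  have hfi : IntegrableOn f (timeInterval 1 t₀ τ n) := hfc.integrableOn_compact isCompact_Icc
  have hle : -(N * N : ℝ) ≤ 0 := by rw [neg_nonpos]; positivity
  have m1 : mass N (rescale u t₀ x₀ τ N) N = ∫ s in (-(N * N : ℝ))..0, f (t₀ + τ * s) := by
    rw [mass]
    refine intervalIntegral.integral_congr fun s hs => ?_
    rw [Set.uIcc_of_le hle, ← sq] at hs
    simp only [hf, hsum, sq_abs]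
    exact sum_congr rfl fun x hx => by rw [rescale_eq u t₀ x₀ τ hs hx]
  have m2 : ∫ s in (-(N * N : ℝ))..0, f (t₀ + τ * s) =
      τ⁻¹ * ∫ t in (t₀ + τ * (-(N * N)))..(t₀ + τ * 0), f t := by
    rw [intervalIntegral.integral_comp_add_mul f hτ.ne', smul_eq_mul]
  have m3 : ∫ t in (t₀ + τ * (-(N * N)))..(t₀ + τ * 0), f t ≤ ∫ t in timeInterval 1 t₀ τ n, f t := by
    rw [intervalIntegral.integral_of_le (by gcongr)]
    refine setIntegral_mono_set hfi (Filter.Eventually.of_forall hf0) (LE.le.eventuallyLE ?_)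
    refine Set.Ioc_subset_Icc_self.trans (Set.Icc_subset_Icc ?_ (by simp))
    have : (N * N : ℝ) ≤ n ^ 2 := by rw [← sq]; gcongr
    have : τ * (N * N : ℝ) ≤ τ * n ^ 2 := by gcongr
    linarith
  set Z := ∫ t in timeInterval 1 t₀ τ n, f t with hZ
  have hZ0 : 0 ≤ Z := setIntegral_nonneg measurableSet_Icc fun t _ => hf0 t
  have hvol : volume.real (timeInterval 1 t₀ τ n) = τ * n ^ 2 := by
    rw [timeInterval, Real.volume_real_Icc_of_le (by have : 0 ≤ τ * n ^ 2 := by positivity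
                                                     linarith)]
    ring
  have ha : avgL2Norm u (timeInterval 1 t₀ τ n) (box x₀ n) ^ 2 =
      (τ * n ^ 2 * (2 * N + 1) ^ d)⁻¹ * Z := by
    rw [avgL2Norm, Real.sq_sqrt (by positivity), hvol, hcard]
  rw [m1, m2, ha, div_le_iff₀ (by positivity)]
  have hn2 : n ^ 2 ≤ 4 * (N : ℝ) ^ 2 := by
    have : n ≤ 2 * N := by linarith
    calc n ^ 2 ≤ (2 * N : ℝ) ^ 2 := by gcongr
      _ = _ := by ring
  have h3 : (2 * N + 1 : ℝ) ^ d ≤ 3 ^ d * N ^ d := by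
    rw [← mul_pow]; gcongr; linarith
  have hX : 0 < n ^ 2 * (2 * N + 1 : ℝ) ^ d := by positivity
  calc τ⁻¹ * ∫ t in (t₀ + τ * (-(N * N)))..(t₀ + τ * 0), f t ≤ τ⁻¹ * Z := by gcongr
    _ = (n ^ 2 * (2 * N + 1 : ℝ) ^ d) * ((τ * n ^ 2 * (2 * N + 1) ^ d)⁻¹ * Z) := by field_simp
    _ ≤ (4 * (N : ℝ) ^ 2 * (3 ^ d * N ^ d)) * ((τ * n ^ 2 * (2 * N + 1) ^ d)⁻¹ * Z) := by gcongr
    _ = _ := by ring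

end RCM

/-! ### The local boundedness estimate -/

theorem theorem3 (d : ℕ) (hd : 2 ≤ d) (p q : ℝ) (hp : 1 < p) (hq : (d : ℝ) / 2 < q)
    (hpq : 1 / p + 1 / q < 2 / ((d : ℝ) - 1)) :
    (0 < RCM.nu d p q ∧ RCM.nu d p q < 1) ∧
    ∃ c : ℝ, 1 ≤ c ∧
      ∀ ω : Sym2 (Fin d → ℤ) → ℝ, RCM.IsConductance ω →
      ∀ (t₀ : ℝ) (x₀ : Fin d → ℤ) (τ n : ℝ), 0 < τ → 2 ^ 20 ≤ n →
      ∀ u : ℝ → (Fin d → ℤ) → ℝ,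
        (∀ t ∈ RCM.timeInterval 1 t₀ τ n, ∀ x ∈ RCM.box x₀ (1 * n), 0 < u t x) →
        RCM.IsSubcaloric ω u (RCM.timeInterval 1 t₀ τ n) (RCM.box x₀ (1 * n)) →
        BddAbove (RCM.absValues u (RCM.timeInterval (1 / 2) t₀ τ n) (RCM.box x₀ (1 / 2 * n))) ∧
        RCM.supNorm u (RCM.timeInterval (1 / 2) t₀ τ n) (RCM.box x₀ (1 / 2 * n)) ≤
          c * RCM.boundConst p q ω (RCM.box x₀ n) τ ^ (p / (p - 1)) *
            RCM.avgL2Norm u (RCM.timeInterval 1 t₀ τ n) (RCM.box x₀ (1 * n)) := by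

  obtain ⟨D, rfl⟩ : ∃ D, d = D + 1 := ⟨d - 1, by omega⟩
  have hD : 1 ≤ D := by omega
  obtain ⟨⟨β, hE, hβ0, hβ1, he⟩, hδ0, hδ1, hδ, hcmp⟩ := RCM.exists_interpExponents hD hp hq hpq
  have hq1 := hE.2.1
  have hθ := hE.2.2.1
  have hθi : 0 < 1 - 1 / RCM.theta (D + 1) p q := by
    rw [sub_pos, div_lt_one (by linarith)]; exact hθ
  have hθi1 : 1 - 1 / RCM.theta (D + 1) p q < 1 := by
    have : 0 < 1 / RCM.theta (D + 1) p q := by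
      have : 0 < RCM.theta (D + 1) p q := by linarith
      positivity
    linarith
  obtain ⟨C, hC, hmax⟩ := RCM.exists_maximal_inequality hE hβ0 hβ1 he hδ0 hδ1 hδ
  have hα0 := mul_pos hδ0 hθi
  have hα1 : RCM.delta₂ (D + 1) q * (1 - 1 / RCM.theta (D + 1) p q) < 1 :=
    mul_lt_one_of_nonneg_of_lt_one_left hδ0.le hδ1 hθi1.le
  have hν : RCM.nu (D + 1) p q =
    1 - RCM.delta₂ (D + 1) q * (1 - 1 / RCM.theta (D + 1) p q) := rfl
  set δ := RCM.delta₂ (D + 1) q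
  set θ := RCM.theta (D + 1) p q
  refine ⟨⟨by rw [hν]; linarith, by rw [hν]; linarith⟩, ?_⟩
  have h3 : (1 : ℝ) ≤ 3 ^ (D + 1) := one_le_pow₀ (by norm_num)
  set c₀ : ℝ := (D + 1 : ℕ) * 3 ^ (D + 1) with hc₀
  have hc₀1 : 1 ≤ c₀ := one_le_mul_of_one_le_of_one_le (by exact_mod_cast (by omega)) h3
  set C₂ : ℝ := (c₀ * (c₀ * (c₀ * c₀) ^ (1 / (θ - 1))) ^ (1 + δ)) ^ (1 / δ) with hC₂
  have hC₂1 : 1 ≤ C₂ := by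
    have hθ1 : 0 < θ - 1 := by linarith
    refine Real.one_le_rpow (one_le_mul_of_one_le_of_one_le hc₀1 (Real.one_le_rpow
      (one_le_mul_of_one_le_of_one_le hc₀1 (Real.one_le_rpow
      (one_le_mul_of_one_le_of_one_le hc₀1 hc₀1) (by positivity))) (by linarith))) (by positivity)
  have h43 : (1 : ℝ) ≤ 4 * 3 ^ (D + 1) := by linarith
  have hc : 1 ≤ C * C₂ * (4 * 3 ^ (D + 1)) :=
    one_le_mul_of_one_le_of_one_le (one_le_mul_of_one_le_of_one_le hC hC₂1) h43
  refine ⟨C * C₂ * (4 * 3 ^ (D + 1)), hc, ?_⟩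
  intro ω hω t₀ x₀ τ n hτ hn u hu hsub
  have hn1 : 1 ≤ n := le_trans (by norm_num) hn
  have hn0 : 0 ≤ n := by linarith
  obtain ⟨hΛq, hA, hL⟩ := RCM.momentBound_localConductance (by omega : 1 ≤ D + 1) hp.le hq1.le hω
    x₀ hτ hn1
  have hv := RCM.isSubsol_rescale hτ hn1 hu hsub
  have hmass := RCM.mass_rescale_le hτ hn1 hsub
  have hΛp := RCM.bondNorm_nonneg p (RCM.box x₀ n) ω
  have hnN : n < (⌊n⌋₊ : ℕ) + 1 := Nat.lt_floor_add_one n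
  have hN20 : 2 ^ 20 ≤ ⌊n⌋₊ := Nat.le_floor (by exact_mod_cast hn)
  have hN8 : 8 ≤ ⌊n⌋₊ := le_trans (by norm_num) hN20
  have hpt := hmax _ _ _ _ hL hN8 _ hv
  have hgain := RCM.gain_factor_le hθ hδ0 hp hc₀1 (mul_nonneg hτ.le hΛp)
    (mul_pos (inv_pos.2 hτ) hΛq) hA hcmp
  rw [← RCM.scaled_const_eq hα0 hτ hΛp hΛq] at hgain
  -- Since `ν = 1 - δ(1 - 1/θ)`, this is the second entry of the maximum in the constant.
  have hB : τ ^ (1 / 2 : ℝ) * (RCM.bondNorm q (RCM.box x₀ n) (fun e => (ω e)⁻¹) *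
      (RCM.bondNorm p (RCM.box x₀ n) ω + τ⁻¹) ^ (1 + δ * (1 - 1 / θ))) ^
      (1 / (2 * (δ * (1 - 1 / θ)))) ≤ RCM.boundConst p q ω (RCM.box x₀ n) τ := by
    rw [RCM.boundConst, hν, show 2 - (1 - δ * (1 - 1 / θ)) = 1 + δ * (1 - 1 / θ) by ring,
      show 1 - (1 - δ * (1 - 1 / θ)) = δ * (1 - 1 / θ) by ring]
    exact le_max_right _ _
  have hB1 : 1 ≤ RCM.boundConst p q ω (RCM.box x₀ n) τ := le_max_left _ _
  set B := RCM.boundConst p q ω (RCM.box x₀ n) τ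
  set U := RCM.avgL2Norm u (RCM.timeInterval 1 t₀ τ n) (RCM.box x₀ (1 * n)) with hU
  have hU0 : 0 ≤ U := Real.sqrt_nonneg _
  have hp0 : 0 < p - 1 := by linarith
  have key : ∀ t ∈ RCM.timeInterval (1 / 2) t₀ τ n, ∀ x ∈ RCM.box x₀ (1 / 2 * n),
      |u t x| ≤ C * C₂ * (4 * 3 ^ (D + 1)) * B ^ (p / (p - 1)) * U := by
    intro t ht x hx
    have hNR : (2 ^ 20 : ℝ) ≤ ⌊n⌋₊ := by exact_mod_cast hN20
    -- Although `N` is only the integer part of `n`, `n ≥ 2^20` leaves ample room for half of the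
    -- cylinder of size `n` in three quarters of that of size `N`.
    have hs : (t - t₀) / τ ∈ Set.Icc (-(3 / 4 * (⌊n⌋₊ : ℝ) ^ 2)) 0 := by
      constructor
      · rw [le_div_iff₀ hτ]
        have h1 : n ^ 2 ≤ ((⌊n⌋₊ : ℝ) + 1) ^ 2 := by gcongr
        have h2 : (2 ^ 20 : ℝ) * ⌊n⌋₊ ≤ ⌊n⌋₊ * ⌊n⌋₊ := by gcongr
        have h3 : 1 / 2 * n ^ 2 ≤ 3 / 4 * (⌊n⌋₊ : ℝ) ^ 2 := by nlinarith
        have h4 : 1 / 2 * n ^ 2 * τ ≤ 3 / 4 * (⌊n⌋₊ : ℝ) ^ 2 * τ := by gcongr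
        have h5 := ht.1
        linarith
      · exact div_nonpos_of_nonpos_of_nonneg (by linarith [ht.2]) hτ.le
    have hs' : (t - t₀) / τ ∈ Set.Icc (-(⌊n⌋₊ : ℝ) ^ 2) 0 :=
      ⟨by linarith [hs.1, sq_nonneg (⌊n⌋₊ : ℝ)], hs.2⟩
    have hxc := (RCM.mem_box_iff (by positivity)).1 hx
    have hf : ((⌊1 / 2 * n⌋₊ : ℕ) : ℝ) ≤ 1 / 2 * n := Nat.floor_le (by positivity)
    have hxN : x - x₀ ∈ RCM.cube (Fin (D + 1)) ⌊n⌋₊ :=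
      RCM.cube_mono (Nat.floor_le_floor (by linarith)) hxc
    have hxb : ∀ i, |((x - x₀) i : ℝ)| ≤ 3 / 4 * ⌊n⌋₊ := fun i => by
      have h1 : |(x - x₀) i| ≤ (⌊1 / 2 * n⌋₊ : ℤ) := abs_le.2 (RCM.mem_cube.1 hxc i)
      have h2 : |((x - x₀) i : ℝ)| ≤ (⌊1 / 2 * n⌋₊ : ℝ) := by exact_mod_cast h1
      linarith
    have h1 := hpt _ hs _ hxb
    rw [RCM.rescale_eq u t₀ x₀ τ hs' hxN, mul_div_cancel₀ _ hτ.ne', add_sub_cancel,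
      add_sub_cancel] at h1
    have hy0 : 0 ≤ RCM.mass ⌊n⌋₊ (RCM.rescale u t₀ x₀ τ ⌊n⌋₊) ⌊n⌋₊ / (⌊n⌋₊ : ℝ) ^ (D + 3) :=
      div_nonneg (RCM.mass_nonneg _ _ _) (by positivity)
    set T := τ ^ (1 / 2 : ℝ) * (RCM.bondNorm q (RCM.box x₀ n) (fun e => (ω e)⁻¹) *
      (RCM.bondNorm p (RCM.box x₀ n) ω + τ⁻¹) ^ (1 + δ * (1 - 1 / θ))) ^
      (1 / (2 * (δ * (1 - 1 / θ))))
    have hT0 : 0 ≤ T := by positivity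
    have h2 : (T ^ 2) ^ (p / (p - 1)) ≤ (B ^ (p / (p - 1))) ^ 2 := by
      rw [← Real.rpow_pow_comm (by linarith)]
      gcongr
    have h6 : |u t x| ^ 2 ≤ (C * C₂ * (4 * 3 ^ (D + 1)) * B ^ (p / (p - 1)) * U) ^ 2 := by
      rw [sq_abs]
      calc u t x ^ 2 ≤ _ := h1
        _ ≤ C * (C₂ * (B ^ (p / (p - 1))) ^ 2) * (4 * 3 ^ (D + 1) * U ^ 2) := by
          have h5 := hgain.trans (mul_le_mul_of_nonneg_left h2 (by linarith))
          exact mul_le_mul (mul_le_mul_of_nonneg_left h5 (by linarith)) hmass hy0 (by positivity)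
        _ = (C * C₂ * (4 * 3 ^ (D + 1))) * (B ^ (p / (p - 1)) * U) ^ 2 := by ring
        -- The constant is at least one, so squaring it makes the right side a perfect square, and
        -- the root can be taken.
        _ ≤ (C * C₂ * (4 * 3 ^ (D + 1))) ^ 2 * (B ^ (p / (p - 1)) * U) ^ 2 := by
          gcongr
          exact le_self_pow₀ hc two_ne_zero
        _ = _ := by ring
    exact (pow_le_pow_iff_left₀ (abs_nonneg _) (by positivity) two_ne_zero).1 h6
  constructor
  · refine ⟨C * C₂ * (4 * 3 ^ (D + 1)) * B ^ (p / (p - 1)) * U, ?_⟩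
    rintro _ ⟨t, ht, x, hx, rfl⟩
    exact key t ht x hx
  -- For `Real.sSup_le` the bound must also be nonnegative, because of the default value of the
  -- supremum of an empty set.
  · refine Real.sSup_le ?_ (by positivity)
    rintro _ ⟨t, ht, x, hx, rfl⟩
    exact key t ht x hx
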